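/- **Setting.** Let $T>0$. Let $U$ be a reflexive separable real Banach space, $V,W$ real Hilbert spaces and $Z$ a real Banach space, with continuous dense embeddings $U\hookrightarrow V\hookrightarrow W\hookrightarrow Z$, the embedding $U\hookrightarrow W$ being compact. Identify $W$ with $W^*$, so that $Z^*\hookrightarrow W\hookrightarrow V^*\hookrightarrow U^*$. Let $\mathbb M\colon U^*\to U^*$ be a linear automorphism (bicontinuous) whose restriction to $W$ is a continuous, symmetric, positive-definite operator $W\to W$, and let $\mathbb V\colon V\to V^*$ be linear, continuous, symmetric and positive-definite; positive-definite means that $|w|_{\mathbb M}^2:=\langle\mathbb Mw,w\rangle_W$ and $|v|_{\mathbb V}^2:=\langle\mathbb Vv,v\rangle_V$ are squares of equivalent norms on $W$ and $V$. Let $\mathcal R\colon Z\to[0,+\infty)$ be convex and positively one-homogeneous, with $\rho_1\|z\|_Z\le\mathcal R(z)\le\rho_2\|z\|_Z$ for all $z\in Z$ and some constants $\rho_2\ge\rho_1>0$. Let $\mathcal E\colon[0,T]\times U\to[0,+\infty]$ have proper domain $[0,T]\times D$ with $\emptyset\ne D\subseteq U$, and assume: - (E1) $\mathcal E(t,\cdot)$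 is weakly lower semicontinuous on $U$ for every $t\in[0,T]$; - (E2) for every $u\in D$ the function $\mathcal E(\cdot,u)$ is absolutely continuous on $[0,T]$, and there is a nonnegative $b\in L^1(0,T)$ such that for a.e. $t\in[0,T]$ and for every $u\in D$ the derivative $\partial_t\mathcal E(t,u)$ exists and $|\partial_t\mathcal E(t,u)|\le b(t)(\mathcal E(t,u)+1)$; - (E3) the sublevels of $\mathcal E(0,\cdot)$ are bounded in $U$; - (E4) for every $M>0$ there are $\gamma_M\in L^1(0,T)$ and a modulus of continuity $\omega_M$ such that for a.e. $t\in[0,T]$ and all $u_1,u_2\in\{\mathcal E(0,\cdot)\le M\}$ one has $|\partial_t\mathcal E(t,u_1)-\partial_t\mathcal E(t,u_2)|\le\gamma_M(t)\,\omega_M(|u_1-u_2|_W)$; - (E5) with $\lambda=0$: $\mathcal E(t,\cdot)$ is convex on $U$ for every $t\in[0,T]$. Denote by $\partial^X$ the Fréchet subdifferential with respect to the topology of $X$, and set $\mathcal R_\varepsilon(v)=\frac\varepsilon2|v|_{\mathbb V}^2+\mathcal R(v)$ for $v\in V$, with Fenchel conjugate $\mathcal R_\varepsilon^*$ on $V^*$.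 For a Banach space $X$, $B([0,T];X)$ is the set of everywhere defined bounded measurable functions $[0,T]\to X$, $C_{\rm w}([0,T];X)$ is its subset of weakly continuous functions, and $C^1_{\rm w}$ is the set of functions that are weakly differentiable at every time with derivative in $C_{\rm w}$. **Dissipative dynamic solutions.** Given $\varepsilon>0$, $u_0^\varepsilon\in D$, $u_1^\varepsilon\in V$, a function $u^\varepsilon\colon[0,T]\to D$ is a *dissipative dynamic solution* if - $u^\varepsilon\in C_{\rm w}([0,T];U)\cap W^{1,2}(0,T;V)\cap C^1_{\rm w}([0,T];W)\cap W^{2,2}(0,T;U^*)$ and $\mathcal E(\cdot,u^\varepsilon(\cdot))\in L^\infty(0,T)$; - $u^\varepsilon(0)=u_0^\varepsilon$ and $\dot u^\varepsilon(0)=u_1^\varepsilon$; - for a.e. $t\in[0,T]$ one has $\varepsilon^2\mathbb M\ddot u^\varepsilon(t)+\varepsilon\mathbb V\dot u^\varepsilon(t)+\eta^\varepsilon(t)+\xi^\varepsilon(t)=0$ in $U^*$, for some measurable $\eta^\varepsilon(t)\in\partial^Z\mathcal R(\dot u^\varepsilon(t))$ and $\xi^\varepsilon(t)\in\partial^U\mathcal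 E(t,u^\varepsilon(t))$; - there is a null set $N\subseteq(0,T]$ such that for all $t\in[0,T]\setminus N$ $$\frac{\varepsilon^2}2|\dot u^\varepsilon(t)|_{\mathbb M}^2+\mathcal E(t,u^\varepsilon(t))+\int_0^t\Big(\mathcal R_\varepsilon(\dot u^\varepsilon)+\mathcal R_\varepsilon^*(-\varepsilon^2\mathbb M\ddot u^\varepsilon-\xi^\varepsilon)\Big)\,dr=\frac{\varepsilon^2}2|u_1^\varepsilon|_{\mathbb M}^2+\mathcal E(0,u_0^\varepsilon)+\int_0^t\partial_t\mathcal E(r,u^\varepsilon(r))\,dr .$$ **Notation for limits.** For $u\in B([0,T];U)\cap BV([0,T];Z)$ let $u^\pm(t)$ be its one-sided limits in $Z$, with $u^-(0)=u(0)$ and $u^+(T)=u(T)$; $J_u$ is the set of discontinuity points of $u$ in $Z$, $J_u^{\rm e}=\{t\in J_u:u^+(t)\ne u^-(t)\}$, and $u_{\rm co}$ is the continuous part of $u$ in $Z$, i.e. $u$ minus its pure jump part. $V_{\mathcal R}(f;s,t)$ is the supremum of $\sum_k\mathcal R(f(t_k)-f(t_{k-1}))$ over the partitions $s=t_0<\dots<t_n=t$.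 **Theorem (convex case).** Let $\varepsilon_n>0$ with $\varepsilon_n\to0$ and, for each $n$, let $u^{\varepsilon_n}$ be a dissipative dynamic solution with parameter $\varepsilon_n$ and initial data $u_0^{\varepsilon_n}\in D$, $u_1^{\varepsilon_n}\in V$. Assume that $$\varepsilon_nu_1^{\varepsilon_n}\to0\ \text{ in }W,\qquad u_0^{\varepsilon_n}\rightharpoonup u_0\ \text{ weakly in }U,\qquad \mathcal E(0,u_0^{\varepsilon_n})\to\mathcal E(0,u_0),$$ for some $u_0\in U$ with $\mathcal E(0,u_0)\le\mathcal E(0,x)+\mathcal R(x-u_0)$ for all $x\in U$. Then there exist a function $u\colon[0,T]\to D$ with $u\in B([0,T];U)\cap BV([0,T];Z)$ and a subsequence (not relabelled) such that - $u^{\varepsilon_n}(t)\rightharpoonup u(t)$ weakly in $U$ for every $t\in[0,T]$; - $\varepsilon_n\dot u^{\varepsilon_n}(t)\to0$ strongly in $V$ for a.e. $t\in[0,T]$. Moreover $u$ is an *essential energetic solution* with initial datum $u_0$: $u(0)=u_0$, the one-sided limits $u^\pm(t)$ belong to $D$ for all $t\in[0,T]$, the function $r\mapsto\partial_t\mathcal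 E(r,u(r))$ is integrable on $(0,T)$, and $$\mathcal E(t,u(t))\le\mathcal E(t,x)+\mathcal R(x-u(t))\quad\text{for all }x\in U\text{ and all }t\in[0,T]\setminus J_u,$$ $$\mathcal E(t,u^+(t))+V_{\mathcal R}(u_{\rm co};s,t)+\sum_{r\in J_u^{\rm e}\cap[s,t]}\mathcal R(u^+(r)-u^-(r))=\mathcal E(s,u^-(s))+\int_s^t\partial_t\mathcal E(r,u(r))\,dr\quad\text{for all }0\le s\le t\le T,$$ where the variation and the sum on the left are finite. -/

import Mathlib

open Set Filter Topology MeasureTheory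
open scoped NNReal ENNReal

/-! ## Functional framework -/

/-- Reflexivity of a real normed space: the canonical map into the bidual is onto. -/
def IsReflexiveSpace (X : Type*) [NormedAddCommGroup X] [NormedSpace ℝ X] : Prop :=
  Function.Surjective (NormedSpace.inclusionInDoubleDual ℝ X)

/-- A continuous dense embedding, realised by an injective bounded linear map. -/
structure IsContDenseEmbedding {X Y : Type*} [NormedAddCommGroup X] [NormedSpace ℝ X]
    [NormedAddCommGroup Y] [NormedSpace ℝ Y] (i : X →L[ℝ] Y) : Prop where
  injective : Function.Injective i
  denseRange : DenseRange i

/-- The Gelfand embedding `W = W* ↪ U*` attached to `i : U ↪ W`: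
`w` acts on `U` as `x ↦ ⟪w, i x⟫`. -/
noncomputable def hilbertToDual {U W : Type*} [NormedAddCommGroup U] [NormedSpace ℝ U]
    [NormedAddCommGroup W] [InnerProductSpace ℝ W] (i : U →L[ℝ] W) (w : W) : StrongDual ℝ U :=
  (innerSL ℝ w).comp i

/-- Mass operator: an automorphism `M` of `U*` whose restriction to `W` is the operator `MW`,
which is continuous, symmetric and positive definite (so that `⟪MW w, w⟫` is the square of an
equivalent norm on `W`). -/
structure IsMassOperator {U W : Type*} [NormedAddCommGroup U] [NormedSpace ℝ U]
    [NormedAddCommGroup W] [InnerProductSpace ℝ W] (i : U →L[ℝ] W)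
    (M : StrongDual ℝ U ≃L[ℝ] StrongDual ℝ U) (MW : W →L[ℝ] W) : Prop where
  restrict : ∀ w : W, M (hilbertToDual i w) = hilbertToDual i (MW w)
  symm : ∀ w₁ w₂ : W, inner ℝ (MW w₁) w₂ = inner ℝ w₁ (MW w₂)
  posDef : ∃ c > 0, ∀ w : W, c * ‖w‖ ^ 2 ≤ inner ℝ (MW w) w

/-- Viscosity operator `V → V*`: continuous, symmetric and positive definite (so that
`⟨VV v, v⟩` is the square of an equivalent norm on `V`). -/
structure IsViscosityOperator {V : Type*} [NormedAddCommGroup V] [NormedSpace ℝ V]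
    (VV : V →L[ℝ] StrongDual ℝ V) : Prop where
  symm : ∀ v₁ v₂ : V, VV v₁ v₂ = VV v₂ v₁
  posDef : ∃ c > 0, ∀ v : V, c * ‖v‖ ^ 2 ≤ VV v v

/-- Rate-independent dissipation potential: convex, positively one-homogeneous, and comparable
with the norm from below and from above. -/
structure IsDissipationPotential {Z : Type*} [NormedAddCommGroup Z] [NormedSpace ℝ Z]
    (R : Z → ℝ) : Prop where
  convex : ConvexOn ℝ univ R
  homogeneous : ∀ c : ℝ, 0 < c → ∀ z : Z, R (c • z) = c * R z
  bounds : ∃ ρ₁ ρ₂ : ℝ, 0 < ρ₁ ∧ ρ₁ ≤ ρ₂ ∧ ∀ z : Z, ρ₁ * ‖z‖ ≤ R z ∧ R z ≤ ρ₂ * ‖z‖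

/-! ## Potential energy -/

/-- The power `∂ₜE(t,u)`. -/
noncomputable def power {U : Type*} (E : ℝ → U → ℝ≥0∞) (t : ℝ) (u : U) : ℝ :=
  deriv (fun s => (E s u).toReal) t

/-- A modulus of continuity on `[0,∞)`: nonnegative, vanishing at `0` and continuous there. -/
structure IsModulusOfContinuity (ω : ℝ → ℝ) : Prop where
  nonneg : ∀ r, 0 ≤ r → 0 ≤ ω r
  zero : ω 0 = 0
  tendsto : Tendsto ω (𝓝[≥] 0) (𝓝 0)

/-- Assumptions on the energy `E : [0,T] × U → [0,∞]` with domain `[0,T] × D`, in the convex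
case; `i` is the embedding of `U` into `W`. -/
structure IsConvexEnergy {U W : Type*} [NormedAddCommGroup U] [NormedSpace ℝ U]
    [NormedAddCommGroup W] [InnerProductSpace ℝ W] (i : U →L[ℝ] W) (T : ℝ) (D : Set U)
    (E : ℝ → U → ℝ≥0∞) : Prop where
  /-- The domain. -/
  nonempty : D.Nonempty
  domain : ∀ t ∈ Icc 0 T, ∀ u : U, E t u < ⊤ ↔ u ∈ D
  /-- Weak lower semicontinuity. -/
  weak_lsc : ∀ t ∈ Icc 0 T,
    LowerSemicontinuous fun x : WeakSpace ℝ U => E t ((toWeakSpace ℝ U).symm x)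
  /-- Power control. -/
  absCont : ∀ u ∈ D, AbsolutelyContinuousOnInterval (fun t => (E t u).toReal) 0 T
  power_control : ∃ b : ℝ → ℝ, IntegrableOn b (Icc 0 T) ∧ (∀ t ∈ Icc 0 T, 0 ≤ b t) ∧
    ∀ᵐ t ∂(volume.restrict (Icc 0 T)), ∀ u ∈ D,
      DifferentiableAt ℝ (fun s => (E s u).toReal) t ∧
        |power E t u| ≤ b t * ((E t u).toReal + 1)
  /-- Coercivity. -/
  coercive : ∀ c : ℝ≥0, Bornology.IsBounded {u : U | E 0 u ≤ c}
  /-- Power continuity. -/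
  power_cont : ∀ m : ℝ≥0, 0 < m → ∃ γ ω : ℝ → ℝ, IntegrableOn γ (Icc 0 T) ∧
    IsModulusOfContinuity ω ∧
    ∀ᵐ t ∂(volume.restrict (Icc 0 T)), ∀ u₁ u₂ : U, E 0 u₁ ≤ m → E 0 u₂ ≤ m →
      |power E t u₁ - power E t u₂| ≤ γ t * ω ‖i u₁ - i u₂‖
  /-- Convexity. -/
  convex : ∀ t ∈ Icc 0 T, ∀ u₁ u₂ : U, ∀ θ ∈ Icc (0 : ℝ) 1,
    E t (θ • u₁ + (1 - θ) • u₂) ≤ ENNReal.ofReal θ * E t u₁ + ENNReal.ofReal (1 - θ) * E t u₂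

/-! ## Convex analysis -/

/-- Fréchet subdifferential of an extended-real-valued function. -/
noncomputable def frechetSubdifferential {X : Type*} [NormedAddCommGroup X] [NormedSpace ℝ X]
    (Φ : X → EReal) (x : X) : Set (StrongDual ℝ X) :=
  {ζ | Φ x ≠ ⊤ ∧
    0 ≤ liminf (fun y => (Φ y - Φ x - ((ζ (y - x) : ℝ) : EReal)) / ((‖y - x‖ : ℝ) : EReal))
      (𝓝[≠] x)}

/-- Fenchel conjugate. -/
noncomputable def fenchelConjugate {X : Type*} [NormedAddCommGroup X] [NormedSpace ℝ X]
    (Φ : X → EReal) (ζ : StrongDual ℝ X) : EReal :=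
  ⨆ y : X, ((ζ y : ℝ) : EReal) - Φ y

/-- The viscously regularised dissipation `v ↦ (ε/2) |v|_V² + R(v)` on `V`; `j` is the embedding
of `V` into `Z`. -/
noncomputable def viscousDissipation {V Z : Type*} [NormedAddCommGroup V] [NormedSpace ℝ V]
    [NormedAddCommGroup Z] [NormedSpace ℝ Z] (j : V →L[ℝ] Z) (VV : V →L[ℝ] StrongDual ℝ V)
    (R : Z → ℝ) (ε : ℝ) (v : V) : ℝ :=
  ε / 2 * VV v v + R (j v)

/-! ## Function spaces on `[0,T]` -/

section Spaces

variable {X : Type*} [NormedAddCommGroup X] [NormedSpace ℝ X]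

/-- `B([0,T];X)`: everywhere defined measurable bounded functions. -/
def MemB (T : ℝ) (f : ℝ → X) : Prop :=
  StronglyMeasurable (fun t : Icc (0 : ℝ) T => f t) ∧ ∃ C : ℝ, ∀ t ∈ Icc 0 T, ‖f t‖ ≤ C

/-- `C_w([0,T];X)`: the weakly continuous functions in `B([0,T];X)`. -/
def MemCw (T : ℝ) (f : ℝ → X) : Prop :=
  MemB T f ∧ ∀ φ : StrongDual ℝ X, ContinuousOn (fun t => φ (f t)) (Icc 0 T)

/-- `f ∈ C¹_w([0,T];X)` with weak derivative `g`. -/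
def HasCwDeriv (T : ℝ) (f g : ℝ → X) : Prop :=
  MemCw T f ∧ MemCw T g ∧ ∀ φ : StrongDual ℝ X, ∀ t ∈ Icc 0 T,
    HasDerivWithinAt (fun s => φ (f s)) (φ (g t)) (Icc 0 T) t

/-- `f ∈ W^{1,2}(0,T;X)` (continuous representative) with derivative `g ∈ L²(0,T;X)`. -/
def HasSobolevDeriv (T : ℝ) (f g : ℝ → X) : Prop :=
  MemLp g 2 (volume.restrict (Icc 0 T)) ∧ ∀ t ∈ Icc 0 T, f t = f 0 + ∫ s in (0 : ℝ)..t, g s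

/-- `fm` and `fp` are the left and right (strong) limits of `f` on `[0,T]`, with the convention
`f⁻(0) = f(0)` and `f⁺(T) = f(T)`. -/
def HasOneSidedLimits (T : ℝ) (f fm fp : ℝ → X) : Prop :=
  fm 0 = f 0 ∧ fp T = f T ∧
  (∀ t ∈ Ioc 0 T, Tendsto f (𝓝[<] t) (𝓝 (fm t))) ∧
  (∀ t ∈ Ico 0 T, Tendsto f (𝓝[>] t) (𝓝 (fp t)))

/-- The jump set of `f`: the points of `[0,T]` at which `f` is not continuous. -/
def jumpSet (T : ℝ) (f : ℝ → X) : Set ℝ :=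
  {t | t ∈ Icc 0 T ∧ ¬ ContinuousWithinAt f (Icc 0 T) t}

/-- The essential jump set: the jump points at which the one-sided limits differ. -/
def essJumpSet (T : ℝ) (f fm fp : ℝ → X) : Set ℝ :=
  {t | t ∈ jumpSet T f ∧ fp t ≠ fm t}

/-- The pure jump part of a function of bounded variation on `[0,T]` with one-sided limits
`fm`, `fp` (the terms vanish off the jump set, and the sums converge absolutely). -/
noncomputable def jumpPart (f fm fp : ℝ → X) (t : ℝ) : X :=
  (∑' r : Icc (0 : ℝ) t, (f r - fm r)) + ∑' r : Ico (0 : ℝ) t, (fp r - f r)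

/-- The continuous part of a function of bounded variation on `[0,T]`. -/
noncomputable def contPart (f fm fp : ℝ → X) (t : ℝ) : X :=
  f t - jumpPart f fm fp t

/-- The `R`-variation of `f` on `[a,b]`: the supremum over partitions `a = t₀ < ⋯ < tₙ = b`. -/
noncomputable def RVariation (R : X → ℝ) (f : ℝ → X) (a b : ℝ) : ℝ≥0∞ :=
  ⨆ (n : ℕ) (p : ℕ → ℝ) (_ : p 0 = a ∧ p n = b ∧ ∀ k < n, p k < p (k + 1)),
    ∑ k ∈ Finset.range n, ENNReal.ofReal (R (f (p (k + 1)) - f (p k)))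

end Spaces

/-! ## Notions of solution -/

/-- Dissipative dynamic solutions of
`ε² M u'' + ε VV u' + ∂R(u') + ∂E(t,u) ∋ 0`, `u(0) = u₀`, `u'(0) = u₁`.

The embeddings are `iUV : U ↪ V`, `iVW : V ↪ W`, `iWZ : W ↪ Z`. The functions `du`, `duV` are the
derivative of `u` with values in `W` (everywhere on `[0,T]`) and in `V` (almost everywhere), `ddu`
is the second derivative with values in `U*`, and `ζ` is `-ε² M u'' - ξ` as an element of `V*`. -/
def IsDissipativeDynamicSolution {U V W Z : Type*}
    [NormedAddCommGroup U] [NormedSpace ℝ U]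
    [NormedAddCommGroup V] [InnerProductSpace ℝ V]
    [NormedAddCommGroup W] [InnerProductSpace ℝ W]
    [NormedAddCommGroup Z] [NormedSpace ℝ Z]
    (iUV : U →L[ℝ] V) (iVW : V →L[ℝ] W) (iWZ : W →L[ℝ] Z)
    (M : StrongDual ℝ U ≃L[ℝ] StrongDual ℝ U) (MW : W →L[ℝ] W) (VV : V →L[ℝ] StrongDual ℝ V)
    (R : Z → ℝ) (T : ℝ) (D : Set U) (E : ℝ → U → ℝ≥0∞)
    (ε : ℝ) (u₀ : U) (u₁ : V) (u : ℝ → U) : Prop :=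
  ∃ (du : ℝ → W) (duV : ℝ → V) (ddu : ℝ → StrongDual ℝ U)
    (η : ℝ → StrongDual ℝ Z) (ξ : ℝ → StrongDual ℝ U) (ζ : ℝ → StrongDual ℝ V),
    -- regularity
    (∀ t ∈ Icc 0 T, u t ∈ D) ∧
    MemCw T u ∧
    HasSobolevDeriv T (fun t => iUV (u t)) duV ∧
    HasCwDeriv T (fun t => iVW (iUV (u t))) du ∧
    (∀ᵐ t ∂(volume.restrict (Icc 0 T)), iVW (duV t) = du t) ∧
    HasSobolevDeriv T (fun t => hilbertToDual (iVW.comp iUV) (iVW (iUV (u t))))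
      (fun t => hilbertToDual (iVW.comp iUV) (du t)) ∧
    HasSobolevDeriv T (fun t => hilbertToDual (iVW.comp iUV) (du t)) ddu ∧
    MemLp (fun t => (E t (u t)).toReal) ⊤ (volume.restrict (Icc 0 T)) ∧
    -- initial conditions
    u 0 = u₀ ∧ du 0 = iVW u₁ ∧
    -- the differential inclusion
    (∀ z : Z, AEStronglyMeasurable (fun t => η t z) (volume.restrict (Icc 0 T))) ∧
    AEStronglyMeasurable ξ (volume.restrict (Icc 0 T)) ∧
    (∀ᵐ t ∂(volume.restrict (Icc 0 T)),
      η t ∈ frechetSubdifferential (fun z => ((R z : ℝ) : EReal)) (iWZ (du t)) ∧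
      ξ t ∈ frechetSubdifferential (fun x => ((E t x : ℝ≥0∞) : EReal)) (u t) ∧
      ε ^ 2 • M (ddu t) + ε • (VV (duV t)).comp iUV + (η t).comp (iWZ.comp (iVW.comp iUV)) + ξ t
        = 0) ∧
    -- the energy-dissipation balance
    (∀ᵐ t ∂(volume.restrict (Icc 0 T)), (ζ t).comp iUV = -(ε ^ 2 • M (ddu t)) - ξ t) ∧
    IntegrableOn (fun r => viscousDissipation (iWZ.comp iVW) VV R ε (duV r) +
      (fenchelConjugate (fun v => ((viscousDissipation (iWZ.comp iVW) VV R ε v : ℝ) : EReal))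
        (ζ r)).toReal) (Icc 0 T) ∧
    IntegrableOn (fun r => power E r (u r)) (Icc 0 T) ∧
    ∃ N : Set ℝ, N ⊆ Ioc 0 T ∧ volume N = 0 ∧ ∀ t ∈ Icc 0 T \ N,
      ε ^ 2 / 2 * inner ℝ (MW (du t)) (du t) + (E t (u t)).toReal +
        (∫ r in (0 : ℝ)..t, (viscousDissipation (iWZ.comp iVW) VV R ε (duV r) +
          (fenchelConjugate (fun v => ((viscousDissipation (iWZ.comp iVW) VV R ε v : ℝ) : EReal))
            (ζ r)).toReal))
      = ε ^ 2 / 2 * inner ℝ (MW (iVW u₁)) (iVW u₁) + (E 0 u₀).toReal +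
        ∫ r in (0 : ℝ)..t, power E r (u r)

/-- Global stability of `x` at time `t`; `k` is the embedding of `U` into `Z`. -/
def IsGloballyStable {U Z : Type*} [NormedAddCommGroup U] [NormedSpace ℝ U]
    [NormedAddCommGroup Z] [NormedSpace ℝ Z] (k : U →L[ℝ] Z) (R : Z → ℝ)
    (E : ℝ → U → ℝ≥0∞) (t : ℝ) (x : U) : Prop :=
  ∀ y : U, E t x ≤ E t y + ENNReal.ofReal (R (k (y - x)))

/-- Essential energetic solutions `u : [0,T] → D` with initial datum `u₀`; `k` is the embedding of
`U` into `Z`, and `um t`, `up t ∈ D` are the one-sided limits of `u` in `Z` (unique, since `k` is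
injective). The essential variation is
`V_R(u_co;s,t) + ∑_{r ∈ J^e ∩ [s,t]} R(u⁺(r) - u⁻(r))`, both terms of which are finite. -/
def IsEssentialEnergeticSolution {U Z : Type*} [NormedAddCommGroup U] [NormedSpace ℝ U]
    [NormedAddCommGroup Z] [NormedSpace ℝ Z] (k : U →L[ℝ] Z) (R : Z → ℝ) (T : ℝ) (D : Set U)
    (E : ℝ → U → ℝ≥0∞) (u₀ : U) (u : ℝ → U) : Prop :=
  (∀ t ∈ Icc 0 T, u t ∈ D) ∧
  MemB T u ∧
  BoundedVariationOn (fun t => k (u t)) (Icc 0 T) ∧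
  u 0 = u₀ ∧
  (∀ t ∈ Icc 0 T \ jumpSet T (fun t => k (u t)), IsGloballyStable k R E t (u t)) ∧
  IntegrableOn (fun r => power E r (u r)) (Icc 0 T) ∧
  ∃ um up : ℝ → U,
    (∀ t ∈ Icc 0 T, um t ∈ D ∧ up t ∈ D) ∧
    HasOneSidedLimits T (fun t => k (u t)) (fun t => k (um t)) (fun t => k (up t)) ∧
    ∀ s t : ℝ, 0 ≤ s → s ≤ t → t ≤ T →
      RVariation R (contPart (fun t => k (u t)) (fun t => k (um t)) (fun t => k (up t))) s t
        ≠ ⊤ ∧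
      Summable (fun r : ↥(essJumpSet T (fun t => k (u t)) (fun t => k (um t))
          (fun t => k (up t)) ∩ Icc s t) => R (k (up r) - k (um r))) ∧
      (E t (up t)).toReal +
        ((RVariation R (contPart (fun t => k (u t)) (fun t => k (um t)) (fun t => k (up t)))
            s t).toReal +
          ∑' r : ↥(essJumpSet T (fun t => k (u t)) (fun t => k (um t))
            (fun t => k (up t)) ∩ Icc s t), R (k (up r) - k (um r)))
      = (E s (um s)).toReal + ∫ r in s..t, power E r (u r)

/-! ## Gronwall inequalities for absolutely continuous functions -/

/-! The argument combines compactness, stability of the limit, and an energy equality that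
identifies all of the limit dissipation.

Compactness. The conjugate term in the energy-dissipation balance is nonnegative, so the balance
gives an upper energy inequality. Gronwall and the power control bound, uniformly in ε, the energy,
∫R(u'), ε∫‖u'‖² in V and ε‖u'‖ in W (`ViscousTrajectory.exists_uniform_bounds`). The third bound
makes εu' tend to 0 in L²(0,T;V), hence almost everywhere along a subsequence. Helly's principle,
applied in Z × ℝ to the trajectory together with t ↦ ∫₀ᵗ R(u'), gives limits u and v at every time.
Here v is nondecreasing, R(u(t) - u(s)) ≤ v(t) - v(s), and E(t,u(t)) + v(t) ≤ E(0,u₀) + ∫₀ᵗ ∂ₜE.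

Stability. Convexity makes ξ a global subgradient, and sublinearity gives η ≤ R. The inclusion thus
becomes the stability inequality up to the terms ε𝕍u' and ε²𝕄u''. After integration in time, and by
parts in the inertial term, these are O(√ε + ε) (`ViscousTrajectory.exists_integral_energy_le`), so
stability survives in time average. Near t the energy along u is lower semicontinuous and the
competitor's side is continuous; averaging over shrinking intervals on either side of t therefore
makes u⁻(t) and u⁺(t) stable (`LimitTrajectory.isGloballyStable_of_tendsto`).

Energy equality. Testing stability at each node of a partition with the state at the next node, and
summing, gives the converse energy estimate. Power continuity and the compact embedding into W make
the power sums converge. Hence E(t,u^±(t)) + v^±(t) = E(0,u₀) + ∫₀ᵗ ∂ₜE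
(`LimitTrajectory.energy_right_eq`, `LimitTrajectory.energy_left_eq`). Subtracting the two
identities and using stability of u⁻(t) shows that v jumps by exactly R(u⁺(t) - u⁻(t))
(`LimitTrajectory.jump_eq`). The rest of v is the variation of the continuous part
(`HasDissipationFunction.essVariation_eq`), and the balance of an essential energetic solution is
the difference of two such identities. -/

theorem AbsolutelyContinuousOnInterval.lipschitz_comp {f φ : ℝ → ℝ} {a b : ℝ} {K : ℝ≥0}
    (hf : AbsolutelyContinuousOnInterval f a b) (hφ : LipschitzOnWith K φ (f '' uIcc a b)) :
    AbsolutelyContinuousOnInterval (fun t => φ (f t)) a b := by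
  rw [absolutelyContinuousOnInterval_iff] at hf ⊢
  intro ε hε
  -- Dividing by K + 1 instead of K covers K = 0 and yields the strict inequality.
  obtain ⟨δ, hδ, h⟩ := hf (ε / (K + 1)) (by positivity)
  refine ⟨δ, hδ, fun I hI hsum => ?_⟩
  have h1 := h I hI hsum
  calc ∑ i ∈ Finset.range I.1, dist (φ (f (I.2 i).1)) (φ (f (I.2 i).2))
      ≤ ∑ i ∈ Finset.range I.1, K * dist (f (I.2 i).1) (f (I.2 i).2) :=
        Finset.sum_le_sum fun i hi => hφ.dist_le_mul _ (mem_image_of_mem _ (hI.1 i hi).1) _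
          (mem_image_of_mem _ (hI.1 i hi).2)
    _ = K * ∑ i ∈ Finset.range I.1, dist (f (I.2 i).1) (f (I.2 i).2) := by rw [Finset.mul_sum]
    _ ≤ K * (ε / (K + 1)) := by gcongr
    _ < (K + 1) * (ε / (K + 1)) := by gcongr; linarith
    _ = ε := by field

/-- An absolutely continuous function is bounded on the interval, and the exponential is Lipschitz
on half-lines bounded above. -/
theorem AbsolutelyContinuousOnInterval.exp {f : ℝ → ℝ} {a b : ℝ}
    (hf : AbsolutelyContinuousOnInterval f a b) :
    AbsolutelyContinuousOnInterval (fun t => Real.exp (f t)) a b := by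
  obtain ⟨C, hC⟩ := hf.exists_bound
  have hLip : LipschitzOnWith (Real.exp C).toNNReal Real.exp (Iic C) := by
    refine (convex_Iic C).lipschitzOnWith_of_nnnorm_deriv_le
      (fun x _ => Real.differentiable_exp.differentiableAt) fun x hx => ?_
    rw [Real.deriv_exp, ← NNReal.coe_le_coe, coe_nnnorm, Real.norm_eq_abs, Real.abs_exp,
      Real.coe_toNNReal _ (Real.exp_pos _).le]
    exact Real.exp_le_exp.2 hx
  refine hf.lipschitz_comp (hLip.mono ?_)
  rintro _ ⟨t, ht, rfl⟩
  exact (le_abs_self _).trans (hC t ht)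

/-- The product of F with exp(-∫β) is absolutely continuous and its derivative is almost everywhere
nonpositive. No sign of F or β is needed, so the reverse inequality below follows by applying this
to -F and -β. -/
theorem AbsolutelyContinuousOnInterval.le_mul_exp_of_deriv_le {F β : ℝ → ℝ} {a b : ℝ} (hab : a ≤ b)
    (hF : AbsolutelyContinuousOnInterval F a b) (hβ : IntervalIntegrable β volume a b)
    (h : ∀ᵐ t, t ∈ Icc a b → deriv F t ≤ β t * F t) :
    F b ≤ F a * Real.exp (∫ t in a..b, β t) := by
  have hB : AbsolutelyContinuousOnInterval (fun x => ∫ t in a..x, β t) a b :=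
    hβ.absolutelyContinuousOnInterval_intervalIntegral left_mem_uIcc
  have hG := hB.fun_neg.exp
  have key := hF.integral_deriv_mul_eq_sub hG
  have hle : ∫ x in a..b, (deriv F x * Real.exp (-∫ t in a..x, β t) +
      F x * deriv (fun x => Real.exp (-∫ t in a..x, β t)) x) ≤ ∫ x in a..b, (0 : ℝ) := by
    refine intervalIntegral.integral_mono_ae_restrict hab ?_ (by simp) ?_
    · exact (hF.fun_mul hG).intervalIntegrable_deriv.congr_ae <| by
        rw [EventuallyEq, ae_restrict_iff' measurableSet_uIoc]
        filter_upwards [hF.ae_differentiableAt, hG.ae_differentiableAt] with x h1 h2 h3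
        exact ((h1 (uIoc_subset_uIcc h3)).hasDerivAt.mul (h2 (uIoc_subset_uIcc h3)).hasDerivAt).deriv
    · rw [EventuallyLE, ae_restrict_iff' measurableSet_Icc]
      filter_upwards [h, hβ.ae_hasDerivAt_integral] with x h1 h2 h3
      have h4 := (h2 (by rwa [uIcc_of_le hab]) a left_mem_uIcc).neg.exp.deriv
      have h5 : deriv (fun x => Real.exp (-∫ t in a..x, β t)) x
          = Real.exp (-∫ t in a..x, β t) * -β x := by
        exact h4
      rw [h5]
      have := mul_le_mul_of_nonneg_right (h1 h3) (Real.exp_pos (-∫ t in a..x, β t)).le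
      linarith
  rw [key] at hle
  simp only [intervalIntegral.integral_same, neg_zero, Real.exp_zero, mul_one,
    intervalIntegral.integral_zero, Real.exp_neg] at hle
  have hpos := Real.exp_pos (∫ t in a..b, β t)
  rw [sub_nonpos, ← div_eq_mul_inv, div_le_iff₀ hpos] at hle
  exact hle

theorem AbsolutelyContinuousOnInterval.le_mul_exp_of_neg_le_deriv {F β : ℝ → ℝ} {a b : ℝ}
    (hab : a ≤ b) (hF : AbsolutelyContinuousOnInterval F a b)
    (hβ : IntervalIntegrable β volume a b) (h : ∀ᵐ t, t ∈ Icc a b → -(β t * F t) ≤ deriv F t) :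
    F a ≤ F b * Real.exp (∫ t in a..b, β t) := by
  have h1 := hF.fun_neg.le_mul_exp_of_deriv_le (β := fun t => -β t) hab hβ.neg <| by
    filter_upwards [h] with t ht htm
    have := ht htm
    rw [deriv.fun_neg]
    linarith
  rw [intervalIntegral.integral_neg, Real.exp_neg] at h1
  have hpos := Real.exp_pos (∫ t in a..b, β t)
  have h2 : F a * (Real.exp (∫ t in a..b, β t))⁻¹ ≤ F b := by linarith
  rwa [← div_eq_mul_inv, div_le_iff₀ hpos] at h2

/-- Gronwall's lemma for an inequality holding almost everywhere, with an integrable kernel. -/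
theorem gronwall_of_ae_le {φ β : ℝ → ℝ} {a b c : ℝ} (hab : a ≤ b) (hβ0 : ∀ t ∈ Icc a b, 0 ≤ β t)
    (hβ : IntervalIntegrable β volume a b)
    (hβφ : IntervalIntegrable (fun t => β t * φ t) volume a b)
    (h : ∀ᵐ t, t ∈ Icc a b → φ t ≤ c + ∫ s in a..t, β s * φ s) :
    ∀ᵐ t, t ∈ Icc a b → φ t ≤ c * Real.exp (∫ s in a..t, β s) := by
  filter_upwards [h] with t ht htm
  refine (ht htm).trans ?_
  have hsub : uIcc a t ⊆ uIcc a b := by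
    rw [uIcc_of_le hab, uIcc_of_le htm.1]; exact Icc_subset_Icc_right htm.2
  have h1 := hβφ.absolutelyContinuousOnInterval_intervalIntegral (c := a) left_mem_uIcc
  -- The right-hand side, unlike φ, is absolutely continuous; its derivative βφ is at most β times
  -- itself.
  have hAC : AbsolutelyContinuousOnInterval (fun x => c + ∫ s in a..x, β s * φ s) a t := by
    have := (((LipschitzWith.const c).lipschitzOnWith (s := uIcc a b)).absolutelyContinuousOnInterval).fun_add h1
    exact this.mono hsub
  have := hAC.le_mul_exp_of_deriv_le htm.1 (hβ.mono_set hsub) <| by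
    filter_upwards [h, hβφ.ae_hasDerivAt_integral] with x hx1 hx2 hx3
    have hx4 : x ∈ Icc a b := ⟨hx3.1, hx3.2.trans htm.2⟩
    have := (hx2 (by rwa [uIcc_of_le hab]) a left_mem_uIcc).const_add c
    rw [this.deriv]
    exact mul_le_mul_of_nonneg_left (hx1 hx4) (hβ0 x hx4)
  simpa using this

/-! ## Weak compactness -/

/-- Every cluster point in the compact set is mapped to y, so injectivity leaves only one, and a
unique cluster point in a compact set is a limit. This yields weak convergence of whole families,
along any filter, without metrizability. -/
theorem IsCompact.exists_tendsto_of_injOn {ι X Y : Type*} [TopologicalSpace X] [TopologicalSpace Y]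
    [T2Space Y] {S : Set X} (hS : IsCompact S) {g : X → Y} (hg : ContinuousOn g S)
    (hinj : InjOn g S) {l : Filter ι} [l.NeBot] {x : ι → X} (hx : ∀ᶠ n in l, x n ∈ S) {y : Y}
    (hy : Tendsto (fun n => g (x n)) l (𝓝 y)) :
    ∃ z ∈ S, g z = y ∧ Tendsto x l (𝓝 z) := by
  have hcl : ∀ z ∈ S, MapClusterPt z l x → g z = y := by
    intro z hz hcz
    have h1 : (𝓝 z ⊓ map x l).NeBot := hcz
    have h2 : (𝓝[S] z ⊓ map x l).NeBot := by
      have h3 : 𝓝[S] z ⊓ map x l = 𝓝 z ⊓ map x l := by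
        rw [nhdsWithin, inf_assoc, inf_eq_right.2 (le_principal_iff.2 (mem_map.2 hx))]
      rwa [h3]
    have h3 : Tendsto g (𝓝[S] z ⊓ map x l) (𝓝 (g z)) := (hg z hz).mono_left inf_le_left
    have h4 : Tendsto g (𝓝[S] z ⊓ map x l) (𝓝 y) :=
      (show Tendsto g (map x l) (𝓝 y) from hy).mono_left inf_le_right
    exact tendsto_nhds_unique h3 h4
  obtain ⟨z, hz, hcz⟩ := hS.exists_mapClusterPt_of_frequently hx.frequently
  refine ⟨z, hz, hcl z hz hcz, hS.tendsto_nhds_of_unique_mapClusterPt hx fun w hw hcw => ?_⟩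
  exact hinj hw hz ((hcl w hw hcw).trans (hcl z hz hcz).symm)

theorem tendsto_toWeakSpace_iff {ι X : Type*} [NormedAddCommGroup X] [NormedSpace ℝ X]
    {l : Filter ι} {x : ι → X} {y : X} :
    Tendsto (fun n => toWeakSpace ℝ X (x n)) l (𝓝 (toWeakSpace ℝ X y)) ↔
      ∀ φ : StrongDual ℝ X, Tendsto (fun n => φ (x n)) l (𝓝 (φ y)) := by
  have h : IsInducing (fun (x : WeakSpace ℝ X) (φ : StrongDual ℝ X) => φ ((toWeakSpace ℝ X).symm x)) :=
    ⟨rfl⟩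
  rw [h.tendsto_nhds_iff, tendsto_pi_nhds]
  rfl

theorem eq_of_forall_strongDual_eq {X : Type*} [NormedAddCommGroup X] [NormedSpace ℝ X] {x y : X}
    (h : ∀ φ : StrongDual ℝ X, φ x = φ y) : x = y := by
  by_contra hne
  obtain ⟨φ, hφ⟩ := SeparatingDual.exists_separating_of_ne (R := ℝ) hne
  exact hφ (h φ)

/-- In a reflexive space, a bounded family whose image under an injective bounded operator
converges is weakly convergent. -/
theorem IsReflexiveSpace.exists_weak_limit {ι X Y : Type*} [NormedAddCommGroup X]
    [NormedSpace ℝ X] [NormedAddCommGroup Y] [NormedSpace ℝ Y] (hX : IsReflexiveSpace X)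
    {k : X →L[ℝ] Y} (hk : Function.Injective k) {l : Filter ι} [l.NeBot] {x : ι → X} {C : ℝ}
    (hC : ∀ᶠ n in l, ‖x n‖ ≤ C) {y : Y} (hy : Tendsto (fun n => k (x n)) l (𝓝 y)) :
    ∃ z, k z = y ∧ ∀ φ : StrongDual ℝ X, Tendsto (fun n => φ (x n)) l (𝓝 (φ z)) := by
  let S : Set (WeakSpace ℝ X) := (toWeakSpace ℝ X).symm ⁻¹' Metric.closedBall (0 : X) C
  have hS : IsCompact (closure S) := by
    refine NormedSpace.isCompact_closure_of_isBounded ℝ X S ?_ ?_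
    · exact Metric.isBounded_closedBall (x := (0 : X)) (r := C)
    -- Reflexivity enters here: each element of the bidual is evaluation at a point, so weak-*
    -- compactness of bounded sets becomes weak compactness.
    · intro ψ _
      obtain ⟨x, hx⟩ := hX (WeakDual.toStrongDual ψ)
      refine ⟨toWeakSpace ℝ X x, ?_⟩
      apply (WeakDual.toStrongDual).injective
      rw [← hx]
      rfl
  -- Only functionals of Y, pulled back by k, are tested. They separate points because k is
  -- injective, and compactness upgrades their convergence to that of all functionals of X.
  let g : WeakSpace ℝ X → StrongDual ℝ Y → ℝ := fun x φ => φ (k ((toWeakSpace ℝ X).symm x))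
  have hg : Continuous g :=
    continuous_pi fun φ => WeakBilin.eval_continuous (topDualPairing ℝ X).flip (φ.comp k)
  have hinj : Function.Injective g := fun a b hab =>
    (toWeakSpace ℝ X).symm.injective (hk (eq_of_forall_strongDual_eq fun φ => congrFun hab φ))
  obtain ⟨z, -, hz, hzt⟩ := hS.exists_tendsto_of_injOn hg.continuousOn hinj.injOn
    (x := fun n => toWeakSpace ℝ X (x n)) (l := l) (y := fun φ => φ y)
    (hC.mono fun n hn => subset_closure (by simpa [S] using hn))
    (tendsto_pi_nhds.2 fun φ => (φ.continuous.tendsto y).comp hy)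
  refine ⟨(toWeakSpace ℝ X).symm z, eq_of_forall_strongDual_eq fun φ => congrFun hz φ, ?_⟩
  exact tendsto_toWeakSpace_iff.1 (by simpa using hzt)

/-- Compact operators map bounded weakly convergent families to convergent ones. -/
theorem IsCompactOperator.tendsto_of_weak {ι X Y : Type*} [NormedAddCommGroup X]
    [NormedSpace ℝ X] [NormedAddCommGroup Y] [NormedSpace ℝ Y] {i : X →L[ℝ] Y}
    (hi : IsCompactOperator i) {l : Filter ι} {x : ι → X} {C : ℝ}
    (hC : ∀ᶠ n in l, ‖x n‖ ≤ C) {z : X}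
    (hz : ∀ φ : StrongDual ℝ X, Tendsto (fun n => φ (x n)) l (𝓝 (φ z))) :
    Tendsto (fun n => i (x n)) l (𝓝 (i z)) := by
  rcases eq_or_neBot l with rfl | hl
  · exact tendsto_bot
  have hinj : ∀ a b : Y, (fun φ : StrongDual ℝ Y => φ a) = (fun φ => φ b) → a = b :=
    fun a b hab => eq_of_forall_strongDual_eq fun φ => congrFun hab φ
  have hS := hi.isCompact_closure_image_closedBall C
  obtain ⟨w, -, hw, hwt⟩ := hS.exists_tendsto_of_injOn
    (g := fun (y : Y) (φ : StrongDual ℝ Y) => φ y)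
    (continuous_pi fun φ => φ.continuous).continuousOn (fun a _ b _ => hinj a b)
    (x := fun n => i (x n)) (y := fun φ => φ (i z))
    (hC.mono fun n hn => subset_closure ⟨x n, by simpa using hn, rfl⟩)
    (tendsto_pi_nhds.2 fun φ => hz (φ.comp i))
  rwa [hinj _ _ hw] at hwt

/-! ## Sublinear functionals -/

namespace IsDissipationPotential

variable {Z : Type*} [NormedAddCommGroup Z] [NormedSpace ℝ Z] {R : Z → ℝ}

theorem nonneg (hR : IsDissipationPotential R) (z : Z) : 0 ≤ R z := by
  obtain ⟨ρ₁, ρ₂, h1, -, h⟩ := hR.bounds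
  exact (by positivity : 0 ≤ ρ₁ * ‖z‖).trans (h z).1

theorem map_zero (hR : IsDissipationPotential R) : R 0 = 0 := by
  obtain ⟨ρ₁, ρ₂, -, -, h⟩ := hR.bounds
  have := h 0
  simp only [norm_zero, mul_zero] at this
  exact le_antisymm this.2 this.1

theorem add_le (hR : IsDissipationPotential R) (x y : Z) : R (x + y) ≤ R x + R y := by
  have h := hR.convex.2 (mem_univ x) (mem_univ y) (by norm_num : (0 : ℝ) ≤ 1 / 2)
    (by norm_num : (0 : ℝ) ≤ 1 / 2) (by norm_num)
  rw [← smul_add, hR.homogeneous _ (by norm_num)] at h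
  simp only [smul_eq_mul] at h
  linarith

theorem sub_le (hR : IsDissipationPotential R) (x y z : Z) : R (x - z) ≤ R (x - y) + R (y - z) := by
  simpa using hR.add_le (x - y) (y - z)

theorem sum_le (hR : IsDissipationPotential R) {ι : Type*} (s : Finset ι) (f : ι → Z) :
    R (∑ i ∈ s, f i) ≤ ∑ i ∈ s, R (f i) := by
  classical
  induction s using Finset.induction_on with
  | empty => simp [hR.map_zero]
  | insert a s ha ih =>
    rw [Finset.sum_insert ha, Finset.sum_insert ha]
    exact (hR.add_le _ _).trans (by linarith)

theorem continuous (hR : IsDissipationPotential R) : Continuous R := by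
  obtain ⟨ρ₁, ρ₂, h1, h12, h⟩ := hR.bounds
  refine (LipschitzWith.of_le_add_mul ρ₂.toNNReal fun x y => ?_).continuous
  rw [Real.coe_toNNReal _ (h1.le.trans h12), dist_eq_norm]
  have := hR.add_le y (x - y)
  rw [add_sub_cancel] at this
  linarith [(h (x - y)).2]

theorem tsum_le (hR : IsDissipationPotential R) {ι : Type*} {f : ι → Z} (hf : Summable f)
    (hRf : Summable fun i => R (f i)) : R (∑' i, f i) ≤ ∑' i, R (f i) :=
  le_of_tendsto_of_tendsto ((hR.continuous.tendsto _).comp hf.hasSum) hRf.hasSum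
    (Eventually.of_forall fun s => hR.sum_le s f)

/-- Jensen's inequality for the average; homogeneity then cancels the length of the interval. -/
theorem setIntegral_le [CompleteSpace Z] (hR : IsDissipationPotential R) {g : ℝ → Z} {a b : ℝ}
    (hab : a ≤ b) (hg : IntervalIntegrable g volume a b) :
    IntervalIntegrable (fun t => R (g t)) volume a b ∧
      R (∫ t in a..b, g t) ≤ ∫ t in a..b, R (g t) := by
  obtain ⟨ρ₁, ρ₂, h1, h12, h⟩ := hR.bounds
  have hint : IntervalIntegrable (fun t => R (g t)) volume a b := by
    refine (hg.norm.const_mul ρ₂).mono_fun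
      (hR.continuous.comp_aestronglyMeasurable hg.def'.aestronglyMeasurable)
      (Eventually.of_forall fun t => ?_)
    beta_reduce
    rw [Real.norm_of_nonneg (hR.nonneg _),
      Real.norm_of_nonneg (mul_nonneg (h1.le.trans h12) (norm_nonneg _))]
    exact (h _).2
  refine ⟨hint, ?_⟩
  rcases hab.eq_or_lt with rfl | hab
  · simp [hR.map_zero]
  have h0 : volume (Ioc a b) ≠ 0 := by simp [hab]
  have hJ := hR.convex.map_set_average_le hR.continuous.continuousOn isClosed_univ h0
    (by simp) (by simp) ((intervalIntegrable_iff_integrableOn_Ioc_of_le hab.le).1 hg)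
    ((intervalIntegrable_iff_integrableOn_Ioc_of_le hab.le).1 hint)
  rw [setAverage_eq, setAverage_eq, measureReal_def, Real.volume_Ioc,
    ENNReal.toReal_ofReal (by linarith),
    hR.homogeneous _ (inv_pos.2 (by linarith)), smul_eq_mul] at hJ
  rw [intervalIntegral.integral_of_le hab.le, intervalIntegral.integral_of_le hab.le]
  exact le_of_mul_le_mul_left hJ (inv_pos.2 (by linarith))

end IsDissipationPotential

/-! ## Fréchet subgradients of convex functions are global subgradients -/

/-- If the inequality failed, the difference quotients along the segment from x to y would stay
below one fixed negative number, against the nonnegative lower limit. Convexity is assumed along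
this segment only, with c standing for the value at y. -/
theorem le_of_mem_frechetSubdifferential {X : Type*} [NormedAddCommGroup X] [NormedSpace ℝ X]
    {Φ : X → EReal} {x y : X} {ζ : StrongDual ℝ X} (hζ : ζ ∈ frechetSubdifferential Φ x)
    {a c : ℝ} (hx : Φ x = (a : EReal))
    (hy : ∀ θ ∈ Ioc (0 : ℝ) 1, Φ (x + θ • (y - x)) ≤ ((a + θ * (c - a) : ℝ) : EReal)) :
    a + ζ (y - x) ≤ c := by
  rcases eq_or_ne y x with rfl | hne
  · have := hy 1 (by simp)
    simp only [sub_self, smul_zero, add_zero, hx, EReal.coe_le_coe_iff] at this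
    simp only [sub_self, _root_.map_zero]
    linarith
  have hn : 0 < ‖y - x‖ := norm_pos_iff.2 (sub_ne_zero.2 hne)
  by_contra! hlt
  -- The defect of the subgradient inequality per unit length; the scaling in θ cancels, so it
  -- bounds the quotient at every point of the segment.
  set q : ℝ := (c - a - ζ (y - x)) / ‖y - x‖ with hq
  have hq0 : q < 0 := div_neg_of_neg_of_pos (by linarith) hn
  have hev := eventually_lt_of_lt_liminf (lt_of_lt_of_le (b := (0 : EReal))
    (by exact_mod_cast hq0 : (q : EReal) < 0) hζ.2)
  have htend : Tendsto (fun θ : ℝ => x + θ • (y - x)) (𝓝[>] 0) (𝓝[≠] x) := by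
    refine tendsto_nhdsWithin_iff.2 ⟨?_, ?_⟩
    · have : Tendsto (fun θ : ℝ => x + θ • (y - x)) (𝓝 0) (𝓝 (x + (0 : ℝ) • (y - x))) :=
        Continuous.tendsto (by fun_prop) 0
      simpa using this.mono_left nhdsWithin_le_nhds
    · filter_upwards [self_mem_nhdsWithin] with θ hθ
      simp [sub_ne_zero.2 hne, (ne_of_gt hθ : θ ≠ 0)]
  obtain ⟨θ, hθ, hθm⟩ := ((htend.eventually hev).and
    (Ioc_mem_nhdsGT (zero_lt_one (α := ℝ)))).exists
  have hθ0 : 0 < θ := hθm.1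
  rw [add_sub_cancel_left, hx] at hθ
  have h1 : (Φ (x + θ • (y - x)) - (a : EReal) - ((ζ (θ • (y - x)) : ℝ) : EReal)) /
      ((‖θ • (y - x)‖ : ℝ) : EReal) ≤ (q : EReal) := by
    have h2 : Φ (x + θ • (y - x)) - (a : EReal) - ((ζ (θ • (y - x)) : ℝ) : EReal)
        ≤ ((a + θ * (c - a) - a - ζ (θ • (y - x)) : ℝ) : EReal) := by
      push_cast
      have := hy θ hθm
      push_cast at this
      exact EReal.sub_le_sub (EReal.sub_le_sub this le_rfl) le_rfl
    have hpos : 0 < ‖θ • (y - x)‖ := by rw [norm_smul, Real.norm_of_nonneg hθ0.le]; positivity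
    refine (EReal.div_le_div_right_of_nonneg (by exact_mod_cast hpos.le) h2).trans ?_
    rw [← EReal.coe_div, EReal.coe_le_coe_iff, hq, norm_smul, Real.norm_of_nonneg hθ0.le,
      _root_.map_smul, smul_eq_mul]
    apply le_of_eq
    field_simp
    ring
  exact absurd hθ (not_lt.2 h1)

/-- The subgradient inequality at z + w bounds η w by R(z + w) - R z, which is at most R w by
subadditivity. -/
theorem IsDissipationPotential.le_of_mem_frechetSubdifferential {Z : Type*} [NormedAddCommGroup Z]
    [NormedSpace ℝ Z] {R : Z → ℝ} (hR : IsDissipationPotential R) {z : Z} {η : StrongDual ℝ Z}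
    (hη : η ∈ frechetSubdifferential (fun z => ((R z : ℝ) : EReal)) z) (w : Z) : η w ≤ R w := by
  have h := _root_.le_of_mem_frechetSubdifferential (y := z + w) (c := R (z + w)) hη rfl <| by
    intro θ hθ
    rw [EReal.coe_le_coe_iff]
    have := hR.convex.2 (mem_univ z) (mem_univ (z + w)) (by linarith [hθ.2] : 0 ≤ 1 - θ)
      hθ.1.le (by ring)
    rw [show (1 - θ) • z + θ • (z + w) = z + θ • (z + w - z) by module] at this
    simp only [smul_eq_mul] at this
    linarith
  rw [add_sub_cancel_left] at h
  linarith [hR.add_le z w]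

/-! ## Riemann-type sums on uniform partitions -/

/-- The `k`-th point of the uniform partition of `[a,b]` into `N + 1` intervals. -/
noncomputable def unifPt (a b : ℝ) (N k : ℕ) : ℝ := a + k * ((b - a) / (N + 1))

theorem unifPt_zero (a b : ℝ) (N : ℕ) : unifPt a b N 0 = a := by simp [unifPt]

theorem unifPt_last (a b : ℝ) (N : ℕ) : unifPt a b N (N + 1) = b := by
  simp only [unifPt]; push_cast; field_simp; ring

theorem unifPt_succ (a b : ℝ) (N k : ℕ) :
    unifPt a b N (k + 1) = unifPt a b N k + (b - a) / (N + 1) := by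
  simp only [unifPt]; push_cast; ring

theorem unifPt_mono {a b : ℝ} (hab : a ≤ b) (N : ℕ) : Monotone (unifPt a b N) := by
  intro k l hkl
  have : 0 ≤ (b - a) / (N + 1) := div_nonneg (by linarith) (by positivity)
  simp only [unifPt]
  gcongr

theorem unifPt_strictMono {a b : ℝ} (hab : a < b) (N : ℕ) : StrictMono (unifPt a b N) := by
  refine strictMono_nat_of_lt_succ fun k => ?_
  rw [unifPt_succ]
  have : 0 < (b - a) / (N + 1) := div_pos (by linarith) (by positivity)
  linarith

theorem unifPt_mem {a b : ℝ} (hab : a ≤ b) {N k : ℕ} (hk : k ≤ N + 1) :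
    unifPt a b N k ∈ Icc a b :=
  ⟨(unifPt_zero a b N).ge.trans (unifPt_mono hab N (Nat.zero_le k)),
    (unifPt_mono hab N hk).trans (unifPt_last a b N).le⟩

/-- The sum is the integral of G r τ with τ a tag at distance at most one mesh from r, so dominated
convergence applies. Only integrability in r and continuity in τ on the diagonal are required; this
serves both the integration by parts and the lower energy estimate. -/
theorem tendsto_sum_integral_tag {G : ℝ → ℝ → ℝ} {g : ℝ → ℝ} {a b : ℝ} (hab : a ≤ b)
    (hg : IntervalIntegrable g volume a b)
    (hG : ∀ τ ∈ Icc a b, AEStronglyMeasurable (fun r => G r τ) (volume.restrict (Ioc a b)))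
    (hGb : ∀ᵐ r, r ∈ Ioc a b → ∀ τ ∈ Icc a b, |G r τ| ≤ g r)
    (hlim : ∀ᵐ r, r ∈ Ioc a b → Tendsto (G r) (𝓝[Icc a b] r) (𝓝 (G r r)))
    {c : ℕ → ℕ → ℝ}
    (hc : ∀ N k, k < N + 1 → c N k ∈ Icc (unifPt a b N k) (unifPt a b N (k + 1))) :
    Tendsto (fun N => ∑ k ∈ Finset.range (N + 1),
      ∫ r in unifPt a b N k..unifPt a b N (k + 1), G r (c N k)) atTop
      (𝓝 (∫ r in a..b, G r r)) := by
  rcases hab.eq_or_lt with rfl | hlt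
  · simp [unifPt]
  let h : ℕ → ℝ := fun N => (b - a) / (N + 1)
  have hh : ∀ N, 0 < h N := fun N => div_pos (by linarith) (by positivity)
  -- The index of the cell containing r; cells are open on the left and closed on the right, hence
  -- the ceiling minus one.
  let κ : ℕ → ℝ → ℕ := fun N r => ⌈(r - a) / h N⌉₊ - 1
  have hκ : ∀ N k r, r ∈ Ioc (unifPt a b N k) (unifPt a b N (k + 1)) → κ N r = k := by
    intro N k r hr
    have : ⌈(r - a) / h N⌉₊ = k + 1 := by
      rw [Nat.ceil_eq_iff (by omega)]
      simp only [unifPt, mem_Ioc] at hr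
      constructor
      · rw [lt_div_iff₀ (hh N)]
        simp only [Nat.add_sub_cancel]
        linarith [hr.1]
      · rw [div_le_iff₀ (hh N)]
        linarith [hr.2]
    simp only [κ, this, Nat.add_sub_cancel]
  have hex : ∀ N r, r ∈ Ioc a b → κ N r < N + 1 ∧
      r ∈ Ioc (unifPt a b N (κ N r)) (unifPt a b N (κ N r + 1)) := by
    intro N r hr
    have hpos : 0 < (r - a) / h N := div_pos (by linarith [hr.1]) (hh N)
    have h1 : 0 < ⌈(r - a) / h N⌉₊ := Nat.ceil_pos.2 hpos
    have h2 : κ N r + 1 = ⌈(r - a) / h N⌉₊ := Nat.sub_add_cancel h1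
    have h3 := Nat.le_ceil ((r - a) / h N)
    have h4 := Nat.ceil_lt_add_one hpos.le
    rw [← h2] at h3 h4
    rw [div_le_iff₀ (hh N)] at h3
    push_cast at h3 h4
    have h5 : (κ N r : ℝ) < (r - a) / h N := by linarith
    have h7 : (r - a) / h N ≤ N + 1 := by
      rw [div_le_iff₀ (hh N)]
      have : ((N : ℝ) + 1) * h N = b - a := by simp only [h]; field_simp
      linarith [hr.2]
    rw [lt_div_iff₀ (hh N)] at h5
    refine ⟨?_, ?_, ?_⟩
    · have : κ N r + 1 ≤ N + 1 := by
        rw [h2]; exact Nat.ceil_le.2 (by push_cast; exact h7)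
      omega
    · simp only [unifPt]; linarith
    · simp only [unifPt]; push_cast; linarith
  have hcm : ∀ N k, k < N + 1 → c N k ∈ Icc a b := fun N k hk =>
    ⟨(unifPt_mem hab (by omega)).1.trans (hc N k hk).1,
      (hc N k hk).2.trans (unifPt_mem hab (by omega)).2⟩
  have hInt : ∀ N k, k < N + 1 → IntervalIntegrable (fun r => G r (c N k)) volume a b := by
    intro N k hk
    refine hg.mono_fun (by rw [uIoc_of_le hab]; exact hG _ (hcm N k hk)) ?_
    rw [EventuallyLE, ae_restrict_iff' measurableSet_uIoc, uIoc_of_le hab]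
    filter_upwards [hGb] with r hr hrm
    exact (hr hrm _ (hcm N k hk)).trans (le_abs_self _)
  have hsub : ∀ N k, k < N + 1 →
      uIcc (unifPt a b N k) (unifPt a b N (k + 1)) ⊆ uIcc a b := by
    intro N k hk
    rw [uIcc_of_le hab]
    exact uIcc_subset_Icc (unifPt_mem hab (by omega)) (unifPt_mem hab (by omega))
  have hcongr : ∀ N k, EqOn (fun r => G r (c N k)) (fun r => G r (c N (κ N r)))
      (uIoc (unifPt a b N k) (unifPt a b N (k + 1))) := by
    intro N k r hr
    rw [uIoc_of_le (unifPt_mono hab N (Nat.le_succ k))] at hr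
    simp only [hκ N k r hr]
  have hInt' : ∀ N k, k < N + 1 → IntervalIntegrable (fun r => G r (c N (κ N r))) volume
      (unifPt a b N k) (unifPt a b N (k + 1)) := fun N k hk =>
    ((hInt N k hk).mono_set (hsub N k hk)).congr (hcongr N k)
  have hIntT : ∀ N, IntervalIntegrable (fun r => G r (c N (κ N r))) volume a b := by
    intro N
    have := IntervalIntegrable.trans_iterate (a := unifPt a b N) (n := N + 1) (hInt' N)
    rwa [unifPt_zero, unifPt_last] at this
  have hsum : ∀ N, ∑ k ∈ Finset.range (N + 1),
      ∫ r in unifPt a b N k..unifPt a b N (k + 1), G r (c N k)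
      = ∫ r in a..b, G r (c N (κ N r)) := by
    intro N
    have := intervalIntegral.sum_integral_adjacent_intervals (hInt' N)
    rw [unifPt_zero, unifPt_last] at this
    rw [← this]
    refine Finset.sum_congr rfl fun k _ => intervalIntegral.integral_congr_ae ?_
    exact Eventually.of_forall fun r hr => hcongr N k hr
  simp_rw [hsum]
  refine intervalIntegral.tendsto_integral_filter_of_dominated_convergence g
    (Eventually.of_forall fun N => (hIntT N).def'.aestronglyMeasurable) ?_ hg ?_
  · refine Eventually.of_forall fun N => ?_
    filter_upwards [hGb] with r hr hrm
    rw [uIoc_of_le hab] at hrm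
    exact hr hrm _ (hcm N _ (hex N r hrm).1)
  · filter_upwards [hlim] with r hr hrm
    rw [uIoc_of_le hab] at hrm
    refine (hr hrm).comp (tendsto_nhdsWithin_iff.2
      ⟨?_, Eventually.of_forall fun N => hcm N _ (hex N r hrm).1⟩)
    have hh0 : Tendsto h atTop (𝓝 0) := by
      simp only [h]
      exact (tendsto_const_nhds.div_atTop
        (tendsto_atTop_add_const_right _ _ tendsto_natCast_atTop_atTop))
    refine tendsto_iff_dist_tendsto_zero.2 (squeeze_zero (fun _ => dist_nonneg) (fun N => ?_) hh0)
    obtain ⟨h1, h2⟩ := hex N r hrm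
    have h3 := hc N _ h1
    rw [unifPt_succ] at h2 h3
    rw [Real.dist_eq, abs_le]
    simp only [h]
    constructor <;> linarith [h2.1, h2.2, h3.1, h3.2]

/-! ## Helly's selection principle -/

/-- The diagonal argument, expressed as sequential compactness of a countable product of compact
sets. -/
theorem IsCompact.exists_subseq_tendsto_of_countable {X α : Type*} [TopologicalSpace X]
    [FirstCountableTopology X] {S : Set X} (hS : IsCompact S) {x : ℕ → α → X}
    (hx : ∀ n a, x n a ∈ S) {Q : Set α} (hQ : Q.Countable) :
    ∃ κ : ℕ → ℕ, StrictMono κ ∧ ∀ q ∈ Q, ∃ y, Tendsto (fun j => x (κ j) q) atTop (𝓝 y) := by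
  have := hQ.to_subtype
  have hc : IsCompact (univ.pi fun _ : Q => S) := isCompact_univ_pi fun _ => hS
  obtain ⟨y, -, κ, hκ, hy⟩ := hc.tendsto_subseq (x := fun n (q : Q) => x n q)
    (fun n => by simpa using fun a _ => hx n a)
  exact ⟨κ, hκ, fun q hq => ⟨y ⟨q, hq⟩, tendsto_pi_nhds.1 hy ⟨q, hq⟩⟩⟩

/-- Convergence is arranged at rational times. Where the limit of the monotone controls is
continuous, nearby rationals make the sequence Cauchy; the remaining times are countably many and
need one further extraction. -/
theorem exists_subseq_forall_tendsto {X : Type*} [PseudoMetricSpace X] {S : Set X}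
    (hS : IsCompact S) {x : ℕ → ℝ → X} {v : ℕ → ℝ → ℝ} (hx : ∀ n t, x n t ∈ S)
    (hv : ∀ n, Monotone (v n)) {C : ℝ} (hvC : ∀ n t, v n t ∈ Icc 0 C) {c : ℝ} (hc : 0 ≤ c)
    (h : ∀ n s t, s ≤ t → dist (x n s) (x n t) ≤ c * (v n t - v n s)) :
    ∃ κ : ℕ → ℕ, StrictMono κ ∧ ∀ t, ∃ y, Tendsto (fun j => x (κ j) t) atTop (𝓝 y) := by
  obtain ⟨κ, hκ, hκQ⟩ := (hS.prod (isCompact_Icc (a := (0 : ℝ)) (b := C))).exists_subseq_tendsto_of_countable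
    (x := fun n t => (x n t, v n t)) (fun n t => ⟨hx n t, hvC n t⟩)
    (countable_range ((↑) : ℚ → ℝ))
  -- An ultrafilter provides a monotone limit of the controls at every time before any subsequence
  -- converges there; at rational times it is the true limit.
  have hw : ∀ t, ∃ w : ℝ, Tendsto (fun j => v (κ j) t) (hyperfilter ℕ) (𝓝 w) := by
    intro t
    obtain ⟨w, -, hw⟩ := (isCompact_Icc (a := (0 : ℝ)) (b := C)).ultrafilter_le_nhds
      ((hyperfilter ℕ).map fun j => v (κ j) t)
      (le_principal_iff.2 (mem_map.2 (Eventually.of_forall fun j => hvC (κ j) t)))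
    exact ⟨w, hw⟩
  choose w hw using hw
  have hwm : Monotone w := fun s t hst =>
    le_of_tendsto_of_tendsto (hw s) (hw t) (Eventually.of_forall fun j => hv _ hst)
  have hwq : ∀ q : ℚ, Tendsto (fun j => v (κ j) q) atTop (𝓝 (w q)) := by
    intro q
    obtain ⟨y, hy⟩ := hκQ q ⟨q, rfl⟩
    have hy2 := (Prod.tendsto_iff _ _).1 hy |>.2
    rwa [← tendsto_nhds_unique (hw q) (hy2.mono_left Nat.hyperfilter_le_atTop)] at hy2
  obtain ⟨κ', hκ', hκQ'⟩ := hS.exists_subseq_tendsto_of_countable (x := fun n => x (κ n))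
    (fun n t => hx _ t) hwm.countable_not_continuousAt
  refine ⟨κ ∘ κ', hκ.comp hκ', fun t => ?_⟩
  by_cases ht : ContinuousAt w t
  swap
  · exact hκQ' t ht
  suffices hC : CauchySeq fun j => x (κ j) t by
    obtain ⟨y, -, hy⟩ := cauchySeq_tendsto_of_isComplete hS.isComplete (fun j => hx (κ j) t) hC
    exact ⟨y, hy.comp hκ'.tendsto_atTop⟩
  rw [Metric.cauchySeq_iff]
  intro δ hδ
  -- The oscillation of `w` allowed between neighbouring rationals; c + 1 in the denominator admits
  -- c = 0.
  obtain ⟨ρ, hρ, hρc⟩ : ∃ ρ > 0, c * ρ < δ / 3 :=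
    ⟨δ / (3 * (c + 1)), by positivity, by
      rw [mul_div_assoc', div_lt_div_iff₀ (by positivity) (by positivity)]; nlinarith⟩
  obtain ⟨r, hr, hrw⟩ := Metric.continuousAt_iff.1 ht (ρ / 2) (by positivity)
  obtain ⟨q, hq1, hq2⟩ := exists_rat_btwn (show t - r < t by linarith)
  obtain ⟨q', hq1', hq2'⟩ := exists_rat_btwn (show t < t + r by linarith)
  have hwd : w q' - w q < ρ := by
    have h1 := hrw (x := (q : ℝ)) (by rw [Real.dist_eq, abs_lt]; constructor <;> linarith)
    have h2 := hrw (x := (q' : ℝ)) (by rw [Real.dist_eq, abs_lt]; constructor <;> linarith)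
    rw [Real.dist_eq, abs_lt] at h1 h2
    linarith [h1.1, h2.2]
  have hev := ((hwq q').sub (hwq q)).eventually (gt_mem_nhds hwd)
  obtain ⟨y, hy⟩ := hκQ q ⟨q, rfl⟩
  have hCq := ((Prod.tendsto_iff _ _).1 hy |>.1).cauchySeq
  obtain ⟨N₁, hN₁⟩ := eventually_atTop.1 hev
  obtain ⟨N₂, hN₂⟩ := Metric.cauchySeq_iff.1 hCq (δ / 3) (by positivity)
  have hone : ∀ m ≥ max N₁ N₂, dist (x (κ m) q) (x (κ m) t) < δ / 3 := by
    intro m hm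
    refine lt_of_le_of_lt (h _ _ _ hq2.le) (lt_of_le_of_lt ?_ hρc)
    have := hN₁ m (le_trans (le_max_left _ _) hm)
    have := hv (κ m) hq1'.le
    gcongr
    linarith
  refine ⟨max N₁ N₂, fun m hm n hn => ?_⟩
  have h1 := hone m hm
  have h2 := hone n hn
  have h3 := hN₂ m (le_trans (le_max_right _ _) hm) n (le_trans (le_max_right _ _) hn)
  have h4 := dist_triangle4 (x (κ m) t) (x (κ m) q) (x (κ n) q) (x (κ n) t)
  rw [dist_comm (x (κ m) t) (x (κ m) q)] at h4
  simp only at h3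
  linarith

/-! ### Integrals over subintervals of [0,T]. -/

theorem MeasureTheory.IntegrableOn.intervalIntegrable_of_mem_Icc {X : Type*} [NormedAddCommGroup X]
    {f : ℝ → X} {T s t : ℝ} (hf : IntegrableOn f (Icc 0 T)) (hs : s ∈ Icc 0 T) (ht : t ∈ Icc 0 T) :
    IntervalIntegrable f volume s t :=
  (hf.mono_set (uIcc_subset_Icc hs ht)).intervalIntegrable

theorem ae_of_ae_restrict_Icc {T s t : ℝ} {p : ℝ → Prop} (hs : s ∈ Icc 0 T) (ht : t ∈ Icc 0 T)
    (h : ∀ᵐ r ∂(volume.restrict (Icc 0 T)), p r) : ∀ᵐ r, r ∈ Icc s t → p r := by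
  rw [ae_restrict_iff' measurableSet_Icc] at h
  filter_upwards [h] with r hr hrm using hr ⟨hs.1.trans hrm.1, hrm.2.trans ht.2⟩

theorem MeasureTheory.IntegrableOn.tendsto_integral_of_tendsto {ι X : Type*} [NormedAddCommGroup X]
    [NormedSpace ℝ X] {f : ℝ → X} {T : ℝ} (hf : IntegrableOn f (Icc 0 T)) {l : Filter ι}
    {s t : ι → ℝ} {s₀ t₀ : ℝ} (hs : Tendsto s l (𝓝 s₀)) (hsm : ∀ᶠ i in l, s i ∈ Icc 0 T)
    (hs₀ : s₀ ∈ Icc 0 T) (ht : Tendsto t l (𝓝 t₀)) (htm : ∀ᶠ i in l, t i ∈ Icc 0 T)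
    (ht₀ : t₀ ∈ Icc 0 T) :
    Tendsto (fun i => ∫ r in s i..t i, f r) l (𝓝 (∫ r in s₀..t₀, f r)) := by
  have hT : (0 : ℝ) ∈ Icc 0 T := ⟨le_rfl, hs₀.1.trans hs₀.2⟩
  have hc : ContinuousOn (fun x => ∫ r in (0 : ℝ)..x, f r) (Icc 0 T) := by
    have := intervalIntegral.continuousOn_primitive_interval (a := 0) (b := T) (f := f)
      (μ := volume) (by rwa [uIcc_of_le hT.2])
    rwa [uIcc_of_le hT.2] at this
  have h1 := ((hc t₀ ht₀).tendsto.comp (tendsto_nhdsWithin_iff.2 ⟨ht, htm⟩)).sub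
    ((hc s₀ hs₀).tendsto.comp (tendsto_nhdsWithin_iff.2 ⟨hs, hsm⟩))
  have heq : ∀ {a b : ℝ}, a ∈ Icc 0 T → b ∈ Icc 0 T →
      (∫ r in (0 : ℝ)..b, f r) - ∫ r in (0 : ℝ)..a, f r = ∫ r in a..b, f r := fun ha hb =>
    intervalIntegral.integral_interval_sub_left (hf.intervalIntegrable_of_mem_Icc hT hb)
      (hf.intervalIntegrable_of_mem_Icc hT ha)
  rw [heq hs₀ ht₀] at h1
  refine h1.congr' ?_
  filter_upwards [hsm, htm] with i h2 h3 using heq h2 h3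

/-! ### Consequences of the assumptions on the energy. -/

/-- Sublevels of the initial energy. -/
def energySublevel {U : Type*} (D : Set U) (E : ℝ → U → ℝ≥0∞) (C : ℝ) : Set U :=
  {x | x ∈ D ∧ (E 0 x).toReal ≤ C}

theorem IsModulusOfContinuity.tendsto_norm_sub {ω : ℝ → ℝ} (hω : IsModulusOfContinuity ω)
    {ι X : Type*} [NormedAddCommGroup X] {l : Filter ι} {x : ι → X} {y : X}
    (h : Tendsto x l (𝓝 y)) : Tendsto (fun n => ω ‖x n - y‖) l (𝓝 0) :=
  hω.tendsto.comp (tendsto_nhdsWithin_iff.2 ⟨by simpa using (h.sub_const y).norm,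
    Eventually.of_forall fun n => norm_nonneg _⟩)

namespace IsConvexEnergy

variable {U W : Type*} [NormedAddCommGroup U] [NormedSpace ℝ U]
    [NormedAddCommGroup W] [InnerProductSpace ℝ W] {i : U →L[ℝ] W} {T : ℝ} {D : Set U}
    {E : ℝ → U → ℝ≥0∞}

theorem ne_top (hE : IsConvexEnergy i T D E) {t : ℝ} (ht : t ∈ Icc 0 T) {x : U} (hx : x ∈ D) :
    E t x ≠ ⊤ := ((hE.domain t ht x).2 hx).ne

theorem integral_power (hE : IsConvexEnergy i T D E) {s t : ℝ} (hs : s ∈ Icc 0 T)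
    (ht : t ∈ Icc 0 T) {x : U} (hx : x ∈ D) :
    IntervalIntegrable (fun r => power E r x) volume s t ∧
      ∫ r in s..t, power E r x = (E t x).toReal - (E s x).toReal := by
  have h := (hE.absCont x hx).mono (c := s) (d := t) (by
    rw [uIcc_of_le (hs.1.trans hs.2)]; exact uIcc_subset_Icc hs ht)
  exact ⟨h.intervalIntegrable_deriv, h.integral_deriv_eq_sub⟩

/-- Gronwall forwards and backwards in time. Coercivity and power continuity refer to sublevels at
time 0 only; this comparison makes them available at all times. -/
theorem exists_comparison (hE : IsConvexEnergy i T D E) :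
    ∃ Λ > 0, ∀ x ∈ D, ∀ s ∈ Icc 0 T, ∀ t ∈ Icc 0 T,
      (E t x).toReal + 1 ≤ Λ * ((E s x).toReal + 1) := by
  obtain ⟨b, hb, hb0, hpow⟩ := hE.power_control
  refine ⟨Real.exp (∫ r in (0 : ℝ)..T, b r), Real.exp_pos _, fun x hx => ?_⟩
  have key : ∀ s ∈ Icc 0 T, ∀ t ∈ Icc 0 T, s ≤ t →
      (E t x).toReal + 1 ≤ Real.exp (∫ r in (0 : ℝ)..T, b r) * ((E s x).toReal + 1) ∧
      (E s x).toReal + 1 ≤ Real.exp (∫ r in (0 : ℝ)..T, b r) * ((E t x).toReal + 1) := by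
    intro s hs t ht hst
    have hT : (0 : ℝ) ≤ T := hs.1.trans hs.2
    have hAC : AbsolutelyContinuousOnInterval (fun r => (E r x).toReal + 1) s t := by
      have h := (hE.absCont x hx).mono (c := s) (d := t) (by
        rw [uIcc_of_le hT]; exact uIcc_subset_Icc hs ht)
      exact h.fun_add ((LipschitzWith.const (1 : ℝ)).lipschitzOnWith.absolutelyContinuousOnInterval)
    have hbI := hb.intervalIntegrable_of_mem_Icc hs ht
    have hd : ∀ᵐ r, r ∈ Icc s t → |deriv (fun r => (E r x).toReal + 1) r| ≤
        b r * ((E r x).toReal + 1) := by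
      filter_upwards [ae_of_ae_restrict_Icc hs ht hpow] with r hr hrm
      rw [deriv_add_const]
      exact (hr hrm x hx).2
    have h1 := hAC.le_mul_exp_of_deriv_le hst hbI
      (hd.mono fun r hr hrm => (le_abs_self _).trans (hr hrm))
    have h2 := hAC.le_mul_exp_of_neg_le_deriv hst hbI
      (hd.mono fun r hr hrm => neg_le.1 ((neg_le_abs _).trans (hr hrm)))
    have hexp : Real.exp (∫ r in s..t, b r) ≤ Real.exp (∫ r in (0 : ℝ)..T, b r) := by
      refine Real.exp_le_exp.2 (intervalIntegral.integral_mono_interval hs.1 hst ht.2 ?_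
        (hb.intervalIntegrable_of_mem_Icc ⟨le_rfl, hT⟩ ⟨hT, le_rfl⟩))
      rw [EventuallyLE, ae_restrict_iff' measurableSet_Ioc]
      exact Eventually.of_forall fun r hr => hb0 r (Ioc_subset_Icc_self hr)
    have hn : ∀ r, 0 ≤ (E r x).toReal + 1 := fun r => by positivity
    constructor
    · rw [mul_comm]
      exact h1.trans (mul_le_mul_of_nonneg_left hexp (hn s))
    · rw [mul_comm]
      exact h2.trans (mul_le_mul_of_nonneg_left hexp (hn t))
  intro s hs t ht
  rcases le_total s t with h | h
  · exact (key s hs t ht h).1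
  · exact (key t ht s hs h).2

/-- An integrable majorant common to a whole sublevel, for dominated convergence of the power along
bounded-energy families. -/
theorem exists_power_bound (hE : IsConvexEnergy i T D E) (C : ℝ) :
    ∃ β : ℝ → ℝ, IntegrableOn β (Icc 0 T) ∧ (∀ t ∈ Icc 0 T, 0 ≤ β t) ∧
      ∀ᵐ t ∂(volume.restrict (Icc 0 T)), ∀ x ∈ energySublevel D E C, |power E t x| ≤ β t := by
  obtain ⟨b, hb, hb0, hpow⟩ := hE.power_control
  obtain ⟨Λ, hΛ, hcmp⟩ := hE.exists_comparison
  refine ⟨fun t => b t * (Λ * (max C 0 + 1)), hb.mul_const _,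
    fun t ht => mul_nonneg (hb0 t ht) (by positivity), ?_⟩
  rw [ae_restrict_iff' measurableSet_Icc] at hpow ⊢
  filter_upwards [hpow] with t ht htm x hx
  refine ((ht htm x hx.1).2).trans (mul_le_mul_of_nonneg_left ?_ (hb0 t htm))
  refine (hcmp x hx.1 0 ⟨le_rfl, htm.1.trans htm.2⟩ t htm).trans ?_
  gcongr
  exact hx.2.trans (le_max_left _ _)

theorem exists_bound (hE : IsConvexEnergy i T D E) (C : ℝ) (hT : 0 ≤ T) :
    ∃ r : ℝ, ∀ x ∈ energySublevel D E C, ‖x‖ ≤ r := by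
  obtain ⟨r, hr⟩ := (hE.coercive C.toNNReal).exists_norm_le
  refine ⟨r, fun x hx => hr x ?_⟩
  have hne := hE.ne_top ⟨le_rfl, hT⟩ hx.1
  simp only [mem_ofPred_eq]
  rw [← ENNReal.ofReal_toReal hne]
  exact ENNReal.ofReal_le_ofReal hx.2

theorem exists_energy_bound (hE : IsConvexEnergy i T D E) (C : ℝ) :
    ∃ C' : ℝ, ∀ x ∈ energySublevel D E C, ∀ t ∈ Icc 0 T, (E t x).toReal ≤ C' := by
  obtain ⟨Λ, hΛ, hcmp⟩ := hE.exists_comparison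
  refine ⟨Λ * (C + 1), fun x hx t ht => ?_⟩
  have := hcmp x hx.1 0 ⟨le_rfl, ht.1.trans ht.2⟩ t ht
  have h2 : Λ * ((E 0 x).toReal + 1) ≤ Λ * (C + 1) := by gcongr; exact hx.2
  linarith

theorem abs_energy_sub_le (hE : IsConvexEnergy i T D E) {C : ℝ} {β : ℝ → ℝ}
    (hβ : IntegrableOn β (Icc 0 T))
    (hpow : ∀ᵐ t ∂(volume.restrict (Icc 0 T)), ∀ x ∈ energySublevel D E C, |power E t x| ≤ β t)
    {x : U} (hx : x ∈ energySublevel D E C) {s t : ℝ} (hs : s ∈ Icc 0 T) (ht : t ∈ Icc 0 T) :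
    |(E t x).toReal - (E s x).toReal| ≤ |∫ r in s..t, β r| := by
  wlog hst : s ≤ t generalizing s t
  · rw [abs_sub_comm, intervalIntegral.integral_symm, abs_neg]
    exact this ht hs (le_of_not_ge hst)
  rw [← (hE.integral_power hs ht hx.1).2]
  refine (intervalIntegral.norm_integral_le_of_norm_le (E := ℝ) hst ?_
    (hβ.intervalIntegrable_of_mem_Icc hs ht)).trans (le_abs_self _)
  filter_upwards [ae_of_ae_restrict_Icc hs ht hpow] with r hr hrm
  exact hr (Ioc_subset_Icc_self hrm) x hx

theorem eventually_lt_energy (hE : IsConvexEnergy i T D E) {ι : Type*} {l : Filter ι}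
    {x : ι → U} {y : U} (hx : ∀ φ : StrongDual ℝ U, Tendsto (fun n => φ (x n)) l (𝓝 (φ y)))
    {t : ℝ} (ht : t ∈ Icc 0 T) {c : ℝ≥0∞} (hc : c < E t y) : ∀ᶠ n in l, c < E t (x n) :=
  (tendsto_toWeakSpace_iff.2 hx).eventually (hE.weak_lsc t ht (toWeakSpace ℝ U y) c hc)

theorem energy_le_of_tendsto (hE : IsConvexEnergy i T D E) {ι : Type*} {l : Filter ι} [l.NeBot]
    {x : ι → U} {y : U} (hx : ∀ φ : StrongDual ℝ U, Tendsto (fun n => φ (x n)) l (𝓝 (φ y)))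
    {t : ℝ} (ht : t ∈ Icc 0 T) (hxD : ∀ᶠ n in l, x n ∈ D) {a : ι → ℝ} {c : ℝ}
    (ha : Tendsto a l (𝓝 c)) (hle : ∀ᶠ n in l, (E t (x n)).toReal ≤ a n) :
    y ∈ D ∧ (E t y).toReal ≤ c := by
  have h : E t y ≤ ENNReal.ofReal c := by
    refine le_of_forall_lt fun c' hc' => ?_
    by_contra! hcon
    obtain ⟨c'', h1, h2⟩ := exists_between hc'
    have h3 := (hE.eventually_lt_energy hx ht h2)
    have hlt : ENNReal.ofReal c < c'' := lt_of_le_of_lt hcon h1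
    have h4 := ((ENNReal.continuous_ofReal.tendsto c).comp ha).eventually (gt_mem_nhds hlt)
    obtain ⟨n, h3, h4, h5, h6⟩ := (h3.and (h4.and (hle.and hxD))).exists
    rw [← ENNReal.ofReal_toReal (hE.ne_top ht h6)] at h3
    exact absurd (h3.trans_le (ENNReal.ofReal_le_ofReal h5)) (not_lt.2 h4.le)
  have hc0 : 0 ≤ c := ge_of_tendsto ha (hle.mono fun n hn => ENNReal.toReal_nonneg.trans hn)
  exact ⟨(hE.domain t ht y).1 (h.trans_lt ENNReal.ofReal_lt_top),
    ENNReal.toReal_le_of_le_ofReal hc0 h⟩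

theorem mem_energySublevel_of_tendsto (hE : IsConvexEnergy i T D E) (hT : 0 ≤ T) {ι : Type*}
    {l : Filter ι} [l.NeBot] {x : ι → U} {y : U}
    (hx : ∀ φ : StrongDual ℝ U, Tendsto (fun n => φ (x n)) l (𝓝 (φ y))) {C : ℝ}
    (hC : ∀ᶠ n in l, x n ∈ energySublevel D E C) : y ∈ energySublevel D E C :=
  hE.energy_le_of_tendsto hx ⟨le_rfl, hT⟩ (hC.mono fun _ h => h.1) tendsto_const_nhds
    (hC.mono fun _ h => h.2)

/-- Joint lower semicontinuity of the energy on sublevels. -/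
theorem energy_le_of_tendsto' (hE : IsConvexEnergy i T D E) {ι : Type*} {l : Filter ι} [l.NeBot]
    {x : ι → U} {y : U} (hx : ∀ φ : StrongDual ℝ U, Tendsto (fun n => φ (x n)) l (𝓝 (φ y)))
    {C : ℝ} (hC : ∀ᶠ n in l, x n ∈ energySublevel D E C) {s : ι → ℝ} {t : ℝ}
    (hs : Tendsto s l (𝓝 t)) (hsm : ∀ᶠ n in l, s n ∈ Icc 0 T) (ht : t ∈ Icc 0 T)
    {a : ι → ℝ} {c : ℝ} (ha : Tendsto a l (𝓝 c)) (hle : ∀ᶠ n in l, (E (s n) (x n)).toReal ≤ a n) :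
    (E t y).toReal ≤ c := by
  obtain ⟨β, hβ, -, hpow⟩ := hE.exists_power_bound C
  -- Replacing the time s n by t changes the energy by at most |∫β|, uniformly on the sublevel; this
  -- reduces the claim to lower semicontinuity at the fixed time t.
  have h0 : Tendsto (fun n => |∫ r in s n..t, β r|) l (𝓝 0) := by
    have := hβ.tendsto_integral_of_tendsto hs hsm ht tendsto_const_nhds
      (Eventually.of_forall fun _ => ht) ht
    rw [intervalIntegral.integral_same] at this
    simpa using this.abs
  have h1 := ha.add h0
  rw [add_zero] at h1
  refine (hE.energy_le_of_tendsto hx ht (hC.mono fun _ h => h.1) h1 ?_).2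
  filter_upwards [hC, hsm, hle] with n h2 h3 h4
  have := (abs_le.1 (hE.abs_energy_sub_le hβ hpow h2 h3 ht)).2
  linarith

theorem exists_power_modulus (hE : IsConvexEnergy i T D E) (hT : 0 ≤ T) (C : ℝ) :
    ∃ γ ω : ℝ → ℝ, IsModulusOfContinuity ω ∧ ∀ᵐ t ∂(volume.restrict (Icc 0 T)),
      ∀ x ∈ energySublevel D E C, ∀ y ∈ energySublevel D E C,
        |power E t x - power E t y| ≤ γ t * ω ‖i x - i y‖ := by
  obtain ⟨γ, ω, -, hω, h⟩ := hE.power_cont (max C 1).toNNReal (by simp)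
  refine ⟨γ, ω, hω, ?_⟩
  filter_upwards [h] with t ht x hx y hy
  have key : ∀ x ∈ energySublevel D E C, E 0 x ≤ ((max C 1).toNNReal : ℝ≥0∞) := fun x hx => by
    rw [← ENNReal.ofReal_toReal (hE.ne_top ⟨le_rfl, hT⟩ hx.1)]
    exact ENNReal.ofReal_le_ofReal (hx.2.trans (le_max_left _ _))
  exact ht x y (key x hx) (key y hy)

/-- The exceptional null set is fixed before the family is, so the family and its limit may depend
on the time t itself. -/
theorem ae_tendsto_power (hE : IsConvexEnergy i T D E) (hT : 0 ≤ T) (C : ℝ) :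
    ∀ᵐ t ∂(volume.restrict (Icc 0 T)), ∀ (ι : Type) (l : Filter ι) (x : ι → U) (y : U),
      (∀ᶠ r in l, x r ∈ energySublevel D E C) → y ∈ energySublevel D E C →
      Tendsto (fun r => i (x r)) l (𝓝 (i y)) →
      Tendsto (fun r => power E t (x r)) l (𝓝 (power E t y)) := by
  obtain ⟨γ, ω, hω, h⟩ := hE.exists_power_modulus hT C
  filter_upwards [h] with t ht ι l x y hx hy hxy
  refine tendsto_iff_dist_tendsto_zero.2 (squeeze_zero' (Eventually.of_forall fun _ => dist_nonneg)
    (hx.mono fun r hr => ht _ hr _ hy) ?_)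
  simpa using (hω.tendsto_norm_sub hxy).const_mul (γ t)

theorem add_le_of_mem_frechetSubdifferential (hE : IsConvexEnergy i T D E) {t : ℝ}
    (ht : t ∈ Icc 0 T) {x y : U} (hx : x ∈ D) (hy : y ∈ D) {ξ : StrongDual ℝ U}
    (hξ : ξ ∈ frechetSubdifferential (fun x => ((E t x : ℝ≥0∞) : EReal)) x) :
    (E t x).toReal + ξ (y - x) ≤ (E t y).toReal := by
  have hcoe : ∀ z ∈ D, ((E t z : ℝ≥0∞) : EReal) = (((E t z).toReal : ℝ) : EReal) := fun z hz =>
    (EReal.coe_ennreal_toReal (hE.ne_top ht hz)).symm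
  refine le_of_mem_frechetSubdifferential hξ (hcoe x hx) fun θ hθ => ?_
  have h := hE.convex t ht y x θ ⟨hθ.1.le, hθ.2⟩
  rw [show θ • y + (1 - θ) • x = x + θ • (y - x) by module] at h
  have hz : E t (x + θ • (y - x)) ≤
      ENNReal.ofReal ((E t x).toReal + θ * ((E t y).toReal - (E t x).toReal)) := by
    refine h.trans (le_of_eq ?_)
    conv_lhs => rw [← ENNReal.ofReal_toReal (hE.ne_top ht hx),
      ← ENNReal.ofReal_toReal (hE.ne_top ht hy)]
    rw [← ENNReal.ofReal_mul hθ.1.le, ← ENNReal.ofReal_mul (by linarith [hθ.2]),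
      ← ENNReal.ofReal_add (mul_nonneg hθ.1.le ENNReal.toReal_nonneg)
        (mul_nonneg (by linarith [hθ.2]) ENNReal.toReal_nonneg)]
    congr 1
    ring
  have hzD : x + θ • (y - x) ∈ D := (hE.domain t ht _).1 (hz.trans_lt ENNReal.ofReal_lt_top)
  rw [hcoe _ hzD, EReal.coe_le_coe_iff]
  refine ENNReal.toReal_le_of_le_ofReal ?_ hz
  have h1 := mul_nonneg hθ.1.le (ENNReal.toReal_nonneg (a := E t y))
  have h2 : 0 ≤ (1 - θ) * (E t x).toReal :=
    mul_nonneg (by linarith [hθ.2]) ENNReal.toReal_nonneg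
  linarith

end IsConvexEnergy

/-! ### Measurability, density of full-measure sets, and integration by parts. -/

theorem MeasureTheory.StronglyMeasurable.aestronglyMeasurable_of_subtype {X : Type*}
    [TopologicalSpace X] {f : ℝ → X} {T : ℝ}
    (hf : StronglyMeasurable (fun t : Icc (0 : ℝ) T => f t)) :
    AEStronglyMeasurable f (volume.restrict (Icc 0 T)) := by
  rw [← map_comap_subtype_coe measurableSet_Icc,
    (MeasurableEmbedding.subtype_coe measurableSet_Icc).aestronglyMeasurable_map_iff]
  exact hf.aestronglyMeasurable

/-- A subset of full measure is dense in [0,T]. Statements known almost everywhere can thus be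
transferred to every time by semicontinuity along the trace filter. -/
theorem neBot_nhdsWithin_Icc_of_ae {T t : ℝ} (hT : 0 < T) (ht : t ∈ Icc 0 T) {p : ℝ → Prop}
    (hp : ∀ᵐ r ∂(volume.restrict (Icc 0 T)), p r) : (𝓝[Icc 0 T ∩ {r | p r}] t).NeBot := by
  rw [← mem_closure_iff_nhdsWithin_neBot]
  rw [ae_restrict_iff' measurableSet_Icc] at hp
  have hd : Dense {r | r ∈ Icc 0 T → p r} := Measure.dense_of_ae hp
  have h1 := hd.open_subset_closure_inter (isOpen_Ioo (a := (0 : ℝ)) (b := T))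
  have h2 : closure (Ioo 0 T) ⊆ closure (Ioo 0 T ∩ {r | r ∈ Icc 0 T → p r}) :=
    closure_minimal h1 isClosed_closure
  rw [closure_Ioo hT.ne] at h2
  refine closure_mono ?_ (h2 ht)
  rintro r ⟨hr1, hr2⟩
  exact ⟨Ioo_subset_Icc_self hr1, hr2 (Ioo_subset_Icc_self hr1)⟩

/-- Integration by parts for a pairing between weakly continuous functions. -/
theorem integral_pairing_by_parts {U W : Type*} [NormedAddCommGroup U] [NormedSpace ℝ U]
    [NormedAddCommGroup W] [InnerProductSpace ℝ W] {i : U →L[ℝ] W} {a b : ℝ} (hab : a ≤ b)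
    {p g : ℝ → W} {p' : ℝ → StrongDual ℝ U} {q : ℝ → U}
    (hp' : IntervalIntegrable p' volume a b) (hg : IntervalIntegrable g volume a b)
    (hp : ∀ s ∈ Icc a b, ∀ t ∈ Icc a b, ∀ x : U,
      inner ℝ (p t) (i x) - inner ℝ (p s) (i x) = ∫ r in s..t, p' r x)
    (hq : ∀ s ∈ Icc a b, ∀ t ∈ Icc a b, ∀ w : W,
      inner ℝ w (i (q t)) - inner ℝ w (i (q s)) = ∫ r in s..t, inner ℝ w (g r))
    (hqc : ∀ φ : StrongDual ℝ U, ContinuousOn (fun r => φ (q r)) (Icc a b))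
    (hpc : ∀ w : W, ContinuousOn (fun r => inner ℝ (p r) w) (Icc a b))
    {Cp Cq : ℝ} (hCp : ∀ r ∈ Icc a b, ‖p r‖ ≤ Cp) (hCq : ∀ r ∈ Icc a b, ‖q r‖ ≤ Cq) :
    ∫ r in a..b, p' r (q r) = inner ℝ (p b) (i (q b)) - inner ℝ (p a) (i (q a))
      - ∫ r in a..b, inner ℝ (p r) (g r) := by
  have hp'm := hp'.1.aestronglyMeasurable
  have hgm := hg.1.aestronglyMeasurable
  have h1 := tendsto_sum_integral_tag (G := fun r τ => p' r (q τ)) (g := fun r => ‖p' r‖ * Cq) hab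
    (hp'.norm.mul_const Cq)
    (fun τ _ => (ContinuousLinearMap.apply ℝ ℝ (q τ)).continuous.comp_aestronglyMeasurable hp'm)
    (Eventually.of_forall fun r _ τ hτ => ((p' r).le_opNorm _).trans (by gcongr; exact hCq τ hτ))
    (Eventually.of_forall fun r hr => hqc (p' r) r (Ioc_subset_Icc_self hr))
    (c := fun N k => unifPt a b N (k + 1))
    (fun N k _ => ⟨unifPt_mono hab N (Nat.le_succ k), le_rfl⟩)
  have h2 := tendsto_sum_integral_tag (G := fun r τ => inner ℝ (p τ) (g r))
    (g := fun r => Cp * ‖g r‖) hab (hg.norm.const_mul Cp)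
    (fun τ _ => (innerSL ℝ (p τ)).continuous.comp_aestronglyMeasurable hgm)
    (Eventually.of_forall fun r _ τ hτ => (norm_inner_le_norm (𝕜 := ℝ) _ _).trans
      (by gcongr; exact hCp τ hτ))
    (Eventually.of_forall fun r hr => hpc (g r) r (Ioc_subset_Icc_self hr))
    (c := fun N k => unifPt a b N k)
    (fun N k _ => ⟨le_rfl, unifPt_mono hab N (Nat.le_succ k)⟩)
  -- Right tags for q and left tags for p make the two sums add up to a telescoping sum exactly,
  -- with no error term: p₁q₁ - p₀q₀ = (p₁ - p₀)q₁ + p₀(q₁ - q₀).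
  have hconst : ∀ N, (∑ k ∈ Finset.range (N + 1),
      ∫ r in unifPt a b N k..unifPt a b N (k + 1), p' r (q (unifPt a b N (k + 1)))) +
      (∑ k ∈ Finset.range (N + 1),
      ∫ r in unifPt a b N k..unifPt a b N (k + 1), inner ℝ (p (unifPt a b N k)) (g r))
      = inner ℝ (p b) (i (q b)) - inner ℝ (p a) (i (q a)) := by
    intro N
    rw [← Finset.sum_add_distrib]
    have := Finset.sum_range_sub
      (fun k => inner ℝ (p (unifPt a b N k)) (i (q (unifPt a b N k)))) (N + 1)
    rw [unifPt_last, unifPt_zero] at this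
    rw [← this]
    refine Finset.sum_congr rfl fun k hk => ?_
    have hk' := Finset.mem_range.1 hk
    have hm1 : unifPt a b N k ∈ Icc a b := unifPt_mem hab (by omega)
    have hm2 : unifPt a b N (k + 1) ∈ Icc a b := unifPt_mem hab (by omega)
    rw [← hp _ hm1 _ hm2, ← hq _ hm1 _ hm2]
    ring
  have h3 := h1.add h2
  simp_rw [hconst] at h3
  have := tendsto_nhds_unique tendsto_const_nhds h3
  linarith

/-! ### From dynamic solutions to variational and energy inequalities. -/

section Trajectories

variable {U V W Z : Type*}
    [NormedAddCommGroup U] [NormedSpace ℝ U]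
    [NormedAddCommGroup V] [InnerProductSpace ℝ V]
    [NormedAddCommGroup W] [InnerProductSpace ℝ W]
    [NormedAddCommGroup Z] [NormedSpace ℝ Z]
    {iUV : U →L[ℝ] V} {iVW : V →L[ℝ] W} {iWZ : W →L[ℝ] Z}
    {M : StrongDual ℝ U ≃L[ℝ] StrongDual ℝ U} {MW : W →L[ℝ] W} {VV : V →L[ℝ] StrongDual ℝ V}
    {R : Z → ℝ} {T : ℝ} {D : Set U} {E : ℝ → U → ℝ≥0∞}

/-- The properties of dynamic solutions that are used in the vanishing-inertia limit: regularity,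
the variational inequality, and an upper energy-dissipation inequality. -/
structure ViscousTrajectory (iUV : U →L[ℝ] V) (iVW : V →L[ℝ] W) (iWZ : W →L[ℝ] Z)
    (M : StrongDual ℝ U ≃L[ℝ] StrongDual ℝ U) (MW : W →L[ℝ] W) (VV : V →L[ℝ] StrongDual ℝ V)
    (R : Z → ℝ) (T : ℝ) (D : Set U) (E : ℝ → U → ℝ≥0∞) (ε : ℝ) (A : ℝ) (u : ℝ → U)
    (du : ℝ → W) (duV : ℝ → V) (ddu : ℝ → StrongDual ℝ U) : Prop where
  mem : ∀ t ∈ Icc 0 T, u t ∈ D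
  memCw : MemCw T u
  sobolev : HasSobolevDeriv T (fun t => iUV (u t)) duV
  memCw_deriv : MemCw T du
  sobolev_deriv : HasSobolevDeriv T (fun t => hilbertToDual (iVW.comp iUV) (du t)) ddu
  memLp : MemLp (fun t => (E t (u t)).toReal) ⊤ (volume.restrict (Icc 0 T))
  inequality : ∀ᵐ r ∂(volume.restrict (Icc 0 T)), ∀ x ∈ D,
    (E r (u r)).toReal ≤ (E r x).toReal + R (iWZ (iVW (iUV (x - u r)))) +
      ε * VV (duV r) (iUV (x - u r)) + ε ^ 2 * M (ddu r) (x - u r)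
  power_integrable : IntegrableOn (fun r => power E r (u r)) (Icc 0 T)
  energy_le : ∀ᵐ t ∂(volume.restrict (Icc 0 T)),
    ε ^ 2 / 2 * inner ℝ (MW (du t)) (du t) + (E t (u t)).toReal +
      (∫ r in (0 : ℝ)..t, viscousDissipation (iWZ.comp iVW) VV R ε (duV r))
    ≤ A + ∫ r in (0 : ℝ)..t, power E r (u r)

theorem IsViscosityOperator.nonneg (hVV : IsViscosityOperator VV) (v : V) : 0 ≤ VV v v := by
  obtain ⟨c, hc, h⟩ := hVV.posDef
  exact (by positivity : 0 ≤ c * ‖v‖ ^ 2).trans (h v)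

theorem integrableOn_viscousDissipation (hR : IsDissipationPotential R) {duV : ℝ → V}
    (hd : MemLp duV 2 (volume.restrict (Icc 0 T))) (j : V →L[ℝ] Z) (ε : ℝ) :
    IntegrableOn (fun r => VV (duV r) (duV r)) (Icc 0 T) ∧
    IntegrableOn (fun r => R (j (duV r))) (Icc 0 T) ∧
    IntegrableOn (fun r => viscousDissipation j VV R ε (duV r)) (Icc 0 T) := by
  have hm := hd.aestronglyMeasurable
  have h1 : IntegrableOn (fun r => VV (duV r) (duV r)) (Icc 0 T) := by
    refine Integrable.mono' (hd.integrable_norm_pow (by norm_num) |>.const_mul ‖VV‖) ?_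
      (Eventually.of_forall fun r => ?_)
    · exact (isBoundedBilinearMap_apply.continuous.comp_aestronglyMeasurable
        ((VV.continuous.comp_aestronglyMeasurable hm).prodMk hm))
    · refine (VV.le_opNorm₂ _ _).trans (le_of_eq ?_)
      simp
      ring
  have h2 : IntegrableOn (fun r => R (j (duV r))) (Icc 0 T) := by
    obtain ⟨ρ₁, ρ₂, hρ1, hρ12, hb⟩ := hR.bounds
    refine Integrable.mono' ((hd.integrable (by norm_num)).norm.const_mul (ρ₂ * ‖j‖))
      ((hR.continuous.comp j.continuous).comp_aestronglyMeasurable hm)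
      (Eventually.of_forall fun r => ?_)
    rw [Real.norm_of_nonneg (hR.nonneg _), mul_assoc]
    refine (hb _).2.trans ?_
    have := hρ1.le.trans hρ12
    gcongr
    exact j.le_opNorm _
  exact ⟨h1, h2, (h1.const_mul _).add h2⟩

theorem fenchelConjugate_toReal_nonneg {X : Type*} [NormedAddCommGroup X] [NormedSpace ℝ X]
    {Φ : X → EReal} (h0 : Φ 0 = 0) (ζ : StrongDual ℝ X) : 0 ≤ (fenchelConjugate Φ ζ).toReal := by
  refine EReal.toReal_nonneg ?_
  refine le_trans ?_ (le_iSup _ (0 : X))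
  simp [h0]

/-- Pairing the inclusion with x - u turns the global subgradient ξ and the bound η ≤ R into the
variational inequality. In the balance the conjugate is nonnegative because the viscous dissipation
vanishes at 0, so it is dropped. -/
theorem IsDissipativeDynamicSolution.exists_viscousTrajectory
    (hR : IsDissipationPotential R) (hT : 0 < T)
    (hE : IsConvexEnergy (iVW.comp iUV) T D E) {ε : ℝ} {u₀ : U} {u₁ : V} {u : ℝ → U}
    (h : IsDissipativeDynamicSolution iUV iVW iWZ M MW VV R T D E ε u₀ u₁ u) :
    u 0 = u₀ ∧ ∃ du duV ddu, ViscousTrajectory iUV iVW iWZ M MW VV R T D E ε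
      (ε ^ 2 / 2 * inner ℝ (MW (iVW u₁)) (iVW u₁) + (E 0 u₀).toReal) u du duV ddu := by
  obtain ⟨du, duV, ddu, η, ξ, ζ, hmem, hCw, hsob, hC1, hae, hsob1, hsob2, hLp, hu0, hdu0, hηm, hξm,
    hincl, hζ, hint, hpow, N, hN, hN0, hbal⟩ := h
  refine ⟨hu0, du, duV, ddu, hmem, hCw, hsob, hC1.2.1, hsob2, hLp, ?_, hpow, ?_⟩
  · filter_upwards [hincl, ae_restrict_mem measurableSet_Icc] with r ⟨h1, h2, h3⟩ hr x hx
    have h4 := hE.add_le_of_mem_frechetSubdifferential hr (hmem r hr) hx h2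
    have h5 := hR.le_of_mem_frechetSubdifferential h1 (iWZ (iVW (iUV (x - u r))))
    have h6 := congrArg (fun L : StrongDual ℝ U => L (x - u r)) h3
    simp only [add_apply, smul_apply,
      ContinuousLinearMap.comp_apply, smul_eq_mul, zero_apply] at h6
    linarith
  · have hvis := (integrableOn_viscousDissipation (VV := VV) hR hsob.1 (iWZ.comp iVW) ε).2.2
    rw [ae_restrict_iff' measurableSet_Icc]
    filter_upwards [measure_eq_zero_iff_ae_notMem.1 hN0] with t ht htm
    rw [← hbal t ⟨htm, ht⟩]
    gcongr
    refine intervalIntegral.integral_mono_on htm.1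
      (hvis.intervalIntegrable_of_mem_Icc ⟨le_rfl, hT.le⟩ htm)
      (hint.intervalIntegrable_of_mem_Icc ⟨le_rfl, hT.le⟩ htm) fun r _ => ?_
    have := fenchelConjugate_toReal_nonneg (Φ := fun v =>
      ((viscousDissipation (iWZ.comp iVW) VV R ε v : ℝ) : EReal))
      (by simp [viscousDissipation, hR.map_zero]) (ζ r)
    linarith

namespace ViscousTrajectory

variable {ε A : ℝ} {u : ℝ → U} {du : ℝ → W} {duV : ℝ → V} {ddu : ℝ → StrongDual ℝ U}

/-- Gronwall for the energy plus one: kinetic energy and dissipation are nonnegative, and the power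
is controlled by the energy itself. -/
theorem ae_energy_le (hVV : IsViscosityOperator VV) (hR : IsDissipationPotential R)
    (hM : IsMassOperator (iVW.comp iUV) M MW) (hε : 0 < ε) {C : ℝ}
    {b : ℝ → ℝ} (hb : IntegrableOn b (Icc 0 T)) (hb0 : ∀ t ∈ Icc 0 T, 0 ≤ b t)
    (hpow : ∀ᵐ t ∂(volume.restrict (Icc 0 T)), ∀ u ∈ D,
      DifferentiableAt ℝ (fun s => (E s u).toReal) t ∧
        |power E t u| ≤ b t * ((E t u).toReal + 1)) (hT : 0 < T) (hA : A ≤ C)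
    (h : ViscousTrajectory iUV iVW iWZ M MW VV R T D E ε A u du duV ddu) :
    ∀ᵐ t ∂(volume.restrict (Icc 0 T)), (E t (u t)).toReal + 1 ≤
      (max C 0 + 1) * Real.exp (∫ r in (0 : ℝ)..T, b r) := by
  have h0 : (0 : ℝ) ∈ Icc 0 T := ⟨le_rfl, hT.le⟩
  have hTm : T ∈ Icc 0 T := ⟨hT.le, le_rfl⟩
  have hφ : MemLp (fun t => (E t (u t)).toReal + 1) ⊤ (volume.restrict (Icc 0 T)) :=
    h.memLp.add (memLp_const 1)
  have hbφ : IntegrableOn (fun t => b t * ((E t (u t)).toReal + 1)) (Icc 0 T) :=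
    hφ.integrable_mul (memLp_one_iff_integrable.2 hb) |>.congr
      (Eventually.of_forall fun t => mul_comm _ _)
  have key := gronwall_of_ae_le (φ := fun t => (E t (u t)).toReal + 1) (c := max C 0 + 1) hT.le hb0
    (hb.intervalIntegrable_of_mem_Icc h0 hTm) (hbφ.intervalIntegrable_of_mem_Icc h0 hTm) <| by
      filter_upwards [ae_of_ae_restrict_Icc h0 hTm h.energy_le] with t ht htm
      have h1 := ht htm
      have h2 : 0 ≤ ∫ r in (0 : ℝ)..t, viscousDissipation (iWZ.comp iVW) VV R ε (duV r) := by
        refine intervalIntegral.integral_nonneg htm.1 fun r _ => ?_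
        exact add_nonneg (mul_nonneg (by positivity) (hVV.nonneg _)) (hR.nonneg _)
      have h3 : 0 ≤ ε ^ 2 / 2 * inner ℝ (MW (du t)) (du t) := by
        obtain ⟨c, hc, hpos⟩ := hM.posDef
        exact mul_nonneg (by positivity) ((by positivity : 0 ≤ c * ‖du t‖ ^ 2).trans (hpos _))
      have h4 : ∫ r in (0 : ℝ)..t, power E r (u r) ≤
          ∫ r in (0 : ℝ)..t, b r * ((E r (u r)).toReal + 1) := by
        refine intervalIntegral.integral_mono_ae_restrict htm.1
          (h.power_integrable.intervalIntegrable_of_mem_Icc h0 htm)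
          (hbφ.intervalIntegrable_of_mem_Icc h0 htm) ?_
        rw [EventuallyLE, ae_restrict_iff' measurableSet_Icc]
        filter_upwards [ae_of_ae_restrict_Icc h0 hTm hpow] with r hr hrm
        have hr' : r ∈ Icc 0 T := ⟨hrm.1, hrm.2.trans htm.2⟩
        exact (le_abs_self _).trans (hr hr' _ (h.mem r hr')).2
      have := le_max_left C 0
      linarith
  rw [ae_restrict_iff' measurableSet_Icc]
  filter_upwards [key] with t ht htm
  refine (ht htm).trans ?_
  gcongr
  refine intervalIntegral.integral_mono_interval le_rfl htm.1 htm.2 ?_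
    (hb.intervalIntegrable_of_mem_Icc h0 hTm)
  rw [EventuallyLE, ae_restrict_iff' measurableSet_Ioc]
  exact Eventually.of_forall fun r hr => hb0 r (Ioc_subset_Icc_self hr)

/-- The constant depends on C but not on the trajectory. The almost-everywhere bound extends to
every time by weak continuity of u and weak closedness of the sublevels. -/
theorem exists_mem_energySublevel (hVV : IsViscosityOperator VV) (hR : IsDissipationPotential R)
    (hM : IsMassOperator (iVW.comp iUV) M MW) (hT : 0 < T)
    (hE : IsConvexEnergy (iVW.comp iUV) T D E) (C : ℝ) :
    ∃ C', ∀ ⦃ε A u du duV ddu⦄, 0 < ε → A ≤ C →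
      ViscousTrajectory iUV iVW iWZ M MW VV R T D E ε A u du duV ddu →
      ∀ t ∈ Icc 0 T, u t ∈ energySublevel D E C' := by
  obtain ⟨b, hb, hb0, hpow⟩ := hE.power_control
  obtain ⟨Λ, hΛ, hcmp⟩ := hE.exists_comparison
  refine ⟨Λ * ((max C 0 + 1) * Real.exp (∫ r in (0 : ℝ)..T, b r)), ?_⟩
  intro ε A u du duV ddu hε hA h t ht
  have hae : ∀ᵐ r ∂(volume.restrict (Icc 0 T)),
      u r ∈ energySublevel D E (Λ * ((max C 0 + 1) * Real.exp (∫ r in (0 : ℝ)..T, b r))) := by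
    filter_upwards [h.ae_energy_le hVV hR hM hε hb hb0 hpow hT hA,
      ae_restrict_mem measurableSet_Icc] with r hr hrm
    refine ⟨h.mem r hrm, ?_⟩
    have h1 := hcmp _ (h.mem r hrm) r hrm 0 ⟨le_rfl, hT.le⟩
    have h2 := mul_le_mul_of_nonneg_left hr hΛ.le
    linarith
  have := neBot_nhdsWithin_Icc_of_ae hT ht hae
  refine hE.mem_energySublevel_of_tendsto hT.le
    (l := 𝓝[Icc 0 T ∩ {r | u r ∈ energySublevel D E
      (Λ * ((max C 0 + 1) * Real.exp (∫ r in (0 : ℝ)..T, b r)))}] t) (x := u) (fun φ => ?_) ?_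
  · exact (h.memCw.2 φ t ht).mono_left (nhdsWithin_mono _ inter_subset_left)
  · filter_upwards [self_mem_nhdsWithin] with r hr using hr.2

/-- The upper energy inequality holds at every time. -/
theorem energy_le_all (hR : IsDissipationPotential R)
    (hM : IsMassOperator (iVW.comp iUV) M MW) (hT : 0 < T)
    (hE : IsConvexEnergy (iVW.comp iUV) T D E) {C : ℝ}
    (h : ViscousTrajectory iUV iVW iWZ M MW VV R T D E ε A u du duV ddu)
    (hC : ∀ t ∈ Icc 0 T, u t ∈ energySublevel D E C) {t : ℝ} (ht : t ∈ Icc 0 T) :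
    ε ^ 2 / 2 * inner ℝ (MW (du t)) (du t) + (E t (u t)).toReal +
      (∫ r in (0 : ℝ)..t, viscousDissipation (iWZ.comp iVW) VV R ε (duV r))
    ≤ A + ∫ r in (0 : ℝ)..t, power E r (u r) := by
  have h0 : (0 : ℝ) ∈ Icc 0 T := ⟨le_rfl, hT.le⟩
  have hvis := (integrableOn_viscousDissipation (VV := VV) hR h.sobolev.1 (iWZ.comp iVW) ε).2.2
  have hne := neBot_nhdsWithin_Icc_of_ae hT ht h.energy_le
  set l := 𝓝[Icc 0 T ∩ {t | ε ^ 2 / 2 * inner ℝ (MW (du t)) (du t) + (E t (u t)).toReal +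
      (∫ r in (0 : ℝ)..t, viscousDissipation (iWZ.comp iVW) VV R ε (duV r))
    ≤ A + ∫ r in (0 : ℝ)..t, power E r (u r)}] t with hl
  have hmem : ∀ᶠ r in l, r ∈ Icc 0 T := by
    filter_upwards [self_mem_nhdsWithin] with r hr using hr.1
  have hid : Tendsto (fun r => r) l (𝓝 t) := tendsto_id.mono_left nhdsWithin_le_nhds
  have hlI : l ≤ 𝓝[Icc 0 T] t := nhdsWithin_mono _ inter_subset_left
  have hP := h.power_integrable.tendsto_integral_of_tendsto (l := l) tendsto_const_nhds
    (Eventually.of_forall fun _ => h0) h0 hid hmem ht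
  have hQ := hvis.tendsto_integral_of_tendsto (l := l) tendsto_const_nhds
    (Eventually.of_forall fun _ => h0) h0 hid hmem ht
  -- The derivative is only weakly continuous, so the kinetic energy is bounded below by its tangent
  -- at `du t`, namely 2⟨𝕄 du(t), du(r)⟩ - ⟨𝕄 du(t), du(t)⟩, which converges.
  have hK : Tendsto (fun r => inner ℝ (MW (du t)) (du r)) l (𝓝 (inner ℝ (MW (du t)) (du t))) :=
    (h.memCw_deriv.2 (innerSL ℝ (MW (du t))) t ht).mono_left hlI
  have hlim := (((hP.const_add A).sub hQ).sub
    (((hK.const_mul 2).sub_const (inner ℝ (MW (du t)) (du t))).const_mul (ε ^ 2 / 2)))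
  have := hE.energy_le_of_tendsto' (l := l) (x := u) (y := u t) (s := fun r => r)
    (fun φ => (h.memCw.2 φ t ht).mono_left hlI) (C := C) (hmem.mono fun r hr => hC r hr) hid hmem ht
    hlim (by
      filter_upwards [self_mem_nhdsWithin] with r hr
      have h1 := hr.2
      simp only [mem_ofPred_eq] at h1
      have h2 : 0 ≤ inner ℝ (MW (du r - du t)) (du r - du t) := by
        obtain ⟨c, hc, hpos⟩ := hM.posDef
        exact (by positivity : 0 ≤ c * ‖du r - du t‖ ^ 2).trans (hpos _)
      rw [map_sub, inner_sub_left, inner_sub_right, inner_sub_right] at h2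
      have h3 : inner ℝ (MW (du r)) (du t) = inner ℝ (MW (du t)) (du r) := by
        rw [hM.symm, real_inner_comm]
      rw [h3] at h2
      have h4 := mul_le_mul_of_nonneg_left (a := ε ^ 2 / 2)
        (show 2 * inner ℝ (MW (du t)) (du r) - inner ℝ (MW (du t)) (du t) ≤
          inner ℝ (MW (du r)) (du r) by linarith) (by positivity)
      linarith)
  linarith

end ViscousTrajectory

end Trajectories

/-! ### Uniform bounds and time-integrated stability. -/

theorem HasSobolevDeriv.sub_eq_integral {X : Type*} [NormedAddCommGroup X] [NormedSpace ℝ X]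
    {T : ℝ} {f g : ℝ → X} (hfg : HasSobolevDeriv T f g) {a b : ℝ} (ha : a ∈ Icc 0 T)
    (hb : b ∈ Icc 0 T) : f b - f a = ∫ r in a..b, g r := by
  have h0 : (0 : ℝ) ∈ Icc 0 T := ⟨le_rfl, ha.1.trans ha.2⟩
  have hg : IntegrableOn g (Icc 0 T) := hfg.1.integrable (by norm_num)
  rw [hfg.2 b hb, hfg.2 a ha, add_sub_add_left_eq_sub]
  exact intervalIntegral.integral_interval_sub_left (hg.intervalIntegrable_of_mem_Icc h0 hb)
    (hg.intervalIntegrable_of_mem_Icc h0 ha)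

namespace ViscousTrajectory

variable {U V W Z : Type*}
    [NormedAddCommGroup U] [NormedSpace ℝ U]
    [NormedAddCommGroup V] [InnerProductSpace ℝ V]
    [NormedAddCommGroup W] [InnerProductSpace ℝ W]
    [NormedAddCommGroup Z] [NormedSpace ℝ Z]
    {iUV : U →L[ℝ] V} {iVW : V →L[ℝ] W} {iWZ : W →L[ℝ] Z}
    {M : StrongDual ℝ U ≃L[ℝ] StrongDual ℝ U} {MW : W →L[ℝ] W} {VV : V →L[ℝ] StrongDual ℝ V}
    {R : Z → ℝ} {T : ℝ} {D : Set U} {E : ℝ → U → ℝ≥0∞}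

theorem exists_uniform_bounds (hVV : IsViscosityOperator VV) (hR : IsDissipationPotential R)
    (hM : IsMassOperator (iVW.comp iUV) M MW) (hT : 0 < T)
    (hE : IsConvexEnergy (iVW.comp iUV) T D E) (C : ℝ) :
    ∃ K, ∀ ⦃ε A u du duV ddu⦄, 0 < ε → A ≤ C →
      ViscousTrajectory iUV iVW iWZ M MW VV R T D E ε A u du duV ddu →
      (∀ t ∈ Icc 0 T, u t ∈ energySublevel D E K) ∧
      (∫ r in (0 : ℝ)..T, R (iWZ (iVW (duV r)))) ≤ K ∧
      ε * (∫ r in (0 : ℝ)..T, ‖duV r‖ ^ 2) ≤ K ∧ ∀ t ∈ Icc 0 T, ε * ‖du t‖ ≤ K := by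
  obtain ⟨C', hC'⟩ := exists_mem_energySublevel (iWZ := iWZ) hVV hR hM hT hE C
  obtain ⟨β, hβ, hβ0, hpow⟩ := hE.exists_power_bound C'
  obtain ⟨cM, hcM, hMpos⟩ := hM.posDef
  obtain ⟨cV, hcV, hVpos⟩ := hVV.posDef
  set B : ℝ := C + ∫ r in (0 : ℝ)..T, β r with hB
  -- `B` bounds the whole left-hand side of the energy inequality; the entries control the energy,
  -- ∫R, the viscous integral, and the velocity in W. The last bound on ε‖du‖ comes from that on its
  -- square via y ≤ 1 + y².
  refine ⟨max (max C' B) (max (2 * B / cV) (1 + 2 * B / cM)), ?_⟩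
  intro ε A u du duV ddu hε hA h
  have h0 : (0 : ℝ) ∈ Icc 0 T := ⟨le_rfl, hT.le⟩
  have hTm : T ∈ Icc 0 T := ⟨hT.le, le_rfl⟩
  have hsub := hC' hε hA h
  obtain ⟨hi1, hi2, -⟩ := integrableOn_viscousDissipation (VV := VV) hR h.sobolev.1 (iWZ.comp iVW) ε
  have hkin : ∀ t, 0 ≤ ε ^ 2 / 2 * inner ℝ (MW (du t)) (du t) := fun t =>
    mul_nonneg (by positivity) ((by positivity : 0 ≤ cM * ‖du t‖ ^ 2).trans (hMpos _))
  have hmain : ∀ t ∈ Icc 0 T, ε ^ 2 / 2 * inner ℝ (MW (du t)) (du t) +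
      (ε / 2 * (∫ r in (0 : ℝ)..t, VV (duV r) (duV r)) +
        ∫ r in (0 : ℝ)..t, R (iWZ (iVW (duV r)))) ≤ B := by
    intro t ht
    have h1 := h.energy_le_all hR hM hT hE hsub ht
    have h2 : ∫ r in (0 : ℝ)..t, power E r (u r) ≤ ∫ r in (0 : ℝ)..T, β r := by
      have h3 : ∫ r in (0 : ℝ)..t, power E r (u r) ≤ ∫ r in (0 : ℝ)..t, β r := by
        refine intervalIntegral.integral_mono_ae_restrict ht.1
          (h.power_integrable.intervalIntegrable_of_mem_Icc h0 ht)
          (hβ.intervalIntegrable_of_mem_Icc h0 ht) ?_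
        rw [EventuallyLE, ae_restrict_iff' measurableSet_Icc]
        filter_upwards [ae_of_ae_restrict_Icc h0 hTm hpow] with r hr hrm
        have hr' : r ∈ Icc 0 T := ⟨hrm.1, hrm.2.trans ht.2⟩
        exact (le_abs_self _).trans (hr hr' _ (hsub r hr'))
      refine h3.trans (intervalIntegral.integral_mono_interval le_rfl ht.1 ht.2 ?_
        (hβ.intervalIntegrable_of_mem_Icc h0 hTm))
      rw [EventuallyLE, ae_restrict_iff' measurableSet_Ioc]
      exact Eventually.of_forall fun r hr => hβ0 r (Ioc_subset_Icc_self hr)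
    have h4 : (∫ r in (0 : ℝ)..t, viscousDissipation (iWZ.comp iVW) VV R ε (duV r)) =
        ε / 2 * (∫ r in (0 : ℝ)..t, VV (duV r) (duV r)) +
        ∫ r in (0 : ℝ)..t, R (iWZ (iVW (duV r))) := by
      rw [← intervalIntegral.integral_const_mul]
      exact intervalIntegral.integral_add
        ((hi1.intervalIntegrable_of_mem_Icc h0 ht).const_mul _)
        (hi2.intervalIntegrable_of_mem_Icc h0 ht)
    have h5 : 0 ≤ (E t (u t)).toReal := ENNReal.toReal_nonneg
    linarith
  have hVn : ∀ t ∈ Icc 0 T, 0 ≤ ∫ r in (0 : ℝ)..t, VV (duV r) (duV r) := fun t ht =>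
    intervalIntegral.integral_nonneg ht.1 fun r _ => hVV.nonneg _
  have hRn : ∀ t ∈ Icc 0 T, 0 ≤ ∫ r in (0 : ℝ)..t, R (iWZ (iVW (duV r))) := fun t ht =>
    intervalIntegral.integral_nonneg ht.1 fun r _ => hR.nonneg _
  refine ⟨fun t ht => ⟨(hsub t ht).1, (hsub t ht).2.trans ((le_max_left _ _).trans (le_max_left _ _))⟩,
    ?_, ?_, fun t ht => ?_⟩
  · refine le_trans ?_ ((le_max_right _ _).trans (le_max_left _ _))
    have := hmain T hTm
    have := hkin T
    have : 0 ≤ ε / 2 * (∫ r in (0 : ℝ)..T, VV (duV r) (duV r)) :=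
      mul_nonneg (by positivity) (hVn T hTm)
    linarith
  · refine le_trans ?_ ((le_max_left _ _).trans (le_max_right _ _))
    rw [le_div_iff₀ hcV]
    have h1 := hmain T hTm
    have h2 := hkin T
    have h3 := hRn T hTm
    have h4 : cV * (∫ r in (0 : ℝ)..T, ‖duV r‖ ^ 2) ≤ ∫ r in (0 : ℝ)..T, VV (duV r) (duV r) := by
      rw [← intervalIntegral.integral_const_mul]
      refine intervalIntegral.integral_mono_on hT.le ?_
        (hi1.intervalIntegrable_of_mem_Icc h0 hTm) fun r _ => hVpos _
      exact (IntegrableOn.intervalIntegrable_of_mem_Icc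
        (h.sobolev.1.integrable_norm_pow (by norm_num)) h0 hTm).const_mul _
    have h5 := mul_le_mul_of_nonneg_left h4 hε.le
    linarith
  · refine le_trans ?_ ((le_max_right _ _).trans (le_max_right _ _))
    have h1 := hmain t ht
    have h2 := hRn t ht
    have h3 : 0 ≤ ε / 2 * (∫ r in (0 : ℝ)..t, VV (duV r) (duV r)) :=
      mul_nonneg (by positivity) (hVn t ht)
    have h4 : (ε * ‖du t‖) ^ 2 ≤ 2 * B / cM := by
      rw [le_div_iff₀ hcM]
      have := mul_le_mul_of_nonneg_left (hMpos (du t)) (by positivity : 0 ≤ ε ^ 2 / 2)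
      nlinarith
    nlinarith [sq_nonneg (ε * ‖du t‖ - 1)]

/-- The uniform bounds control u' but not u'', so the derivative is moved onto x - u. Its derivative
is -u', whence the plus sign of the kinetic integral. -/
theorem integral_deriv_pairing [CompleteSpace V] [CompleteSpace W]
    (hM : IsMassOperator (iVW.comp iUV) M MW) {ε A : ℝ} {u : ℝ → U} {du : ℝ → W} {duV : ℝ → V}
    {ddu : ℝ → StrongDual ℝ U}
    (h : ViscousTrajectory iUV iVW iWZ M MW VV R T D E ε A u du duV ddu) (x : U) {s t : ℝ}
    (hs : s ∈ Icc 0 T) (ht : t ∈ Icc 0 T) (hst : s ≤ t) :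
    ∫ r in s..t, M (ddu r) (x - u r) =
      inner ℝ (MW (du t)) (iVW (iUV (x - u t))) - inner ℝ (MW (du s)) (iVW (iUV (x - u s)))
      + ∫ r in s..t, inner ℝ (MW (du r)) (iVW (duV r)) := by
  have h0 : (0 : ℝ) ∈ Icc 0 T := ⟨le_rfl, hs.1.trans hs.2⟩
  have hsub : Icc s t ⊆ Icc 0 T := Icc_subset_Icc hs.1 ht.2
  have hddu : IntegrableOn ddu (Icc 0 T) := h.sobolev_deriv.1.integrable (by norm_num)
  have hduV : IntegrableOn duV (Icc 0 T) := h.sobolev.1.integrable (by norm_num)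
  have hMddu : IntegrableOn (fun r => M (ddu r)) (Icc 0 T) :=
    (M : StrongDual ℝ U →L[ℝ] StrongDual ℝ U).integrable_comp hddu
  have hiduV : IntegrableOn (fun r => -iVW (duV r)) (Icc 0 T) := (iVW.integrable_comp hduV).neg
  obtain ⟨⟨-, Cu, hCu⟩, hucont⟩ := h.memCw
  obtain ⟨⟨-, Cd, hCd⟩, hdcont⟩ := h.memCw_deriv
  have key := integral_pairing_by_parts (i := iVW.comp iUV) (p := fun r => MW (du r))
    (g := fun r => -iVW (duV r)) (p' := fun r => M (ddu r)) (q := fun r => x - u r) hst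
    (hMddu.intervalIntegrable_of_mem_Icc hs ht) (hiduV.intervalIntegrable_of_mem_Icc hs ht)
    (Cp := ‖MW‖ * Cd) (Cq := ‖x‖ + Cu) ?_ ?_ ?_ ?_ ?_ ?_
  · simp only [inner_neg_right, intervalIntegral.integral_neg] at key
    rw [key]
    simp only [ContinuousLinearMap.comp_apply]
    ring
  · intro a ha b hb y
    have h1 := h.sobolev_deriv.sub_eq_integral (hsub ha) (hsub hb)
    let L : StrongDual ℝ U →L[ℝ] ℝ :=
      (ContinuousLinearMap.apply ℝ ℝ y).comp (M : StrongDual ℝ U →L[ℝ] StrongDual ℝ U)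
    have h2 := L.intervalIntegral_comp_comm (hddu.intervalIntegrable_of_mem_Icc (hsub ha) (hsub hb))
    rw [← h1] at h2
    have h3 : ∀ w : W, L (hilbertToDual (iVW.comp iUV) w) = inner ℝ (MW w) (iVW (iUV y)) := by
      intro w
      simp only [L, ContinuousLinearMap.comp_apply, ContinuousLinearMap.apply_apply,
        ContinuousLinearEquiv.coe_coe, hM.restrict]
      rfl
    rw [map_sub, h3, h3] at h2
    exact h2.symm
  · intro a ha b hb w
    have h1 := h.sobolev.sub_eq_integral (hsub ha) (hsub hb)
    let L : V →L[ℝ] ℝ := (innerSL ℝ w).comp iVW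
    have h2 := L.intervalIntegral_comp_comm (hduV.intervalIntegrable_of_mem_Icc (hsub ha) (hsub hb))
    rw [← h1] at h2
    simp only [L, ContinuousLinearMap.comp_apply, innerSL_apply_apply, map_sub] at h2
    simp only [inner_neg_right, intervalIntegral.integral_neg, h2, map_sub, inner_sub_right,
      ContinuousLinearMap.comp_apply]
    ring
  · intro φ
    simp only [map_sub]
    exact continuousOn_const.sub ((hucont φ).mono hsub)
  · intro w
    have := (hdcont (innerSL ℝ (MW w))).mono hsub
    refine this.congr fun r _ => ?_
    beta_reduce
    rw [innerSL_apply_apply, hM.symm, real_inner_comm]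
  · intro r hr
    exact (MW.le_opNorm _).trans (by gcongr; exact hCd r (hsub hr))
  · intro r hr
    exact (norm_sub_le _ _).trans (by gcongr; exact hCu r (hsub hr))

/-- The time-integrated approximate stability inequality. -/
theorem exists_integral_energy_le [CompleteSpace V] [CompleteSpace W] (hR : IsDissipationPotential R)
    (hM : IsMassOperator (iVW.comp iUV) M MW) (hT : 0 < T)
    (hE : IsConvexEnergy (iVW.comp iUV) T D E) (K : ℝ) {x : U} (hx : x ∈ D) :
    ∃ L, ∀ ⦃ε A u du duV ddu⦄, 0 < ε →
      ViscousTrajectory iUV iVW iWZ M MW VV R T D E ε A u du duV ddu →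
      (∀ t ∈ Icc 0 T, u t ∈ energySublevel D E K) →
      ε * (∫ r in (0 : ℝ)..T, ‖duV r‖ ^ 2) ≤ K → (∀ t ∈ Icc 0 T, ε * ‖du t‖ ≤ K) →
      IntegrableOn (fun r => (E r (u r)).toReal) (Icc 0 T) ∧
      IntegrableOn (fun r => (E r x).toReal + R (iWZ (iVW (iUV (x - u r))))) (Icc 0 T) ∧
      ∀ s ∈ Icc 0 T, ∀ t ∈ Icc 0 T, s ≤ t →
        ∫ r in s..t, (E r (u r)).toReal ≤
          (∫ r in s..t, ((E r x).toReal + R (iWZ (iVW (iUV (x - u r)))))) + L * (√ε + ε) := by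
  obtain ⟨r₀, hr₀⟩ := hE.exists_bound K hT.le
  set Q := ‖x‖ + r₀ with hQ
  set a := ‖VV‖ * ‖iUV‖ * Q with ha
  -- The first entry collects the factors of √ε, from viscosity and the kinetic integral; the second
  -- collects those of ε, from the two boundary terms.
  refine ⟨max (a * ((T + K) / 2) + K * ‖MW‖ * ‖iVW‖ * ((T + K) / 2))
    (2 * (K * ‖MW‖ * ‖iVW‖ * ‖iUV‖ * Q)), ?_⟩
  intro ε A u du duV ddu hε h hsub hKV hKd
  have h0 : (0 : ℝ) ∈ Icc 0 T := ⟨le_rfl, hT.le⟩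
  have hTm : T ∈ Icc 0 T := ⟨hT.le, le_rfl⟩
  have hq : ∀ r ∈ Icc 0 T, ‖x - u r‖ ≤ Q := fun r hr =>
    (norm_sub_le _ _).trans (by rw [hQ]; gcongr; exact hr₀ _ (hsub r hr))
  have hQ0 : 0 ≤ Q := (norm_nonneg _).trans (hq 0 h0)
  have ha0 : 0 ≤ a := by positivity
  have hK0 : 0 ≤ K := (by positivity : 0 ≤ ε * ‖du 0‖).trans (hKd 0 h0)
  have hum : AEStronglyMeasurable (fun r => x - u r) (volume.restrict (Icc 0 T)) :=
    aestronglyMeasurable_const.sub h.memCw.1.1.aestronglyMeasurable_of_subtype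
  have hdm := h.sobolev.1.aestronglyMeasurable
  have hdum : AEStronglyMeasurable du (volume.restrict (Icc 0 T)) :=
    h.memCw_deriv.1.1.aestronglyMeasurable_of_subtype
  have hduV : IntegrableOn duV (Icc 0 T) := h.sobolev.1.integrable (by norm_num)
  have hddu : IntegrableOn ddu (Icc 0 T) := h.sobolev_deriv.1.integrable (by norm_num)
  have hi1 : IntegrableOn (fun r => (E r (u r)).toReal) (Icc 0 T) := h.memLp.integrable le_top
  have hi2 : IntegrableOn (fun r => (E r x).toReal) (Icc 0 T) := by
    have := (hE.absCont x hx).continuousOn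
    rw [uIcc_of_le hT.le] at this
    exact this.integrableOn_Icc
  have hi3 : IntegrableOn (fun r => R (iWZ (iVW (iUV (x - u r))))) (Icc 0 T) := by
    obtain ⟨ρ₁, ρ₂, hρ1, hρ12, hb⟩ := hR.bounds
    have hρ2 := hρ1.le.trans hρ12
    have hm : AEStronglyMeasurable (fun r => R (iWZ (iVW (iUV (x - u r)))))
        (volume.restrict (Icc 0 T)) := (hR.continuous.comp (iWZ.continuous.comp
      (iVW.continuous.comp iUV.continuous))).comp_aestronglyMeasurable hum
    refine Integrable.mono' (integrable_const (ρ₂ * (‖iWZ‖ * (‖iVW‖ * (‖iUV‖ * Q))))) hm ?_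
    filter_upwards [ae_restrict_mem measurableSet_Icc] with r hr
    rw [Real.norm_of_nonneg (hR.nonneg _)]
    refine (hb _).2.trans ?_
    gcongr
    exact iWZ.le_opNorm_of_le (iVW.le_opNorm_of_le (iUV.le_opNorm_of_le (hq r hr)))
  have hb4 : ∀ r ∈ Icc 0 T, |VV (duV r) (iUV (x - u r))| ≤ a * ‖duV r‖ := by
    intro r hr
    refine (VV.le_opNorm₂ _ _).trans ?_
    have := iUV.le_opNorm_of_le (hq r hr)
    calc ‖VV‖ * ‖duV r‖ * ‖iUV (x - u r)‖ ≤ ‖VV‖ * ‖duV r‖ * (‖iUV‖ * Q) := by gcongr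
      _ = a * ‖duV r‖ := by rw [ha]; ring
  have hi4 : IntegrableOn (fun r => VV (duV r) (iUV (x - u r))) (Icc 0 T) := by
    refine Integrable.mono' (hduV.norm.const_mul a)
      (isBoundedBilinearMap_apply.continuous.comp_aestronglyMeasurable
        ((VV.continuous.comp_aestronglyMeasurable hdm).prodMk
          (iUV.continuous.comp_aestronglyMeasurable hum))) ?_
    filter_upwards [ae_restrict_mem measurableSet_Icc] with r hr using hb4 r hr
  have hi5 : IntegrableOn (fun r => M (ddu r) (x - u r)) (Icc 0 T) := by
    have hMddu : IntegrableOn (fun r => M (ddu r)) (Icc 0 T) :=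
      (M : StrongDual ℝ U →L[ℝ] StrongDual ℝ U).integrable_comp hddu
    refine Integrable.mono' (hMddu.norm.mul_const Q)
      (isBoundedBilinearMap_apply.continuous.comp_aestronglyMeasurable
        (hMddu.aestronglyMeasurable.prodMk hum)) ?_
    filter_upwards [ae_restrict_mem measurableSet_Icc] with r hr
    exact (M (ddu r)).le_opNorm_of_le (hq r hr)
  have hi23 : IntegrableOn (fun r => (E r x).toReal + R (iWZ (iVW (iUV (x - u r))))) (Icc 0 T) :=
    hi2.add hi3
  have hi4' : IntegrableOn (fun r => ε * VV (duV r) (iUV (x - u r))) (Icc 0 T) := hi4.const_mul ε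
  have hi234 : IntegrableOn (fun r => (E r x).toReal + R (iWZ (iVW (iUV (x - u r)))) +
    ε * VV (duV r) (iUV (x - u r))) (Icc 0 T) := hi23.add hi4'
  have hi5' : IntegrableOn (fun r => ε ^ 2 * M (ddu r) (x - u r)) (Icc 0 T) := hi5.const_mul (ε ^ 2)
  have hduVn : IntegrableOn (fun r => ‖duV r‖) (Icc 0 T) := hduV.norm
  refine ⟨hi1, hi23, fun s hs t ht hst => ?_⟩
  have hI : ∀ {f : ℝ → ℝ}, IntegrableOn f (Icc 0 T) → IntervalIntegrable f volume s t :=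
    fun hf => hf.intervalIntegrable_of_mem_Icc hs ht
  have hmono : ∫ r in s..t, (E r (u r)).toReal ≤ ∫ r in s..t,
      ((E r x).toReal + R (iWZ (iVW (iUV (x - u r)))) +
      ε * VV (duV r) (iUV (x - u r)) + ε ^ 2 * M (ddu r) (x - u r)) := by
    refine intervalIntegral.integral_mono_ae_restrict hst (hI hi1)
      (hI (hi234.add hi5')) ?_
    rw [EventuallyLE, ae_restrict_iff' measurableSet_Icc]
    filter_upwards [ae_of_ae_restrict_Icc hs ht h.inequality] with r hr hrm using hr hrm x hx
  have hsplit : ∫ r in s..t, ((E r x).toReal + R (iWZ (iVW (iUV (x - u r)))) +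
      ε * VV (duV r) (iUV (x - u r)) + ε ^ 2 * M (ddu r) (x - u r)) =
      (∫ r in s..t, ((E r x).toReal + R (iWZ (iVW (iUV (x - u r)))))) +
      ε * (∫ r in s..t, VV (duV r) (iUV (x - u r))) + ε ^ 2 * ∫ r in s..t, M (ddu r) (x - u r) := by
    rw [← intervalIntegral.integral_const_mul, ← intervalIntegral.integral_const_mul,
      ← intervalIntegral.integral_add (hI hi23) (hI hi4'),
      ← intervalIntegral.integral_add (hI hi234) (hI hi5')]
  have hsq : IntegrableOn (fun r => ‖duV r‖ ^ 2) (Icc 0 T) :=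
    h.sobolev.1.integrable_norm_pow (by norm_num)
  have hsε : √ε * √ε = ε := Real.mul_self_sqrt hε.le
  -- Young's inequality in the form εy ≤ (√ε/2)(1 + εy²), integrated against the bound on ε∫‖duV‖².
  have hvel : ε * (∫ r in s..t, ‖duV r‖) ≤ √ε * ((T + K) / 2) := by
    have h1 : ε * (∫ r in s..t, ‖duV r‖) ≤ ε * ∫ r in (0 : ℝ)..T, ‖duV r‖ := by
      gcongr
      refine intervalIntegral.integral_mono_interval hs.1 hst ht.2
        (Eventually.of_forall fun r => norm_nonneg _)
        (hduVn.intervalIntegrable_of_mem_Icc h0 hTm)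
    have h2 : ε * (∫ r in (0 : ℝ)..T, ‖duV r‖) ≤
        ∫ r in (0 : ℝ)..T, (√ε / 2 + √ε / 2 * ε * ‖duV r‖ ^ 2) := by
      rw [← intervalIntegral.integral_const_mul]
      refine intervalIntegral.integral_mono_on hT.le
        ((hduVn.intervalIntegrable_of_mem_Icc h0 hTm).const_mul _)
        (intervalIntegrable_const.add
          ((hsq.intervalIntegrable_of_mem_Icc h0 hTm).const_mul _)) fun r _ => ?_
      have := mul_nonneg (Real.sqrt_nonneg ε) (sq_nonneg (1 - √ε * ‖duV r‖))
      have h3 : √ε * (√ε * ‖duV r‖) ^ 2 = √ε * ε * ‖duV r‖ ^ 2 := by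
        rw [mul_pow, sq (√ε), hsε]; ring
      have h4 : √ε * (√ε * ‖duV r‖) = ε * ‖duV r‖ := by rw [← mul_assoc, hsε]
      nlinarith
    rw [intervalIntegral.integral_add intervalIntegrable_const
      ((hsq.intervalIntegrable_of_mem_Icc h0 hTm).const_mul _),
      intervalIntegral.integral_const_mul, intervalIntegral.integral_const] at h2
    have h3 := mul_le_mul_of_nonneg_left hKV (by positivity : 0 ≤ √ε / 2)
    simp only [sub_zero, smul_eq_mul] at h2
    nlinarith
  have hV : ε * (∫ r in s..t, VV (duV r) (iUV (x - u r))) ≤ a * (√ε * ((T + K) / 2)) := by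
    have h1 : (∫ r in s..t, VV (duV r) (iUV (x - u r))) ≤ ∫ r in s..t, a * ‖duV r‖ :=
      intervalIntegral.integral_mono_on hst (hI hi4) ((hI hduV.norm).const_mul a) fun r hr =>
        (le_abs_self _).trans (hb4 r ⟨hs.1.trans hr.1, hr.2.trans ht.2⟩)
    rw [intervalIntegral.integral_const_mul] at h1
    calc ε * (∫ r in s..t, VV (duV r) (iUV (x - u r))) ≤ ε * (a * ∫ r in s..t, ‖duV r‖) := by gcongr
      _ = a * (ε * ∫ r in s..t, ‖duV r‖) := by ring
      _ ≤ _ := by gcongr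
  -- One of the two factors ε is absorbed by the bound on ε‖du‖, leaving a boundary term of order ε.
  have hbd : ∀ r ∈ Icc 0 T, |ε ^ 2 * inner ℝ (MW (du r)) (iVW (iUV (x - u r)))| ≤
      ε * (K * ‖MW‖ * ‖iVW‖ * ‖iUV‖ * Q) := by
    intro r hr
    have h1 : |inner ℝ (MW (du r)) (iVW (iUV (x - u r)))| ≤
        (‖MW‖ * ‖du r‖) * (‖iVW‖ * (‖iUV‖ * Q)) :=
      (abs_real_inner_le_norm _ _).trans (mul_le_mul (MW.le_opNorm _)
        (iVW.le_opNorm_of_le (iUV.le_opNorm_of_le (hq r hr))) (norm_nonneg _) (by positivity))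
    rw [abs_mul, abs_of_nonneg (by positivity : 0 ≤ ε ^ 2)]
    calc ε ^ 2 * |inner ℝ (MW (du r)) (iVW (iUV (x - u r)))|
        ≤ ε ^ 2 * ((‖MW‖ * ‖du r‖) * (‖iVW‖ * (‖iUV‖ * Q))) := by gcongr
      _ = ε * ((ε * ‖du r‖) * ‖MW‖ * ‖iVW‖ * ‖iUV‖ * Q) := by ring
      _ ≤ _ := by gcongr; exact hKd r hr
  -- Again one ε bounds `du`; the other gives ε∫‖duV‖, of order √ε.
  have hkin : ε ^ 2 * (∫ r in s..t, inner ℝ (MW (du r)) (iVW (duV r))) ≤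
      K * ‖MW‖ * ‖iVW‖ * (√ε * ((T + K) / 2)) := by
    rw [← intervalIntegral.integral_const_mul]
    have hb : ∀ r ∈ Icc 0 T, |ε ^ 2 * inner ℝ (MW (du r)) (iVW (duV r))| ≤
        K * ‖MW‖ * ‖iVW‖ * (ε * ‖duV r‖) := by
      intro r hr
      rw [abs_mul, abs_of_nonneg (by positivity : 0 ≤ ε ^ 2)]
      have h1 : |inner ℝ (MW (du r)) (iVW (duV r))| ≤ (‖MW‖ * ‖du r‖) * (‖iVW‖ * ‖duV r‖) :=
        (abs_real_inner_le_norm _ _).trans (mul_le_mul (MW.le_opNorm _)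
          (iVW.le_opNorm _) (norm_nonneg _) (by positivity))
      calc ε ^ 2 * |inner ℝ (MW (du r)) (iVW (duV r))|
          ≤ ε ^ 2 * ((‖MW‖ * ‖du r‖) * (‖iVW‖ * ‖duV r‖)) := by gcongr
        _ = (ε * ‖du r‖) * ‖MW‖ * ‖iVW‖ * (ε * ‖duV r‖) := by ring
        _ ≤ _ := by gcongr; exact hKd r hr
    have hi : IntegrableOn (fun r => ε ^ 2 * inner ℝ (MW (du r)) (iVW (duV r))) (Icc 0 T) := by
      refine Integrable.mono' ((hduV.norm.const_mul ε).const_mul (K * ‖MW‖ * ‖iVW‖)) ?_ ?_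
      · exact ((MW.continuous.comp_aestronglyMeasurable hdum).inner
          (iVW.continuous.comp_aestronglyMeasurable hdm)).const_mul _
      · filter_upwards [ae_restrict_mem measurableSet_Icc] with r hr using hb r hr
    have h1 := intervalIntegral.integral_mono_on hst (hI hi)
      (hI ((hduV.norm.const_mul ε).const_mul (K * ‖MW‖ * ‖iVW‖))) fun r hr =>
        (le_abs_self _).trans (hb r ⟨hs.1.trans hr.1, hr.2.trans ht.2⟩)
    rw [intervalIntegral.integral_const_mul (K * ‖MW‖ * ‖iVW‖),
      intervalIntegral.integral_const_mul ε] at h1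
    exact h1.trans (by gcongr)
  have hpair := h.integral_deriv_pairing hM x hs ht hst
  have h1 := (abs_le.1 (hbd t ht)).2
  have h2 := (abs_le.1 (hbd s hs)).1
  have hfin : ε * (∫ r in s..t, VV (duV r) (iUV (x - u r))) +
      ε ^ 2 * (∫ r in s..t, M (ddu r) (x - u r)) ≤
      √ε * (a * ((T + K) / 2) + K * ‖MW‖ * ‖iVW‖ * ((T + K) / 2)) +
      ε * (2 * (K * ‖MW‖ * ‖iVW‖ * ‖iUV‖ * Q)) := by
    rw [hpair]
    linarith
  have h3 : √ε * (a * ((T + K) / 2) + K * ‖MW‖ * ‖iVW‖ * ((T + K) / 2)) ≤ √ε *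
      max (a * ((T + K) / 2) + K * ‖MW‖ * ‖iVW‖ * ((T + K) / 2))
        (2 * (K * ‖MW‖ * ‖iVW‖ * ‖iUV‖ * Q)) := by gcongr; exact le_max_left _ _
  have h4 : ε * (2 * (K * ‖MW‖ * ‖iVW‖ * ‖iUV‖ * Q)) ≤ ε *
      max (a * ((T + K) / 2) + K * ‖MW‖ * ‖iVW‖ * ((T + K) / 2))
        (2 * (K * ‖MW‖ * ‖iVW‖ * ‖iUV‖ * Q)) := by gcongr; exact le_max_right _ _
  rw [hsplit] at hmono
  linarith

end ViscousTrajectory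

/-! ### Passage to the limit. -/

/-- A limit trajectory together with its limit dissipation `v`. -/
structure LimitTrajectory {U Z : Type*} [NormedAddCommGroup U] [NormedSpace ℝ U]
    [NormedAddCommGroup Z] [NormedSpace ℝ Z] (k : U →L[ℝ] Z) (R : Z → ℝ) (T : ℝ) (D : Set U)
    (E : ℝ → U → ℝ≥0∞) (K : ℝ) (u : ℝ → U) (v : ℝ → ℝ) : Prop where
  mem : ∀ t, u t ∈ energySublevel D E K
  memB : MemB T u
  mono : Monotone v
  le_sub : ∀ s t, s ≤ t → R (k (u t) - k (u s)) ≤ v t - v s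
  zero : v 0 = 0
  -- Constant extension outside [0,T] makes one-sided limits meaningful at every real time and
  -- builds in the conventions u⁻(0) = u(0) and u⁺(T) = u(T).
  const_left : ∀ t ≤ 0, u t = u 0 ∧ v t = v 0
  const_right : ∀ t, T ≤ t → u t = u T ∧ v t = v T
  power_integrable : IntegrableOn (fun r => power E r (u r)) (Icc 0 T)
  energy_le : ∀ t ∈ Icc 0 T,
    (E t (u t)).toReal + v t ≤ (E 0 (u 0)).toReal + ∫ r in (0 : ℝ)..t, power E r (u r)
  -- Comparing constants `lo` and `hi`, instead of integrals, requires neither measurability of the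
  -- limit energy nor convergence of the energies; lower semicontinuity suffices.
  averaged_stability : ∀ s ∈ Icc 0 T, ∀ t ∈ Icc 0 T, s < t → ∀ x ∈ D, ∀ lo hi : ℝ,
    (∀ r ∈ Ioo s t, lo < (E r (u r)).toReal) →
    (∀ r ∈ Ioo s t, (E r x).toReal + R (k (x - u r)) ≤ hi) → lo ≤ hi
  stable_zero : IsGloballyStable k R E 0 (u 0)

/-- An injective continuous map on a Polish space is a measurable embedding, so measurability of the
limit in W pulls back to U. -/
theorem stronglyMeasurable_of_tendsto_comp {α U W : Type*} [MeasurableSpace α]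
    [NormedAddCommGroup U] [NormedSpace ℝ U] [CompleteSpace U]
    [TopologicalSpace.SeparableSpace U] [NormedAddCommGroup W] [NormedSpace ℝ W]
    {i : U →L[ℝ] W} (hi : Function.Injective i) {f : ℕ → α → U} {g : α → U}
    (hf : ∀ n, StronglyMeasurable (f n))
    (h : ∀ a, Tendsto (fun n => i (f n a)) atTop (𝓝 (i (g a)))) : StronglyMeasurable g := by
  borelize U W
  have h1 : Measurable fun a => i (g a) :=
    measurable_of_tendsto_metrizable
      (fun n => (i.continuous.comp_stronglyMeasurable (hf n)).measurable) (tendsto_pi_nhds.2 h)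
  have := UniformSpace.secondCountable_of_separable U
  exact ((i.continuous.measurableEmbedding hi).measurable_comp_iff.1 h1).stronglyMeasurable

/-- The nearest point projection onto `[0,T]`. -/
noncomputable def clampIcc (T t : ℝ) : ℝ := max 0 (min T t)

theorem clampIcc_mem {T : ℝ} (hT : 0 ≤ T) (t : ℝ) : clampIcc T t ∈ Icc 0 T :=
  ⟨le_max_left _ _, max_le hT (min_le_left _ _)⟩

theorem clampIcc_of_mem {T t : ℝ} (ht : t ∈ Icc 0 T) : clampIcc T t = t := by
  rw [clampIcc, min_eq_right ht.2, max_eq_right ht.1]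

theorem clampIcc_mono (T : ℝ) : Monotone (clampIcc T) := fun s t h => by
  unfold clampIcc; gcongr

theorem clampIcc_of_le {T t : ℝ} (hT : 0 ≤ T) (ht : t ≤ 0) : clampIcc T t = 0 := by
  rw [clampIcc, min_eq_right (ht.trans hT), max_eq_left ht]

theorem clampIcc_of_ge {T t : ℝ} (hT : 0 ≤ T) (ht : T ≤ t) : clampIcc T t = T := by
  rw [clampIcc, min_eq_left ht, max_eq_right hT]

section Limit

variable {U V W Z : Type*}
    [NormedAddCommGroup U] [NormedSpace ℝ U]
    [NormedAddCommGroup V] [InnerProductSpace ℝ V]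
    [NormedAddCommGroup W] [InnerProductSpace ℝ W]
    [NormedAddCommGroup Z] [NormedSpace ℝ Z]
    {iUV : U →L[ℝ] V} {iVW : V →L[ℝ] W} {iWZ : W →L[ℝ] Z}
    {M : StrongDual ℝ U ≃L[ℝ] StrongDual ℝ U} {MW : W →L[ℝ] W} {VV : V →L[ℝ] StrongDual ℝ V}
    {R : Z → ℝ} {T : ℝ} {D : Set U} {E : ℝ → U → ℝ≥0∞}

/-- The bound gives ε²∫‖duV‖² ≤ εK, so the squared norms tend to 0 in L¹, hence in measure and
almost everywhere along a subsequence. -/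
theorem exists_subseq_velocity_tendsto {ε : ℕ → ℝ} (hεpos : ∀ n, 0 < ε n)
    (hε : Tendsto ε atTop (𝓝 0)) (hT : 0 ≤ T) {duV : ℕ → ℝ → V}
    (hd : ∀ n, MemLp (duV n) 2 (volume.restrict (Icc 0 T))) {K : ℝ}
    (hK : ∀ n, ε n * (∫ r in (0 : ℝ)..T, ‖duV n r‖ ^ 2) ≤ K) :
    ∃ κ : ℕ → ℕ, StrictMono κ ∧ ∀ᵐ t ∂(volume.restrict (Icc 0 T)),
      Tendsto (fun j => ε (κ j) • duV (κ j) t) atTop (𝓝 0) := by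
  have hint : ∀ n, Integrable (fun r => ‖duV n r‖ ^ 2) (volume.restrict (Icc 0 T)) := fun n =>
    (hd n).integrable_norm_pow (by norm_num)
  have hL : Tendsto (fun n => eLpNorm (fun t => ‖ε n • duV n t‖ ^ 2 - 0) 1
      (volume.restrict (Icc 0 T))) atTop (𝓝 0) := by
    have hlim : Tendsto (fun n => ENNReal.ofReal (ε n * K)) atTop (𝓝 0) := by
      have := (ENNReal.continuous_ofReal.tendsto _).comp (hε.mul_const K)
      simpa [Function.comp_def] using this
    refine tendsto_of_tendsto_of_tendsto_of_le_of_le tendsto_const_nhds hlim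
      (fun _ => zero_le) fun n => ?_
    rw [eLpNorm_one_eq_lintegral_enorm]
    have heq : ∀ t, ‖‖ε n • duV n t‖ ^ 2 - 0‖ₑ = ENNReal.ofReal (ε n ^ 2 * ‖duV n t‖ ^ 2) := by
      intro t
      rw [sub_zero, Real.enorm_eq_ofReal (by positivity), norm_smul, mul_pow, Real.norm_eq_abs,
        sq_abs]
    simp_rw [heq]
    rw [← ofReal_integral_eq_lintegral_ofReal ((hint n).const_mul _)
      (Eventually.of_forall fun t => by positivity)]
    refine ENNReal.ofReal_le_ofReal ?_
    rw [integral_const_mul, integral_Icc_eq_integral_Ioc, ← intervalIntegral.integral_of_le hT, sq,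
      mul_assoc]
    exact mul_le_mul_of_nonneg_left (hK n) (hεpos n).le
  have hm := tendstoInMeasure_of_tendsto_eLpNorm (f := fun n t => ‖ε n • duV n t‖ ^ 2)
    (g := fun _ => 0) one_ne_zero (fun n => by
      have := (hd n).aestronglyMeasurable.const_smul (ε n)
      exact (continuous_pow 2).comp_aestronglyMeasurable this.norm)
    aestronglyMeasurable_const hL
  obtain ⟨κ, hκ, h⟩ := hm.exists_seq_tendsto_ae
  refine ⟨κ, hκ, ?_⟩
  filter_upwards [h] with t ht
  rw [tendsto_zero_iff_norm_tendsto_zero]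
  have := (Real.continuous_sqrt.tendsto _).comp ht
  simpa [Function.comp_def] using this

/-- Lebesgue differentiation. It makes the velocity convergence independent of the chosen
representative of the derivative. -/
theorem HasSobolevDeriv.ae_eq {X : Type*} [NormedAddCommGroup X] [NormedSpace ℝ X]
    [CompleteSpace X] {f g g' : ℝ → X} (h : HasSobolevDeriv T f g) (h' : HasSobolevDeriv T f g') :
    g =ᵐ[volume.restrict (Icc 0 T)] g' := by
  rcases lt_or_ge T 0 with hT | hT
  · rw [Icc_eq_empty (not_le.2 hT), Measure.restrict_empty]
    rfl
  have h0 : (0 : ℝ) ∈ Icc 0 T := ⟨le_rfl, hT⟩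
  have hTm : T ∈ Icc 0 T := ⟨hT, le_rfl⟩
  have hg : IntegrableOn g (Icc 0 T) := h.1.integrable (by norm_num)
  have hg' : IntegrableOn g' (Icc 0 T) := h'.1.integrable (by norm_num)
  rw [EventuallyEq, ← Measure.restrict_congr_set Ioo_ae_eq_Icc, ae_restrict_iff' measurableSet_Ioo]
  filter_upwards [(hg.intervalIntegrable_of_mem_Icc h0 hTm).ae_hasDerivAt_integral,
    (hg'.intervalIntegrable_of_mem_Icc h0 hTm).ae_hasDerivAt_integral] with t h1 h2 ht
  have ht' : t ∈ uIcc 0 T := by rw [uIcc_of_le hT]; exact Ioo_subset_Icc_self ht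
  have h3 := h1 ht' 0 left_mem_uIcc
  refine h3.unique ((h2 ht' 0 left_mem_uIcc).congr_of_eventuallyEq ?_)
  filter_upwards [isOpen_Ioo.mem_nhds ht] with s hs
  have := h.2 s (Ioo_subset_Icc_self hs)
  rw [h'.2 s (Ioo_subset_Icc_self hs)] at this
  exact (add_left_cancel this).symm

namespace ViscousTrajectory

variable {ε A : ℝ} {u : ℝ → U} {du : ℝ → W} {duV : ℝ → V} {ddu : ℝ → StrongDual ℝ U}

theorem dissipation_le [CompleteSpace V] [CompleteSpace Z] (hR : IsDissipationPotential R)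
    (h : ViscousTrajectory iUV iVW iWZ M MW VV R T D E ε A u du duV ddu) {s t : ℝ}
    (hs : s ∈ Icc 0 T) (ht : t ∈ Icc 0 T) (hst : s ≤ t) :
    R (iWZ (iVW (iUV (u t))) - iWZ (iVW (iUV (u s)))) ≤
      (∫ r in (0 : ℝ)..t, R (iWZ (iVW (duV r)))) - ∫ r in (0 : ℝ)..s, R (iWZ (iVW (duV r))) := by
  have h0 : (0 : ℝ) ∈ Icc 0 T := ⟨le_rfl, hs.1.trans hs.2⟩
  have hduV : IntegrableOn duV (Icc 0 T) := h.sobolev.1.integrable (by norm_num)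
  have hi : IntegrableOn (fun r => R (iWZ (iVW (duV r)))) (Icc 0 T) :=
    (integrableOn_viscousDissipation (VV := VV) hR h.sobolev.1 (iWZ.comp iVW) ε).2.1
  have h1 := (iWZ.comp iVW).intervalIntegral_comp_comm (hduV.intervalIntegrable_of_mem_Icc hs ht)
  rw [← h.sobolev.sub_eq_integral hs ht, map_sub] at h1
  simp only [ContinuousLinearMap.comp_apply] at h1
  rw [← h1, intervalIntegral.integral_interval_sub_left (hi.intervalIntegrable_of_mem_Icc h0 ht)
    (hi.intervalIntegrable_of_mem_Icc h0 hs)]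
  have hi' : IntegrableOn (fun r => iWZ (iVW (duV r))) (Icc 0 T) :=
    (iWZ.comp iVW).integrable_comp hduV
  exact (hR.setIntegral_le hst (hi'.intervalIntegrable_of_mem_Icc hs ht)).2

end ViscousTrajectory

end Limit

section LimitPassage

variable {U V W Z : Type*}
    [NormedAddCommGroup U] [NormedSpace ℝ U]
    [NormedAddCommGroup V] [InnerProductSpace ℝ V] [CompleteSpace V]
    [NormedAddCommGroup W] [InnerProductSpace ℝ W]
    [NormedAddCommGroup Z] [NormedSpace ℝ Z] [CompleteSpace Z]
    {iUV : U →L[ℝ] V} {iVW : V →L[ℝ] W} {iWZ : W →L[ℝ] Z}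
    {M : StrongDual ℝ U ≃L[ℝ] StrongDual ℝ U} {MW : W →L[ℝ] W} {VV : V →L[ℝ] StrongDual ℝ V}
    {R : Z → ℝ} {T : ℝ} {D : Set U} {E : ℝ → U → ℝ≥0∞}

/-- Compactness: a subsequence of trajectories and of their dissipations converges everywhere. -/
theorem exists_subseq_trajectory_tendsto (hU : IsReflexiveSpace U)
    (hk : Function.Injective (iWZ.comp (iVW.comp iUV)))
    (hUW : IsCompactOperator (iVW.comp iUV)) (hR : IsDissipationPotential R) (hT : 0 < T)
    (hE : IsConvexEnergy (iVW.comp iUV) T D E) {ε A : ℕ → ℝ} {u : ℕ → ℝ → U} {du : ℕ → ℝ → W}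
    {duV : ℕ → ℝ → V} {ddu : ℕ → ℝ → StrongDual ℝ U}
    (h : ∀ n, ViscousTrajectory iUV iVW iWZ M MW VV R T D E (ε n) (A n) (u n) (du n) (duV n) (ddu n))
    {K : ℝ} (hK : ∀ n, ∀ t ∈ Icc 0 T, u n t ∈ energySublevel D E K)
    (hRK : ∀ n, (∫ r in (0 : ℝ)..T, R (iWZ (iVW (duV n r)))) ≤ K) :
    ∃ (κ : ℕ → ℕ) (w : ℝ → U) (v : ℝ → ℝ), StrictMono κ ∧
      (∀ t ∈ Icc 0 T, (∀ φ : StrongDual ℝ U,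
        Tendsto (fun j => φ (u (κ j) t)) atTop (𝓝 (φ (w t)))) ∧
        Tendsto (fun j => ∫ r in (0 : ℝ)..t, R (iWZ (iVW (duV (κ j) r)))) atTop (𝓝 (v t))) ∧
      ∀ t, w t = w (clampIcc T t) ∧ v t = v (clampIcc T t) := by
  obtain ⟨ρ, hρ⟩ := hE.exists_bound K hT.le
  obtain ⟨ρ₁, ρ₂, hρ1, -, hb⟩ := hR.bounds
  have h0 : (0 : ℝ) ∈ Icc 0 T := ⟨le_rfl, hT.le⟩
  have hTm : T ∈ Icc 0 T := ⟨hT.le, le_rfl⟩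
  have hcl := clampIcc_mem hT.le
  have hkc : IsCompactOperator (iWZ.comp (iVW.comp iUV)) := hUW.clm_comp iWZ
  have hS := (hkc.isCompact_closure_image_closedBall ρ).prod (isCompact_Icc (a := (0 : ℝ)) (b := K))
  let vn : ℕ → ℝ → ℝ := fun n t => ∫ r in (0 : ℝ)..clampIcc T t, R (iWZ (iVW (duV n r)))
  have hi : ∀ n, IntegrableOn (fun r => R (iWZ (iVW (duV n r)))) (Icc 0 T) := fun n =>
    (integrableOn_viscousDissipation (VV := VV) hR (h n).sobolev.1 (iWZ.comp iVW) 0).2.1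
  have hvm : ∀ n, Monotone (vn n) := fun n s t hst =>
    intervalIntegral.integral_mono_interval le_rfl (hcl s).1 (clampIcc_mono T hst)
      (Eventually.of_forall fun r => hR.nonneg _)
      ((hi n).intervalIntegrable_of_mem_Icc h0 (hcl t))
  have hvK : ∀ n t, vn n t ∈ Icc 0 K := fun n t =>
    ⟨intervalIntegral.integral_nonneg (hcl t).1 fun r _ => hR.nonneg _,
      (intervalIntegral.integral_mono_interval le_rfl (hcl t).1 (hcl t).2
        (Eventually.of_forall fun r => hR.nonneg _)
        ((hi n).intervalIntegrable_of_mem_Icc h0 hTm)).trans (hRK n)⟩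
  -- The dissipations serve both as monotone controls and as a second component, so they converge as
  -- well; c = ρ₁⁻¹ + 1 dominates the increments of both components.
  obtain ⟨κ, hκ, hκt⟩ := exists_subseq_forall_tendsto hS
    (x := fun n t => (iWZ (iVW (iUV (u n (clampIcc T t)))), vn n t)) (v := vn)
    (fun n t => ⟨subset_closure ⟨u n (clampIcc T t), by
      simpa using hρ _ (hK n _ (hcl t)), rfl⟩, hvK n t⟩) hvm hvK
    (c := ρ₁⁻¹ + 1) (by positivity) (by
      intro n s t hst
      have hv0 : 0 ≤ vn n t - vn n s := sub_nonneg.2 (hvm n hst)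
      rw [Prod.dist_eq]
      refine max_le ?_ ?_
      · have h1 := (h n).dissipation_le hR (hcl s) (hcl t) (clampIcc_mono T hst)
        have h2 := (hb (iWZ (iVW (iUV (u n (clampIcc T t)))) -
          iWZ (iVW (iUV (u n (clampIcc T s)))))).1.trans h1
        rw [dist_comm, dist_eq_norm]
        have h3 : ‖iWZ (iVW (iUV (u n (clampIcc T t)))) - iWZ (iVW (iUV (u n (clampIcc T s))))‖ ≤
            ρ₁⁻¹ * (vn n t - vn n s) := by
          rw [inv_mul_eq_div, le_div_iff₀ hρ1, mul_comm]
          exact h2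
        linarith
      · rw [dist_comm, Real.dist_eq, abs_of_nonneg hv0]
        have : 0 ≤ ρ₁⁻¹ * (vn n t - vn n s) := by positivity
        linarith)
  choose y hy using hκt
  have hlim : ∀ t, ∃ w : U, ∀ φ : StrongDual ℝ U,
      Tendsto (fun j => φ (u (κ j) (clampIcc T t))) atTop (𝓝 (φ w)) := by
    intro t
    obtain ⟨w, -, hw⟩ := hU.exists_weak_limit hk (x := fun j => u (κ j) (clampIcc T t))
      (l := atTop) (C := ρ) (Eventually.of_forall fun j => hρ _ (hK _ _ (hcl t)))
      ((Prod.tendsto_iff _ _).1 (hy t)).1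
    exact ⟨w, hw⟩
  choose w hw using hlim
  refine ⟨κ, fun t => w (clampIcc T t), fun t => (y (clampIcc T t)).2, hκ, fun t ht => ?_,
    fun t => ?_⟩
  · have h1 := hw t
    have h2 := ((Prod.tendsto_iff _ _).1 (hy t)).2
    simp only [vn, clampIcc_of_mem ht] at h1 h2 ⊢
    exact ⟨h1, h2⟩
  · simp only [clampIcc_of_mem (hcl t), and_self]

theorem exists_limitTrajectory [CompleteSpace U] [TopologicalSpace.SeparableSpace U]
    [CompleteSpace W] (hU : IsReflexiveSpace U) (hi : Function.Injective (iVW.comp iUV))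
    (hWZ : Function.Injective iWZ)
    (hUW : IsCompactOperator (iVW.comp iUV)) (hVV : IsViscosityOperator VV)
    (hR : IsDissipationPotential R) (hM : IsMassOperator (iVW.comp iUV) M MW) (hT : 0 < T)
    (hE : IsConvexEnergy (iVW.comp iUV) T D E) {ε A : ℕ → ℝ} (hεpos : ∀ n, 0 < ε n)
    (hε : Tendsto ε atTop (𝓝 0)) {u : ℕ → ℝ → U} {du : ℕ → ℝ → W}
    {duV : ℕ → ℝ → V} {ddu : ℕ → ℝ → StrongDual ℝ U}
    (h : ∀ n, ViscousTrajectory iUV iVW iWZ M MW VV R T D E (ε n) (A n) (u n) (du n) (duV n) (ddu n))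
    {u₀ : U} (hA : Tendsto A atTop (𝓝 (E 0 u₀).toReal))
    (hu₀ : ∀ φ : StrongDual ℝ U, Tendsto (fun n => φ (u n 0)) atTop (𝓝 (φ u₀)))
    (hstab : IsGloballyStable (iWZ.comp (iVW.comp iUV)) R E 0 u₀) :
    ∃ (K : ℝ) (w : ℝ → U) (v : ℝ → ℝ) (κ : ℕ → ℕ), StrictMono κ ∧
      (∀ t ∈ Icc 0 T, ∀ φ : StrongDual ℝ U,
        Tendsto (fun j => φ (u (κ j) t)) atTop (𝓝 (φ (w t)))) ∧
      (∀ᵐ t ∂(volume.restrict (Icc 0 T)),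
        Tendsto (fun j => ε (κ j) • duV (κ j) t) atTop (𝓝 0)) ∧
      w 0 = u₀ ∧ LimitTrajectory (iWZ.comp (iVW.comp iUV)) R T D E K w v := by
  have h0 : (0 : ℝ) ∈ Icc 0 T := ⟨le_rfl, hT.le⟩
  have hTm : T ∈ Icc 0 T := ⟨hT.le, le_rfl⟩
  have hk : Function.Injective (iWZ.comp (iVW.comp iUV)) := hWZ.comp hi
  obtain ⟨C, hC⟩ := hA.bddAbove_range
  obtain ⟨K, hK⟩ := ViscousTrajectory.exists_uniform_bounds (iWZ := iWZ) hVV hR hM hT hE C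
  have hKn := fun n => hK (hεpos n) (hC ⟨n, rfl⟩) (h n)
  obtain ⟨κ₁, hκ₁, hvel⟩ := exists_subseq_velocity_tendsto hεpos hε hT.le
    (fun n => (h n).sobolev.1) (fun n => (hKn n).2.2.1)
  obtain ⟨κ₂, w, v, hκ₂, hconv, hclamp⟩ := exists_subseq_trajectory_tendsto hU hk hUW hR hT hE
    (fun n => h (κ₁ n)) (fun n => (hKn (κ₁ n)).1) (fun n => (hKn (κ₁ n)).2.1)
  have hκ : StrictMono (κ₁ ∘ κ₂) := hκ₁.comp hκ₂
  have hw0 : w 0 = u₀ := eq_of_forall_strongDual_eq fun φ =>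
    tendsto_nhds_unique ((hconv 0 h0).1 φ) ((hu₀ φ).comp hκ.tendsto_atTop)
  obtain ⟨ρ, hρ⟩ := hE.exists_bound K hT.le
  have hcl := clampIcc_mem hT.le
  have hmemI : ∀ t ∈ Icc 0 T, w t ∈ energySublevel D E K := fun t ht =>
    hE.mem_energySublevel_of_tendsto hT.le (hconv t ht).1
      (Eventually.of_forall fun j => (hKn (κ₁ (κ₂ j))).1 t ht)
  have hmem : ∀ t, w t ∈ energySublevel D E K := fun t => by
    rw [(hclamp t).1]; exact hmemI _ (hcl t)
  have hkconv : ∀ t ∈ Icc 0 T, Tendsto (fun j => iVW.comp iUV (u (κ₁ (κ₂ j)) t)) atTop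
      (𝓝 (iVW.comp iUV (w t))) := by
    intro t ht
    exact hUW.tendsto_of_weak (Eventually.of_forall fun j => hρ _ ((hKn (κ₁ (κ₂ j))).1 t ht))
      (hconv t ht).1
  have hZconv : ∀ t ∈ Icc 0 T, Tendsto (fun j => iWZ (iVW (iUV (u (κ₁ (κ₂ j)) t)))) atTop
      (𝓝 (iWZ (iVW (iUV (w t))))) := fun t ht => (iWZ.continuous.tendsto _).comp (hkconv t ht)
  have hint : ∀ n, IntegrableOn (fun r => R (iWZ (iVW (duV n r)))) (Icc 0 T) := fun n =>
    (integrableOn_viscousDissipation (VV := VV) hR (h n).sobolev.1 (iWZ.comp iVW) 0).2.1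
  obtain ⟨β, hβ, hβ0, hpowβ⟩ := hE.exists_power_bound K
  have hpconv : ∀ᵐ r ∂(volume.restrict (Icc 0 T)),
      Tendsto (fun j => power E r (u (κ₁ (κ₂ j)) r)) atTop (𝓝 (power E r (w r))) := by
    filter_upwards [hE.ae_tendsto_power hT.le K, ae_restrict_mem measurableSet_Icc] with r hr hrm
    exact hr ℕ atTop (fun j => u (κ₁ (κ₂ j)) r) (w r)
      (Eventually.of_forall fun j => (hKn (κ₁ (κ₂ j))).1 r hrm) (hmem r) (hkconv r hrm)
  have hpint : IntegrableOn (fun r => power E r (w r)) (Icc 0 T) := by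
    refine Integrable.mono' hβ (aestronglyMeasurable_of_tendsto_ae atTop
      (fun j => (h (κ₁ (κ₂ j))).power_integrable.aestronglyMeasurable) hpconv) ?_
    filter_upwards [hpowβ] with r hr using hr _ (hmem r)
  have hvsub : ∀ s ∈ Icc 0 T, ∀ t ∈ Icc 0 T, s ≤ t →
      R (iWZ (iVW (iUV (w t))) - iWZ (iVW (iUV (w s)))) ≤ v t - v s := by
    intro s hs t ht hst
    exact le_of_tendsto_of_tendsto' ((hR.continuous.tendsto _).comp
      ((hZconv t ht).sub (hZconv s hs))) ((hconv t ht).2.sub (hconv s hs).2) fun j =>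
        (h (κ₁ (κ₂ j))).dissipation_le hR hs ht hst
  have hv0 : v 0 = 0 := tendsto_nhds_unique (hconv 0 h0).2 (by simp)
  have hvm : Monotone v := by
    intro s t hst
    rw [(hclamp s).2, (hclamp t).2]
    have := (hR.nonneg _).trans (hvsub _ (hcl s) _ (hcl t) (clampIcc_mono T hst))
    linarith
  refine ⟨K, w, v, κ₁ ∘ κ₂, hκ, fun t ht => (hconv t ht).1, ?_, hw0, hmem, ?_, hvm, ?_, hv0, ?_, ?_,
    hpint, ?_, ?_, by rwa [hw0]⟩
  · filter_upwards [hvel] with t ht using ht.comp hκ₂.tendsto_atTop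
  · refine ⟨stronglyMeasurable_of_tendsto_comp hi (fun j => (h (κ₁ (κ₂ j))).memCw.1.1)
      fun t => hkconv t t.2, ρ, fun t ht => hρ _ (hmem t)⟩
  · intro s t hst
    rw [(hclamp s).1, (hclamp t).1, (hclamp s).2, (hclamp t).2]
    exact hvsub _ (hcl s) _ (hcl t) (clampIcc_mono T hst)
  · intro t ht
    have := hclamp t
    rwa [clampIcc_of_le hT.le ht] at this
  · intro t ht
    have := hclamp t
    rwa [clampIcc_of_ge hT.le ht] at this
  · intro t ht
    have hP : Tendsto (fun j => ∫ r in (0 : ℝ)..t, power E r (u (κ₁ (κ₂ j)) r)) atTop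
        (𝓝 (∫ r in (0 : ℝ)..t, power E r (w r))) := by
      refine intervalIntegral.tendsto_integral_filter_of_dominated_convergence β
        (Eventually.of_forall fun j => ((h (κ₁ (κ₂ j))).power_integrable.intervalIntegrable_of_mem_Icc
          h0 ht).def'.aestronglyMeasurable) (Eventually.of_forall fun j => ?_)
        (hβ.intervalIntegrable_of_mem_Icc h0 ht) ?_
      · filter_upwards [ae_of_ae_restrict_Icc h0 ht hpowβ] with r hr hrm
        rw [uIoc_of_le ht.1] at hrm
        exact hr (Ioc_subset_Icc_self hrm) _
          ((hKn (κ₁ (κ₂ j))).1 r ⟨hrm.1.le, hrm.2.trans ht.2⟩)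
      · filter_upwards [ae_of_ae_restrict_Icc h0 ht hpconv] with r hr hrm
        rw [uIoc_of_le ht.1] at hrm
        exact hr (Ioc_subset_Icc_self hrm)
    have hlim := ((hA.comp hκ.tendsto_atTop).add hP).sub (hconv t ht).2
    have := (hE.energy_le_of_tendsto (hconv t ht).1 ht
      (Eventually.of_forall fun j => ((hKn (κ₁ (κ₂ j))).1 t ht).1) hlim
      (Eventually.of_forall fun j => ?_)).2
    · rw [hw0]; linarith
    · have h1 := (h (κ₁ (κ₂ j))).energy_le_all hR hM hT hE (hKn (κ₁ (κ₂ j))).1 ht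
      have h2 : ∫ r in (0 : ℝ)..t, R (iWZ (iVW (duV (κ₁ (κ₂ j)) r))) ≤
          ∫ r in (0 : ℝ)..t, viscousDissipation (iWZ.comp iVW) VV R (ε (κ₁ (κ₂ j)))
            (duV (κ₁ (κ₂ j)) r) := by
        refine intervalIntegral.integral_mono_on ht.1
          ((hint _).intervalIntegrable_of_mem_Icc h0 ht)
          ((integrableOn_viscousDissipation (VV := VV) hR (h _).sobolev.1
            (iWZ.comp iVW) _).2.2.intervalIntegrable_of_mem_Icc h0 ht) fun r _ => ?_
        have := mul_nonneg (by linarith [hεpos (κ₁ (κ₂ j))] : 0 ≤ ε (κ₁ (κ₂ j)) / 2)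
          (hVV.nonneg (duV (κ₁ (κ₂ j)) r))
        simp only [viscousDissipation, ContinuousLinearMap.comp_apply]
        linarith
      have h3 : 0 ≤ ε (κ₁ (κ₂ j)) ^ 2 / 2 *
          inner ℝ (MW (du (κ₁ (κ₂ j)) t)) (du (κ₁ (κ₂ j)) t) := by
        obtain ⟨c, hc, hpos⟩ := hM.posDef
        exact mul_nonneg (by positivity) ((by positivity : 0 ≤ c * ‖du (κ₁ (κ₂ j)) t‖ ^ 2).trans
          (hpos _))
      simp only [Function.comp_apply]
      linarith
  · intro s hs t ht hst x hx lo hi hlo hhi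
    obtain ⟨L, hL⟩ := ViscousTrajectory.exists_integral_energy_le (VV := VV) hR hM hT hE K hx
    have hLn := fun n => hL (hεpos n) (h n) (hKn n).1 (hKn n).2.2.1 (hKn n).2.2.2
    obtain ⟨Cx, hCx⟩ := hE.exists_energy_bound (E 0 x).toReal
    obtain ⟨ρ₁, ρ₂, hρ1, hρ12, hb⟩ := hR.bounds
    have hI := fun r (hr : r ∈ Ioo s t) => (⟨hs.1.trans hr.1.le, hr.2.le.trans ht.2⟩ : r ∈ Icc 0 T)
    set Q := Cx + ρ₂ * (‖iWZ.comp (iVW.comp iUV)‖ * (‖x‖ + ρ)) with hQ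
    have hg : ∀ n, ∀ r ∈ Ioo s t, 0 ≤ (E r x).toReal + R (iWZ (iVW (iUV (x - u n r)))) ∧
        (E r x).toReal + R (iWZ (iVW (iUV (x - u n r)))) ≤ Q := by
      intro n r hr
      refine ⟨add_nonneg ENNReal.toReal_nonneg (hR.nonneg _),
        add_le_add (hCx x ⟨hx, le_rfl⟩ r (hI r hr)) ((hb _).2.trans ?_)⟩
      have := hρ1.le.trans hρ12
      gcongr
      refine (iWZ.comp (iVW.comp iUV)).le_opNorm_of_le ((norm_sub_le _ _).trans ?_)
      gcongr
      exact hρ _ ((hKn n).1 r (hI r hr))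
    -- The assumptions on `lo` and `hi` hold in the open interval only, whereas the integrals
    -- include the endpoint t.
    have hne : ∀ᵐ r : ℝ, r ≠ t := by simp [ae_iff, measure_singleton]
    -- Since `lo` lies strictly below the limit energy, lower semicontinuity makes the truncated
    -- energy eventually equal to `lo` at each time; truncation also supplies the majorant.
    have hlo' : Tendsto (fun j => ∫ r in s..t, min (E r (u (κ₁ (κ₂ j)) r)).toReal lo) atTop
        (𝓝 (∫ _ in s..t, lo)) := by
      refine intervalIntegral.tendsto_integral_filter_of_dominated_convergence (fun _ => |lo|)
        (Eventually.of_forall fun j => ?_) (Eventually.of_forall fun j => ?_)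
        intervalIntegrable_const ?_
      · exact (((hLn (κ₁ (κ₂ j))).1.intervalIntegrable_of_mem_Icc hs ht).def'.aestronglyMeasurable).inf
          aestronglyMeasurable_const
      · refine Eventually.of_forall fun r _ => ?_
        have h1 : 0 ≤ (E r (u (κ₁ (κ₂ j)) r)).toReal := ENNReal.toReal_nonneg
        rw [Real.norm_eq_abs, abs_le]
        exact ⟨le_min (by linarith [abs_nonneg lo]) (neg_abs_le lo),
          (min_le_right _ _).trans (le_abs_self lo)⟩
      · filter_upwards [hne] with r hrt hr
        rw [uIoc_of_le hst.le] at hr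
        have hr' : r ∈ Ioo s t := ⟨hr.1, lt_of_le_of_ne hr.2 hrt⟩
        refine tendsto_const_nhds.congr' ?_
        rcases lt_or_ge lo 0 with hneg | hpos
        · exact Eventually.of_forall fun j => (min_eq_right (hneg.le.trans ENNReal.toReal_nonneg)).symm
        have hlt : ENNReal.ofReal lo < E r (w r) :=
          (ENNReal.ofReal_lt_iff_lt_toReal hpos (hE.ne_top (hI r hr') (hmem r).1)).2 (hlo r hr')
        filter_upwards [hE.eventually_lt_energy (hconv r (hI r hr')).1 (hI r hr') hlt] with j hj
        refine (min_eq_right ?_).symm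
        exact (ENNReal.ofReal_le_iff_le_toReal
          (hE.ne_top (hI r hr') ((hKn (κ₁ (κ₂ j))).1 r (hI r hr')).1)).1 hj.le
    -- The competitor's side converges pointwise by the compact embedding, and the limit is at most
    -- `hi`, so the maximum converges to `hi`.
    have hhi' : Tendsto (fun j => ∫ r in s..t,
        max ((E r x).toReal + R (iWZ (iVW (iUV (x - u (κ₁ (κ₂ j)) r))))) hi) atTop
        (𝓝 (∫ _ in s..t, hi)) := by
      refine intervalIntegral.tendsto_integral_filter_of_dominated_convergence (fun _ => Q + |hi|)
        (Eventually.of_forall fun j => ?_) (Eventually.of_forall fun j => ?_)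
        intervalIntegrable_const ?_
      · exact (((hLn (κ₁ (κ₂ j))).2.1.intervalIntegrable_of_mem_Icc
          hs ht).def'.aestronglyMeasurable).sup aestronglyMeasurable_const
      · filter_upwards [hne] with r hrt hr
        rw [uIoc_of_le hst.le] at hr
        obtain ⟨h1, h2⟩ := hg (κ₁ (κ₂ j)) r ⟨hr.1, lt_of_le_of_ne hr.2 hrt⟩
        rw [Real.norm_eq_abs, abs_of_nonneg (h1.trans (le_max_left _ _))]
        exact max_le (by linarith [abs_nonneg hi]) (by linarith [le_abs_self hi])
      · filter_upwards [hne] with r hrt hr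
        rw [uIoc_of_le hst.le] at hr
        have hr' : r ∈ Ioo s t := ⟨hr.1, lt_of_le_of_ne hr.2 hrt⟩
        have h1 := (hR.continuous.tendsto _).comp
          ((hZconv r (hI r hr')).const_sub (iWZ (iVW (iUV x))))
        have h2 := (h1.const_add (E r x).toReal).max (tendsto_const_nhds (x := hi))
        have h3 := hhi r hr'
        simp only [ContinuousLinearMap.comp_apply, map_sub] at h3 ⊢
        rw [max_eq_right h3] at h2
        exact h2
    have hεκ := hε.comp hκ.tendsto_atTop
    have herr : Tendsto (fun j => L * (√(ε (κ₁ (κ₂ j))) + ε (κ₁ (κ₂ j)))) atTop (𝓝 0) := by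
      have := ((((Real.continuous_sqrt.tendsto 0).comp hεκ).add hεκ).const_mul L)
      simpa using this
    have hfin := le_of_tendsto_of_tendsto' hlo' (hhi'.add herr) fun j => ?_
    · simp only [intervalIntegral.integral_const, add_zero, smul_eq_mul] at hfin
      exact le_of_mul_le_mul_left hfin (sub_pos.2 hst)
    · obtain ⟨hi1, hi2, hle⟩ := hLn (κ₁ (κ₂ j))
      have hi1' := hi1.intervalIntegrable_of_mem_Icc hs ht
      have hi2' := hi2.intervalIntegrable_of_mem_Icc hs ht
      have h1 : ∫ r in s..t, min (E r (u (κ₁ (κ₂ j)) r)).toReal lo ≤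
          ∫ r in s..t, (E r (u (κ₁ (κ₂ j)) r)).toReal :=
        intervalIntegral.integral_mono_on hst.le ⟨hi1'.1.inf (integrable_const _),
          hi1'.2.inf (integrable_const _)⟩ hi1' fun r _ => min_le_left _ _
      have h2 : ∫ r in s..t, ((E r x).toReal + R (iWZ (iVW (iUV (x - u (κ₁ (κ₂ j)) r))))) ≤
          ∫ r in s..t, max ((E r x).toReal + R (iWZ (iVW (iUV (x - u (κ₁ (κ₂ j)) r))))) hi :=
        intervalIntegral.integral_mono_on hst.le hi2' ⟨hi2'.1.sup (integrable_const _),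
          hi2'.2.sup (integrable_const _)⟩ fun r _ => le_max_left _ _
      exact (h1.trans (hle s hs t ht hst.le)).trans (by linarith)

end LimitPassage

theorem exists_tendsto_of_dist_le {X : Type*} [PseudoMetricSpace X] [CompleteSpace X] {f : ℝ → X}
    {v : ℝ → ℝ} {c : ℝ} (h : ∀ s t, dist (f s) (f t) ≤ c * dist (v s) (v t)) {l : Filter ℝ} [l.NeBot]
    {a : ℝ} (hv : Tendsto v l (𝓝 a)) : ∃ y, Tendsto f l (𝓝 y) := by
  rw [← cauchy_map_iff_exists_tendsto, cauchy_map_iff']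
  have hc := (cauchy_map_iff'.1 hv.cauchy_map)
  rw [tendsto_uniformity_iff_dist_tendsto_zero] at hc ⊢
  refine squeeze_zero (fun _ => dist_nonneg) (fun p => h _ _) ?_
  simpa using hc.const_mul c

/-! ### Stability inequalities and the lower energy estimate. -/

section Stability

variable {U W Z : Type*} [NormedAddCommGroup U] [NormedSpace ℝ U]
    [NormedAddCommGroup W] [InnerProductSpace ℝ W]
    [NormedAddCommGroup Z] [NormedSpace ℝ Z]
    {i : U →L[ℝ] W} {k : U →L[ℝ] Z} {R : Z → ℝ} {T : ℝ} {D : Set U} {E : ℝ → U → ℝ≥0∞}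

theorem IsGloballyStable.toReal_le (hE : IsConvexEnergy i T D E) (hR : IsDissipationPotential R)
    {t : ℝ} (ht : t ∈ Icc 0 T) {x y : U} (h : IsGloballyStable k R E t x) (hy : y ∈ D) :
    (E t x).toReal ≤ (E t y).toReal + R (k (y - x)) := by
  have h1 := h y
  rw [← ENNReal.ofReal_toReal (hE.ne_top ht hy),
    ← ENNReal.ofReal_add ENNReal.toReal_nonneg (hR.nonneg _)] at h1
  exact ENNReal.toReal_le_of_le_ofReal (add_nonneg ENNReal.toReal_nonneg (hR.nonneg _)) h1

theorem IsConvexEnergy.isGloballyStable_of_forall_le (hE : IsConvexEnergy i T D E)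
    (hR : IsDissipationPotential R) {t : ℝ} (ht : t ∈ Icc 0 T) {x : U} (hx : x ∈ D)
    (h : ∀ y ∈ D, (E t x).toReal ≤ (E t y).toReal + R (k (y - x))) :
    IsGloballyStable k R E t x := by
  intro y
  by_cases hy : y ∈ D
  · rw [← ENNReal.ofReal_toReal (hE.ne_top ht hy), ← ENNReal.ofReal_toReal (hE.ne_top ht hx),
      ← ENNReal.ofReal_add ENNReal.toReal_nonneg (hR.nonneg _)]
    exact ENNReal.ofReal_le_ofReal (h y hy)
  · have : E t y = ⊤ := by
      by_contra hne
      exact hy ((hE.domain t ht y).1 (lt_top_iff_ne_top.2 hne))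
    simp [this]

/-- Lower energy estimate for stable curves, by summation over a uniform partition. -/
theorem IsConvexEnergy.exists_partition_energy_le (hE : IsConvexEnergy i T D E)
    (hR : IsDissipationPotential R) {K : ℝ} {w : ℝ → U} {s t : ℝ} (hs : s ∈ Icc 0 T)
    (ht : t ∈ Icc 0 T) (hst : s < t) (hw : ∀ r ∈ Icc s t, w r ∈ energySublevel D E K)
    (hstab : ∀ r ∈ Ico s t, IsGloballyStable k R E r (w r))
    (hcont : ∀ᵐ r, r ∈ Ioc s t → Tendsto (fun τ => i (w τ)) (𝓝[Icc s t] r) (𝓝 (i (w r))))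
    {δ : ℝ} (hδ : 0 < δ) :
    ∃ N : ℕ, (E s (w s)).toReal + ∫ r in s..t, power E r (w r) ≤ (E t (w t)).toReal +
      (∑ n ∈ Finset.range (N + 1),
        R (k (w (unifPt s t N (n + 1))) - k (w (unifPt s t N n)))) + δ := by
  have hT : 0 ≤ T := hs.1.trans hs.2
  have hsub : Icc s t ⊆ Icc 0 T := Icc_subset_Icc hs.1 ht.2
  obtain ⟨β, hβ, -, hpow⟩ := hE.exists_power_bound K
  have htend := tendsto_sum_integral_tag (G := fun r τ => power E r (w τ)) (g := β) hst.le
    (hβ.intervalIntegrable_of_mem_Icc hs ht)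
    (fun τ hτ => ((hE.integral_power hs ht (hw τ hτ).1).1).1.aestronglyMeasurable)
    (by
      filter_upwards [ae_of_ae_restrict_Icc hs ht hpow] with r hr hrm τ hτ
      exact hr (Ioc_subset_Icc_self hrm) _ (hw τ hτ))
    (by
      filter_upwards [ae_of_ae_restrict_Icc hs ht (hE.ae_tendsto_power hT K), hcont] with r hr hc hrm
      exact hr (Ioc_subset_Icc_self hrm) ℝ _ w (w r)
        (by filter_upwards [self_mem_nhdsWithin] with τ hτ using hw τ hτ)
        (hw r (Ioc_subset_Icc_self hrm)) (hc hrm))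
    -- Stability at the left node is tested with the state at the right node, and time then advances
    -- with that state frozen: hence right tags, and no stability needed at the final time.
    (c := fun N n => unifPt s t N (n + 1))
    (fun N n _ => ⟨unifPt_mono hst.le N (Nat.le_succ n), le_rfl⟩)
  obtain ⟨N, hN⟩ := (htend.eventually (lt_mem_nhds (sub_lt_self _ hδ))).exists
  refine ⟨N, ?_⟩
  have hstep : ∀ n ∈ Finset.range (N + 1),
      (E (unifPt s t N n) (w (unifPt s t N n))).toReal -
        (E (unifPt s t N (n + 1)) (w (unifPt s t N (n + 1)))).toReal +
        (∫ r in unifPt s t N n..unifPt s t N (n + 1), power E r (w (unifPt s t N (n + 1)))) ≤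
      R (k (w (unifPt s t N (n + 1))) - k (w (unifPt s t N n))) := by
    intro n hn
    have hn' := Finset.mem_range.1 hn
    have hm1 : unifPt s t N n ∈ Icc s t := unifPt_mem hst.le (by omega)
    have hm2 : unifPt s t N (n + 1) ∈ Icc s t := unifPt_mem hst.le (by omega)
    have hlt : unifPt s t N n < t :=
      (unifPt_strictMono hst N (by omega : n < N + 1)).trans_eq (unifPt_last s t N)
    have h1 := (hstab _ ⟨hm1.1, hlt⟩).toReal_le hE hR (hsub hm1) (hw _ hm2).1
    have h2 := (hE.integral_power (hsub hm1) (hsub hm2) (hw _ hm2).1).2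
    rw [map_sub] at h1
    linarith
  have hsum := Finset.sum_le_sum hstep
  have htel := Finset.sum_range_sub'
    (fun n => (E (unifPt s t N n) (w (unifPt s t N n))).toReal) (N + 1)
  simp only [unifPt_zero, unifPt_last] at htel
  rw [Finset.sum_add_distrib, htel] at hsum
  linarith

end Stability

/-- Weak one-sided limits of a limit trajectory. -/
structure WeakOneSidedLimits {U Z : Type*} [NormedAddCommGroup U] [NormedSpace ℝ U]
    [NormedAddCommGroup Z] [NormedSpace ℝ Z] (k : U →L[ℝ] Z) (D : Set U) (E : ℝ → U → ℝ≥0∞)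
    (K : ℝ) (u um up : ℝ → U) : Prop where
  mem_left : ∀ t, um t ∈ energySublevel D E K
  mem_right : ∀ t, up t ∈ energySublevel D E K
  weak_left : ∀ t, ∀ φ : StrongDual ℝ U, Tendsto (fun r => φ (u r)) (𝓝[<] t) (𝓝 (φ (um t)))
  weak_right : ∀ t, ∀ φ : StrongDual ℝ U, Tendsto (fun r => φ (u r)) (𝓝[>] t) (𝓝 (φ (up t)))
  left : ∀ t, Tendsto (fun r => k (u r)) (𝓝[<] t) (𝓝 (k (um t)))
  right : ∀ t, Tendsto (fun r => k (u r)) (𝓝[>] t) (𝓝 (k (up t)))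

/-! ### One-sided limits of the limit trajectory and their stability. -/

namespace LimitTrajectory

variable {U W Z : Type*} [NormedAddCommGroup U] [NormedSpace ℝ U]
    [NormedAddCommGroup W] [InnerProductSpace ℝ W]
    [NormedAddCommGroup Z] [NormedSpace ℝ Z]
    {i : U →L[ℝ] W} {k : U →L[ℝ] Z} {R : Z → ℝ} {T : ℝ} {D : Set U} {E : ℝ → U → ℝ≥0∞}
    {K : ℝ} {u um up : ℝ → U} {v : ℝ → ℝ}

theorem exists_dist_le (hR : IsDissipationPotential R) (h : LimitTrajectory k R T D E K u v) :
    ∃ c, ∀ s t, dist (k (u s)) (k (u t)) ≤ c * dist (v s) (v t) := by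
  obtain ⟨ρ₁, ρ₂, hρ1, -, hb⟩ := hR.bounds
  refine ⟨ρ₁⁻¹, fun s t => ?_⟩
  wlog hst : s ≤ t generalizing s t
  · rw [dist_comm, dist_comm (v s)]
    exact this t s (le_of_not_ge hst)
  rw [dist_comm, dist_comm (v s), dist_eq_norm, Real.dist_eq, abs_of_nonneg (sub_nonneg.2 (h.mono hst)),
    inv_mul_eq_div, le_div_iff₀ hρ1, mul_comm]
  exact (hb _).1.trans (h.le_sub s t hst)

/-- The monotone v has one-sided limits, so u is Cauchy in Z along them; boundedness in U and
reflexivity lift the limits to weak limits in U. -/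
theorem exists_weakOneSidedLimits [CompleteSpace Z] (hU : IsReflexiveSpace U)
    (hk : Function.Injective k) (hR : IsDissipationPotential R) (hT : 0 < T)
    (hE : IsConvexEnergy i T D E) (h : LimitTrajectory k R T D E K u v) :
    ∃ um up, WeakOneSidedLimits k D E K u um up := by
  obtain ⟨c, hc⟩ := h.exists_dist_le hR
  obtain ⟨ρ, hρ⟩ := hE.exists_bound K hT.le
  have key : ∀ (l : Filter ℝ) [l.NeBot] (a : ℝ), Tendsto v l (𝓝 a) → ∃ z ∈ energySublevel D E K,
      (∀ φ : StrongDual ℝ U, Tendsto (fun r => φ (u r)) l (𝓝 (φ z))) ∧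
      Tendsto (fun r => k (u r)) l (𝓝 (k z)) := by
    intro l _ a ha
    obtain ⟨y, hy⟩ := exists_tendsto_of_dist_le hc ha
    obtain ⟨z, rfl, hz⟩ := hU.exists_weak_limit hk (Eventually.of_forall fun r => hρ _ (h.mem r)) hy
    exact ⟨z, hE.mem_energySublevel_of_tendsto hT.le hz (Eventually.of_forall h.mem), hz, hy⟩
  choose um hm1 hm2 hm3 using fun t => key (𝓝[<] t) _ (h.mono.tendsto_leftLim t)
  choose up hp1 hp2 hp3 using fun t => key (𝓝[>] t) _ (h.mono.tendsto_rightLim t)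
  exact ⟨um, up, hm1, hp1, hm2, hp2, hm3, hp3⟩

theorem left_eq (hk : Function.Injective k) (h : LimitTrajectory k R T D E K u v)
    (hl : WeakOneSidedLimits k D E K u um up) {t : ℝ} (ht : t ≤ 0) :
    um t = u 0 ∧ Function.leftLim v t = 0 := by
  constructor
  · refine hk (tendsto_nhds_unique (hl.left t) (tendsto_const_nhds.congr' ?_))
    filter_upwards [self_mem_nhdsWithin] with r hr
    rw [(h.const_left r (hr.le.trans ht)).1]
  · refine tendsto_nhds_unique (h.mono.tendsto_leftLim t) (tendsto_const_nhds.congr' ?_)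
    filter_upwards [self_mem_nhdsWithin] with r hr
    rw [(h.const_left r (hr.le.trans ht)).2, h.zero]

theorem right_eq (hk : Function.Injective k) (h : LimitTrajectory k R T D E K u v)
    (hl : WeakOneSidedLimits k D E K u um up) {t : ℝ} (ht : T ≤ t) :
    up t = u T ∧ Function.rightLim v t = v T := by
  constructor
  · refine hk (tendsto_nhds_unique (hl.right t) (tendsto_const_nhds.congr' ?_))
    filter_upwards [self_mem_nhdsWithin] with r hr
    rw [(h.const_right r (ht.trans hr.le)).1]
  · refine tendsto_nhds_unique (h.mono.tendsto_rightLim t) (tendsto_const_nhds.congr' ?_)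
    filter_upwards [self_mem_nhdsWithin] with r hr
    rw [(h.const_right r (ht.trans hr.le)).2]

/-- Two arbitrary filters let one argument cover one-sided limits and, through `pure t`, the values
themselves. -/
theorem le_sub_of_tendsto (hR : IsDissipationPotential R) (h : LimitTrajectory k R T D E K u v)
    {l l' : Filter ℝ} [l.NeBot] [l'.NeBot] {z z' : U} {a a' : ℝ}
    (hz : Tendsto (fun r => k (u r)) l (𝓝 (k z))) (hz' : Tendsto (fun r => k (u r)) l' (𝓝 (k z')))
    (ha : Tendsto v l (𝓝 a)) (ha' : Tendsto v l' (𝓝 a')) (hle : ∀ᶠ p in l ×ˢ l', p.1 ≤ p.2) :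
    R (k z' - k z) ≤ a' - a :=
  le_of_tendsto_of_tendsto ((hR.continuous.tendsto _).comp
    ((hz'.comp tendsto_snd).sub (hz.comp tendsto_fst)))
    ((ha'.comp tendsto_snd).sub (ha.comp tendsto_fst)) (hle.mono fun _ hp => h.le_sub _ _ hp)

theorem left_sub_right_le (hR : IsDissipationPotential R) (h : LimitTrajectory k R T D E K u v)
    (hl : WeakOneSidedLimits k D E K u um up) {s t : ℝ} (hst : s < t) :
    R (k (um t) - k (up s)) ≤ Function.leftLim v t - Function.rightLim v s := by
  refine h.le_sub_of_tendsto hR (hl.right s) (hl.left t) (h.mono.tendsto_rightLim s)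
    (h.mono.tendsto_leftLim t) ?_
  obtain ⟨m, hm1, hm2⟩ := exists_between hst
  filter_upwards [prod_mem_prod (Ioo_mem_nhdsGT hm1) (Ioo_mem_nhdsLT hm2)] with p hp
  exact hp.1.2.le.trans hp.2.1.le

theorem right_sub_left_le (hR : IsDissipationPotential R) (h : LimitTrajectory k R T D E K u v)
    (hl : WeakOneSidedLimits k D E K u um up) (t : ℝ) :
    R (k (up t) - k (um t)) ≤ Function.rightLim v t - Function.leftLim v t := by
  refine h.le_sub_of_tendsto hR (hl.left t) (hl.right t) (h.mono.tendsto_leftLim t)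
    (h.mono.tendsto_rightLim t) ?_
  filter_upwards [prod_mem_prod (self_mem_nhdsWithin (a := t) (s := Iio t))
    (self_mem_nhdsWithin (a := t) (s := Ioi t))] with p hp
  exact (hp.1.trans hp.2).le

theorem right_sub_right_le (hR : IsDissipationPotential R) (h : LimitTrajectory k R T D E K u v)
    (hl : WeakOneSidedLimits k D E K u um up) {s t : ℝ} (hst : s ≤ t) :
    R (k (up t) - k (up s)) ≤ Function.rightLim v t - Function.rightLim v s := by
  rcases hst.eq_or_lt with rfl | hst
  · simp [hR.map_zero]
  have h1 := h.left_sub_right_le hR hl hst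
  have h2 := h.right_sub_left_le hR hl t
  have h3 := hR.sub_le (k (up t)) (k (um t)) (k (up s))
  linarith

theorem sub_left_le (hR : IsDissipationPotential R) (h : LimitTrajectory k R T D E K u v)
    (hl : WeakOneSidedLimits k D E K u um up) (t : ℝ) :
    R (k (u t) - k (um t)) ≤ v t - Function.leftLim v t := by
  refine h.le_sub_of_tendsto hR (hl.left t) (l' := pure t) (tendsto_pure_nhds _ _)
    (h.mono.tendsto_leftLim t) (tendsto_pure_nhds _ _) ?_
  filter_upwards [prod_mem_prod (self_mem_nhdsWithin (a := t) (s := Iio t))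
    (mem_pure.2 (mem_singleton t))] with p hp
  rw [show p.2 = t from hp.2]
  exact le_of_lt hp.1

theorem right_sub_le (hR : IsDissipationPotential R) (h : LimitTrajectory k R T D E K u v)
    (hl : WeakOneSidedLimits k D E K u um up) (t : ℝ) :
    R (k (up t) - k (u t)) ≤ Function.rightLim v t - v t := by
  refine h.le_sub_of_tendsto hR (l := pure t) (tendsto_pure_nhds _ _) (hl.right t)
    (tendsto_pure_nhds _ _) (h.mono.tendsto_rightLim t) ?_
  filter_upwards [prod_mem_prod (mem_pure.2 (mem_singleton t))
    (self_mem_nhdsWithin (a := t) (s := Ioi t))] with p hp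
  rw [show p.1 = t from hp.1]
  exact le_of_lt hp.2

/-- Any one-sided limit at `t` is stable. -/
theorem isGloballyStable_of_tendsto (hR : IsDissipationPotential R)
    (hE : IsConvexEnergy i T D E) (h : LimitTrajectory k R T D E K u v)
    {t : ℝ} (ht : t ∈ Icc 0 T) {l : Filter ℝ} [l.NeBot] (hlt : l ≤ 𝓝 t)
    (hlI : ∀ᶠ r in l, r ∈ Icc 0 T)
    (hint : ∀ p : ℝ → Prop, (∀ᶠ r in l, p r) →
      ∃ a ∈ Icc 0 T, ∃ b ∈ Icc 0 T, a < b ∧ ∀ r ∈ Ioo a b, p r)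
    {z : U} (hz : z ∈ energySublevel D E K)
    (hzw : ∀ φ : StrongDual ℝ U, Tendsto (fun r => φ (u r)) l (𝓝 (φ z)))
    (hzk : Tendsto (fun r => k (u r)) l (𝓝 (k z))) : IsGloballyStable k R E t z := by
  refine hE.isGloballyStable_of_forall_le hR ht hz.1 fun y hy => ?_
  by_contra! hlt'
  -- If stability fails, hi < lo fit strictly between its two sides. Both bounds then persist near
  -- t, and averaged stability forces lo ≤ hi.
  obtain ⟨hi, h1, h2⟩ := exists_between hlt'
  obtain ⟨lo, h3, h4⟩ := exists_between h2
  have hev1 : ∀ᶠ r in l, lo < (E r (u r)).toReal := by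
    by_contra hcon
    rw [not_eventually] at hcon
    have hne : (l ⊓ 𝓟 {r | ¬lo < (E r (u r)).toReal}).NeBot := by
      rwa [← frequently_mem_iff_neBot]
    have := hE.energy_le_of_tendsto' (l := l ⊓ 𝓟 {r | ¬lo < (E r (u r)).toReal}) (x := u)
      (s := fun r => r) (fun φ => (hzw φ).mono_left inf_le_left) (C := K)
      (Eventually.of_forall h.mem) (tendsto_id.mono_left (inf_le_left.trans hlt))
      (hlI.filter_mono inf_le_left) ht (tendsto_const_nhds (x := lo)) (by
        filter_upwards [mem_inf_of_right (mem_principal_self _)] with r hr using not_lt.1 hr)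
    linarith
  have hev2 : ∀ᶠ r in l, (E r y).toReal + R (k (y - u r)) ≤ hi := by
    have hc : Tendsto (fun r => (E r y).toReal) l (𝓝 (E t y).toReal) := by
      have := (hE.absCont y hy).continuousOn
      rw [uIcc_of_le (ht.1.trans ht.2)] at this
      exact (this t ht).tendsto.comp (tendsto_nhdsWithin_iff.2 ⟨tendsto_id.mono_left hlt, hlI⟩)
    have hRc := (hR.continuous.tendsto _).comp (hzk.const_sub (k y))
    have hsum := hc.add hRc
    rw [map_sub] at h1
    filter_upwards [hsum.eventually (gt_mem_nhds h1)] with r hr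
    rw [map_sub]
    exact hr.le
  obtain ⟨a, ha, b, hb, hab, hp⟩ := hint _ (hev1.and hev2)
  have := h.averaged_stability a ha b hb hab y hy lo hi (fun r hr => (hp r hr).1)
    (fun r hr => (hp r hr).2)
  linarith

theorem isGloballyStable_left (hR : IsDissipationPotential R)
    (hE : IsConvexEnergy i T D E) (h : LimitTrajectory k R T D E K u v)
    (hl : WeakOneSidedLimits k D E K u um up) {t : ℝ} (ht : t ∈ Ioc 0 T) :
    IsGloballyStable k R E t (um t) := by
  refine h.isGloballyStable_of_tendsto hR hE (l := 𝓝[<] t) (Ioc_subset_Icc_self ht)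
    nhdsWithin_le_nhds ?_ (fun p hp => ?_) (hl.mem_left t) (hl.weak_left t) (hl.left t)
  · filter_upwards [Ioo_mem_nhdsLT ht.1] with r hr using ⟨hr.1.le, hr.2.le.trans ht.2⟩
  · obtain ⟨a, ha, hsub⟩ := (mem_nhdsLT_iff_exists_Ioo_subset (a := t)).1 hp
    exact ⟨max a 0, ⟨le_max_right _ _, (max_lt ha ht.1).le.trans ht.2⟩, t, Ioc_subset_Icc_self ht,
      max_lt ha ht.1, fun r hr => hsub ⟨(le_max_left _ _).trans_lt hr.1, hr.2⟩⟩

theorem isGloballyStable_right (hR : IsDissipationPotential R)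
    (hE : IsConvexEnergy i T D E) (h : LimitTrajectory k R T D E K u v)
    (hl : WeakOneSidedLimits k D E K u um up) {t : ℝ} (ht : t ∈ Ico 0 T) :
    IsGloballyStable k R E t (up t) := by
  refine h.isGloballyStable_of_tendsto hR hE (l := 𝓝[>] t) (Ico_subset_Icc_self ht)
    nhdsWithin_le_nhds ?_ (fun p hp => ?_) (hl.mem_right t) (hl.weak_right t) (hl.right t)
  · filter_upwards [Ioo_mem_nhdsGT ht.2] with r hr using ⟨ht.1.trans hr.1.le, hr.2.le⟩
  · obtain ⟨a, ha, hsub⟩ := (mem_nhdsGT_iff_exists_Ioo_subset (a := t)).1 hp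
    exact ⟨t, Ico_subset_Icc_self ht, min a T, ⟨ht.1.trans (lt_min ha ht.2).le, min_le_right _ _⟩,
      lt_min ha ht.2, fun r hr => hsub ⟨hr.1, hr.2.trans_le (min_le_left _ _)⟩⟩

end LimitTrajectory

theorem HasOneSidedLimits.eq_of_continuousWithinAt {X : Type*} [NormedAddCommGroup X] {T : ℝ}
    {f fm fp : ℝ → X} (h : HasOneSidedLimits T f fm fp) {t : ℝ} (ht : t ∈ Icc 0 T)
    (hc : ContinuousWithinAt f (Icc 0 T) t) : fm t = f t ∧ fp t = f t := by
  obtain ⟨h1, h2, h3, h4⟩ := h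
  constructor
  · rcases ht.1.eq_or_lt with rfl | h0
    · exact h1
    · refine tendsto_nhds_unique (h3 t ⟨h0, ht.2⟩) (hc.tendsto.mono_left ?_)
      refine le_inf nhdsWithin_le_nhds (le_principal_iff.2 ?_)
      filter_upwards [Ioo_mem_nhdsLT h0] with r hr using ⟨hr.1.le, hr.2.le.trans ht.2⟩
  · rcases ht.2.eq_or_lt with rfl | hT
    · exact h2
    · refine tendsto_nhds_unique (h4 t ⟨ht.1, hT⟩) (hc.tendsto.mono_left ?_)
      refine le_inf nhdsWithin_le_nhds (le_principal_iff.2 ?_)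
      filter_upwards [Ioo_mem_nhdsGT hT] with r hr using ⟨ht.1.trans hr.1.le, hr.2.le⟩

/-! ### Essential variation and the dissipation function. -/

/-- The increments and jumps of `f`, measured by `R`, are controlled by those of `v`; the one-sided
limits are `fm`, `fp` and `vm`, `vp`. -/
structure HasDissipationFunction {Z : Type*} [NormedAddCommGroup Z] (R : Z → ℝ)
    (f fm fp : ℝ → Z) (v vm vp : ℝ → ℝ) : Prop where
  left_le : ∀ t, R (f t - fm t) ≤ v t - vm t
  right_le : ∀ t, R (fp t - f t) ≤ vp t - v t
  between_le : ∀ s t, s < t → R (fm t - fp s) ≤ vm t - vp s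
  jump_eq : ∀ t, R (fp t - fm t) = vp t - vm t
  bounded : ∃ B, ∀ s t, vp t - vp s ≤ B

namespace HasDissipationFunction

variable {Z : Type*} [NormedAddCommGroup Z] [NormedSpace ℝ Z] {R : Z → ℝ} {f fm fp : ℝ → Z}
  {v vm vp : ℝ → ℝ}

theorem right_sub_right_le (hR : IsDissipationPotential R)
    (h : HasDissipationFunction R f fm fp v vm vp) {s t : ℝ} (hst : s ≤ t) :
    R (fp t - fp s) ≤ vp t - vp s := by
  rcases hst.eq_or_lt with rfl | hst
  · simp [hR.map_zero]
  have h1 := h.between_le s t hst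
  have h2 := h.jump_eq t
  have h3 := hR.sub_le (fp t) (fm t) (fp s)
  linarith

/-- Induction on the largest jump point x: the path runs from `fp s` to `fm x`, jumps, then goes
from `fp x` to z. The jump costs exactly its R-size, and z, a stay general so that the induction
hypothesis can be used with `fm x` and `vm x`. -/
theorem sub_sum_jump_le (hR : IsDissipationPotential R)
    (h : HasDissipationFunction R f fm fp v vm vp) (F : Finset ℝ) {s : ℝ} (hs : ∀ r ∈ F, s < r) :
    ∀ (z : Z) (a : ℝ), R (z - fp s) ≤ a - vp s → (∀ r ∈ F, R (z - fp r) ≤ a - vp r) →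
      R (z - fp s - ∑ r ∈ F, (fp r - fm r)) + ∑ r ∈ F, R (fp r - fm r) ≤ a - vp s := by
  induction F using Finset.induction_on_max with
  | empty => intro z a hz _; simpa using hz
  | insert x F hx ih =>
    intro z a _ hz
    have hxF : x ∉ F := fun hmem => lt_irrefl _ (hx x hmem)
    have h1 := ih (fun r hr => hs r (Finset.mem_insert_of_mem hr)) (fm x) (vm x)
      (h.between_le s x (hs x (Finset.mem_insert_self _ _))) (fun r hr => h.between_le r x (hx r hr))
    have h2 := hz x (Finset.mem_insert_self _ _)
    have h3 := h.jump_eq x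
    rw [Finset.sum_insert hxF, Finset.sum_insert hxF]
    have h4 := hR.add_le (z - fp x) (fm x - fp s - ∑ r ∈ F, (fp r - fm r))
    have h5 : z - fp s - (fp x - fm x + ∑ r ∈ F, (fp r - fm r)) =
        (z - fp x) + (fm x - fp s - ∑ r ∈ F, (fp r - fm r)) := by abel
    rw [h5]
    linarith

theorem right_sub_sum_jump_le (hR : IsDissipationPotential R)
    (h : HasDissipationFunction R f fm fp v vm vp) {s t : ℝ} (hst : s ≤ t) (F : Finset ℝ) :
    R (fp t - fp s - ∑ r ∈ F, (Ioc s t).indicator (fun r => fp r - fm r) r) +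
      ∑ r ∈ F, (Ioc s t).indicator (fun r => R (fp r - fm r)) r ≤ vp t - vp s := by
  classical
  simp only [indicator_apply]
  rw [← Finset.sum_filter, ← Finset.sum_filter]
  exact h.sub_sum_jump_le hR _ (fun r hr => (Finset.mem_filter.1 hr).2.1) _ _
    (h.right_sub_right_le hR hst)
    (fun r hr => h.right_sub_right_le hR (Finset.mem_filter.1 hr).2.2)

theorem summable_jump (hR : IsDissipationPotential R)
    (h : HasDissipationFunction R f fm fp v vm vp) : Summable fun r => R (fp r - fm r) := by
  obtain ⟨B, hB⟩ := h.bounded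
  refine summable_of_sum_le (c := B) (fun _ => hR.nonneg _) fun F => ?_
  obtain ⟨a, ha⟩ := F.finite_toSet.bddBelow
  obtain ⟨b, hb⟩ := F.finite_toSet.bddAbove
  -- The half-open interval must contain all of F, hence a - 1; the maximum keeps it ordered even
  -- when F is empty.
  have hle : a - 1 ≤ max b (a - 1) := le_max_right _ _
  have h1 := h.right_sub_sum_jump_le hR hle F
  have hmem : ∀ r ∈ F, r ∈ Ioc (a - 1) (max b (a - 1)) := fun r hr =>
    ⟨(sub_one_lt a).trans_le (ha hr), (hb hr).trans (le_max_left _ _)⟩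
  have h2 : ∑ r ∈ F, (Ioc (a - 1) (max b (a - 1))).indicator (fun r => R (fp r - fm r)) r =
      ∑ r ∈ F, R (fp r - fm r) :=
    Finset.sum_congr rfl fun r hr => indicator_of_mem (hmem r hr) _
  rw [h2] at h1
  have h3 := hR.nonneg
    (fp (max b (a - 1)) - fp (a - 1) -
      ∑ r ∈ F, (Ioc (a - 1) (max b (a - 1))).indicator (fun r => fp r - fm r) r)
  linarith [hB (a - 1) (max b (a - 1))]

theorem summable_of_le [CompleteSpace Z] (hR : IsDissipationPotential R)
    (h : HasDissipationFunction R f fm fp v vm vp) {g : ℝ → Z}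
    (hg : ∀ r, R (g r) ≤ R (fp r - fm r)) : Summable g := by
  obtain ⟨ρ₁, ρ₂, hρ1, -, hb⟩ := hR.bounds
  refine Summable.of_norm_bounded ((h.summable_jump hR).mul_left ρ₁⁻¹) fun r => ?_
  rw [inv_mul_eq_div, le_div_iff₀ hρ1, mul_comm]
  exact (hb _).1.trans (hg r)

/-- Adding the missing outgoing jump at t turns `f t` into `fp t` and merges the two half-jumps. The
continuous part therefore ignores the values of f at its jumps. -/
theorem contPart_eq [CompleteSpace Z] (hR : IsDissipationPotential R)
    (h : HasDissipationFunction R f fm fp v vm vp) {t : ℝ} (ht : 0 ≤ t) :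
    contPart f fm fp t = fp t - ∑' r, (Icc 0 t).indicator (fun r => fp r - fm r) r := by
  have h1 : Summable fun r => f r - fm r := h.summable_of_le hR fun r => by
    linarith [h.left_le r, h.right_le r, h.jump_eq r, hR.nonneg (fp r - f r)]
  have h2 : Summable fun r => fp r - f r := h.summable_of_le hR fun r => by
    linarith [h.left_le r, h.right_le r, h.jump_eq r, hR.nonneg (f r - fm r)]
  have h3 : ∑' r, (Icc 0 t).indicator (fun r => fp r - f r) r =
      (∑' r, (Ico 0 t).indicator (fun r => fp r - f r) r) + (fp t - f t) := by
    have hs : Summable (({t} : Set ℝ).indicator fun r => fp r - f r) := h2.indicator _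
    have h4 : ∑' r, ({t} : Set ℝ).indicator (fun r => fp r - f r) r = fp t - f t := by
      rw [← tsum_subtype]
      exact tsum_singleton t fun r => fp r - f r
    rw [← h4, ← (h2.indicator _).tsum_add hs]
    refine tsum_congr fun r => ?_
    rw [← Ico_union_right ht, indicator_union_of_disjoint (by simp)]
  have h5 : ∑' r, (Icc 0 t).indicator (fun r => fp r - fm r) r =
      (∑' r, (Icc 0 t).indicator (fun r => f r - fm r) r) +
        ∑' r, (Icc 0 t).indicator (fun r => fp r - f r) r := by
    rw [← (h1.indicator _).tsum_add (h2.indicator _)]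
    refine tsum_congr fun r => ?_
    rw [← Pi.add_apply, ← indicator_add']
    congr 2
    funext r
    exact (sub_add_sub_cancel' _ _ _).symm
  rw [contPart, jumpPart, tsum_subtype (Icc 0 t) fun r => f r - fm r,
    tsum_subtype (Ico 0 t) fun r => fp r - f r, h5, h3]
  abel

theorem tsum_indicator_Icc_add {X : Type*} [NormedAddCommGroup X] {g : ℝ → X}
    (hg : ∀ s : Set ℝ, Summable (s.indicator g)) {a s t : ℝ} (has : a ≤ s) (hst : s ≤ t) :
    ∑' r, (Icc a t).indicator g r =
      (∑' r, (Icc a s).indicator g r) + ∑' r, (Ioc s t).indicator g r := by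
  rw [← (hg _).tsum_add (hg _)]
  refine tsum_congr fun r => ?_
  rw [← Icc_union_Ioc_eq_Icc has hst, indicator_union_of_disjoint]
  exact disjoint_left.2 fun x hx hx' => not_lt.2 hx.2 hx'.1

theorem contPart_sub [CompleteSpace Z] (hR : IsDissipationPotential R)
    (h : HasDissipationFunction R f fm fp v vm vp) {s t : ℝ} (hs : 0 ≤ s) (hst : s ≤ t) :
    contPart f fm fp t - contPart f fm fp s =
      fp t - fp s - ∑' r, (Ioc s t).indicator (fun r => fp r - fm r) r := by
  have h1 : Summable fun r => fp r - fm r := h.summable_of_le hR fun r => le_rfl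
  rw [h.contPart_eq hR hs, h.contPart_eq hR (hs.trans hst),
    tsum_indicator_Icc_add (fun s => h1.indicator s) hs hst]
  abel

/-- Limit of the finite estimates: removing the jumps from f also removes their R-sizes from the
increment of v. The next lemma is the reverse triangle estimate; together they separate continuous
and jump dissipation. -/
theorem contPart_sub_le [CompleteSpace Z] (hR : IsDissipationPotential R)
    (h : HasDissipationFunction R f fm fp v vm vp) {s t : ℝ} (hs : 0 ≤ s) (hst : s ≤ t) :
    R (contPart f fm fp t - contPart f fm fp s) ≤
      vp t - vp s - ∑' r, (Ioc s t).indicator (fun r => R (fp r - fm r)) r := by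
  have h1 : Summable ((Ioc s t).indicator fun r => fp r - fm r) :=
    (h.summable_of_le hR fun r => le_rfl).indicator _
  have h2 : Summable ((Ioc s t).indicator fun r => R (fp r - fm r)) :=
    (h.summable_jump hR).indicator _
  rw [h.contPart_sub hR hs hst, le_sub_iff_add_le]
  exact le_of_tendsto' (((hR.continuous.tendsto _).comp (h1.hasSum.const_sub _)).add h2.hasSum)
    fun F => h.right_sub_sum_jump_le hR hst F

theorem right_sub_le_contPart_sub [CompleteSpace Z] (hR : IsDissipationPotential R)
    (h : HasDissipationFunction R f fm fp v vm vp) {s t : ℝ} (hs : 0 ≤ s) (hst : s ≤ t) :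
    R (fp t - fp s) ≤ R (contPart f fm fp t - contPart f fm fp s) +
      ∑' r, (Ioc s t).indicator (fun r => R (fp r - fm r)) r := by
  have h1 : Summable ((Ioc s t).indicator fun r => fp r - fm r) :=
    (h.summable_of_le hR fun r => le_rfl).indicator _
  have heq : ∀ r, R ((Ioc s t).indicator (fun r => fp r - fm r) r) =
      (Ioc s t).indicator (fun r => R (fp r - fm r)) r := fun r => by
    by_cases hr : r ∈ Ioc s t
    · rw [indicator_of_mem hr, indicator_of_mem hr]
    · rw [indicator_of_notMem hr, indicator_of_notMem hr, hR.map_zero]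
  have h2 : R (∑' r, (Ioc s t).indicator (fun r => fp r - fm r) r) ≤
      ∑' r, (Ioc s t).indicator (fun r => R (fp r - fm r)) r := by
    have := hR.tsum_le h1 (by simp_rw [heq]; exact (h.summable_jump hR).indicator _)
    simpa only [heq] using this
  have h3 := hR.add_le (contPart f fm fp t - contPart f fm fp s)
    (∑' r, (Ioc s t).indicator (fun r => fp r - fm r) r)
  rw [h.contPart_sub hR hs hst, sub_add_cancel] at h3
  rw [h.contPart_sub hR hs hst]
  linarith

/-- The part of `v` that is not due to jumps after time `0`. -/
theorem sub_tsum_eq (hR : IsDissipationPotential R)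
    (h : HasDissipationFunction R f fm fp v vm vp) {s t : ℝ} (hs : 0 ≤ s) (hst : s ≤ t) :
    ∑' r, (Ioc s t).indicator (fun r => R (fp r - fm r)) r =
      (∑' r, (Icc 0 t).indicator (fun r => R (fp r - fm r)) r) -
        ∑' r, (Icc 0 s).indicator (fun r => R (fp r - fm r)) r := by
  rw [tsum_indicator_Icc_add (fun s => (h.summable_jump hR).indicator s) hs hst]
  ring

theorem rVariation_contPart_le [CompleteSpace Z] (hR : IsDissipationPotential R)
    (h : HasDissipationFunction R f fm fp v vm vp) {s t : ℝ} (hs : 0 ≤ s) (hst : s ≤ t) :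
    RVariation R (contPart f fm fp) s t ≤
      ENNReal.ofReal (vp t - vp s - ∑' r, (Ioc s t).indicator (fun r => R (fp r - fm r)) r) := by
  refine iSup_le fun n => iSup_le fun p => iSup_le fun hp => ?_
  obtain ⟨h0, hn, hlt⟩ := hp
  have hge : ∀ k ≤ n, s ≤ p k := by
    intro k
    induction k with
    | zero => intro _; exact h0.ge
    | succ k ih => intro hk; exact (ih (by omega)).trans (hlt k (by omega)).le
  rw [← ENNReal.ofReal_sum_of_nonneg fun _ _ => hR.nonneg _]
  refine ENNReal.ofReal_le_ofReal ?_
  have hstep : ∀ k ∈ Finset.range n,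
      R (contPart f fm fp (p (k + 1)) - contPart f fm fp (p k)) ≤
        (vp (p (k + 1)) - ∑' r, (Icc 0 (p (k + 1))).indicator (fun r => R (fp r - fm r)) r) -
          (vp (p k) - ∑' r, (Icc 0 (p k)).indicator (fun r => R (fp r - fm r)) r) := by
    intro k hk
    have hk' := Finset.mem_range.1 hk
    have hpos : 0 ≤ p k := hs.trans (hge k hk'.le)
    have h1 := h.contPart_sub_le hR hpos (hlt k hk').le
    rw [h.sub_tsum_eq hR hpos (hlt k hk').le] at h1
    linarith
  refine (Finset.sum_le_sum hstep).trans_eq ?_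
  rw [Finset.sum_range_sub
    (fun k => vp (p k) - ∑' r, (Icc 0 (p k)).indicator (fun r => R (fp r - fm r)) r), h0, hn,
    h.sub_tsum_eq hR hs hst]
  ring

theorem sum_right_sub_le [CompleteSpace Z] (hR : IsDissipationPotential R)
    (h : HasDissipationFunction R f fm fp v vm vp) {s t : ℝ} (hs : 0 ≤ s) (hst : s < t) (N : ℕ) :
    ∑ n ∈ Finset.range (N + 1), R (fp (unifPt s t N (n + 1)) - fp (unifPt s t N n)) ≤
      (RVariation R (contPart f fm fp) s t).toReal +
        ∑' r, (Ioc s t).indicator (fun r => R (fp r - fm r)) r := by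
  have hstep : ∀ n ∈ Finset.range (N + 1),
      R (fp (unifPt s t N (n + 1)) - fp (unifPt s t N n)) ≤
        R (contPart f fm fp (unifPt s t N (n + 1)) - contPart f fm fp (unifPt s t N n)) +
        ((∑' r, (Icc 0 (unifPt s t N (n + 1))).indicator (fun r => R (fp r - fm r)) r) -
          ∑' r, (Icc 0 (unifPt s t N n)).indicator (fun r => R (fp r - fm r)) r) := by
    intro n hn
    have hpos : 0 ≤ unifPt s t N n :=
      hs.trans (unifPt_mem hst.le (by have := Finset.mem_range.1 hn; omega)).1
    have hle := unifPt_mono hst.le N (Nat.le_succ n)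
    rw [← h.sub_tsum_eq hR hpos hle]
    exact h.right_sub_le_contPart_sub hR hpos hle
  refine (Finset.sum_le_sum hstep).trans ?_
  rw [Finset.sum_add_distrib, Finset.sum_range_sub
    (fun k => ∑' r, (Icc 0 (unifPt s t N k)).indicator (fun r => R (fp r - fm r)) r), unifPt_last,
    unifPt_zero, h.sub_tsum_eq hR hs hst.le]
  refine add_le_add_left ?_ _
  refine (ENNReal.ofReal_le_iff_le_toReal
    (ne_top_of_le_ne_top ENNReal.ofReal_ne_top (h.rVariation_contPart_le hR hs hst.le))).1 ?_
  rw [ENNReal.ofReal_sum_of_nonneg fun _ _ => hR.nonneg _]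
  exact le_iSup_of_le (N + 1) (le_iSup_of_le (unifPt s t N)
    (le_iSup_of_le ⟨unifPt_zero .., unifPt_last .., fun k _ => unifPt_strictMono hst N (by omega)⟩ le_rfl))

/-- The jump at s counts in full and contributes `vp s - vm s`, while the variation starting from
the right limit at s sees only jumps in (s,t]. -/
theorem tsum_essJumpSet (hR : IsDissipationPotential R)
    (h : HasDissipationFunction R f fm fp v vm vp) {T : ℝ} (hl : HasOneSidedLimits T f fm fp)
    {s t : ℝ} (hs : 0 ≤ s) (hst : s ≤ t) (htT : t ≤ T) :
    ∑' r : ↥(essJumpSet T f fm fp ∩ Icc s t), R (fp r - fm r) =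
      (vp s - vm s) + ∑' r, (Ioc s t).indicator (fun r => R (fp r - fm r)) r := by
  have hsum : Summable fun r => R (fp r - fm r) := h.summable_jump hR
  have h1 : ∑' r, (Icc s t).indicator (fun r => R (fp r - fm r)) r =
      (vp s - vm s) + ∑' r, (Ioc s t).indicator (fun r => R (fp r - fm r)) r := by
    rw [tsum_indicator_Icc_add (fun s => hsum.indicator s) le_rfl hst, Icc_self, ← tsum_subtype,
      ← h.jump_eq]
    exact congrArg (· + _) (tsum_singleton s fun r => R (fp r - fm r))
  rw [← h1, tsum_subtype _ fun r => R (fp r - fm r)]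
  refine tsum_congr fun r => ?_
  by_cases hr : r ∈ Icc s t
  · rw [indicator_of_mem hr]
    by_cases hne : fp r = fm r
    · rw [hne, sub_self, hR.map_zero]
      by_cases hr' : r ∈ essJumpSet T f fm fp ∩ Icc s t
      · exact absurd hne hr'.1.2
      · exact indicator_of_notMem hr' _
    · have hrT : r ∈ Icc 0 T := ⟨hs.trans hr.1, hr.2.trans htT⟩
      have hmem : r ∈ essJumpSet T f fm fp ∩ Icc s t := ⟨⟨⟨hrT, fun hc => hne
        ((hl.eq_of_continuousWithinAt hrT hc).2.trans (hl.eq_of_continuousWithinAt hrT hc).1.symm)⟩,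
          hne⟩, hr⟩
      exact indicator_of_mem hmem _
  · rw [indicator_of_notMem hr, indicator_of_notMem fun hr' => hr hr'.2]

/-- The essential variation is the increment of the dissipation function, if the latter is
approximated by sums over partitions. -/
theorem essVariation_eq [CompleteSpace Z] (hR : IsDissipationPotential R)
    (h : HasDissipationFunction R f fm fp v vm vp) {T : ℝ} (hl : HasOneSidedLimits T f fm fp)
    {s t : ℝ} (hs : 0 ≤ s) (hst : s ≤ t) (htT : t ≤ T)
    (happ : s < t → ∀ δ > 0, ∃ N, vp t - vp s ≤
      (∑ n ∈ Finset.range (N + 1), R (fp (unifPt s t N (n + 1)) - fp (unifPt s t N n))) + δ) :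
    (RVariation R (contPart f fm fp) s t).toReal +
      ∑' r : ↥(essJumpSet T f fm fp ∩ Icc s t), R (fp r - fm r) = vp t - vm s := by
  rw [h.tsum_essJumpSet hR hl hs hst htT]
  have hupper := h.rVariation_contPart_le hR hs hst
  have hS : (0 : ℝ) ≤ vp t - vp s - ∑' r, (Ioc s t).indicator (fun r => R (fp r - fm r)) r :=
    (hR.nonneg _).trans (h.contPart_sub_le hR hs hst)
  have h1 := ENNReal.toReal_le_of_le_ofReal hS hupper
  have h2 : vp t - vp s ≤ (RVariation R (contPart f fm fp) s t).toReal +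
      ∑' r, (Ioc s t).indicator (fun r => R (fp r - fm r)) r := by
    rcases hst.eq_or_lt with rfl | hlt
    · rw [sub_self, Ioc_self]
      simp
    · refine le_of_forall_pos_le_add fun δ hδ => ?_
      obtain ⟨N, hN⟩ := happ hlt δ hδ
      linarith [h.sum_right_sub_le hR hs hlt N]
  linarith

end HasDissipationFunction

theorem IsDissipationPotential.eq_of_nonpos {Z : Type*} [NormedAddCommGroup Z] [NormedSpace ℝ Z]
    {R : Z → ℝ} (hR : IsDissipationPotential R) {x y : Z} (h : R (x - y) ≤ 0) : x = y := by
  obtain ⟨ρ₁, ρ₂, hρ1, -, hb⟩ := hR.bounds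
  have h1 := (hb (x - y)).1.trans h
  have h2 : ‖x - y‖ ≤ 0 := nonpos_of_mul_nonpos_right h1 hρ1
  exact sub_eq_zero.1 (norm_le_zero_iff.1 h2)

/-! ### Energy equality, jump identity and the essential balance. -/

namespace LimitTrajectory

variable {U W Z : Type*} [NormedAddCommGroup U] [NormedSpace ℝ U]
    [NormedAddCommGroup W] [InnerProductSpace ℝ W]
    [NormedAddCommGroup Z] [NormedSpace ℝ Z]
    {i : U →L[ℝ] W} {k : U →L[ℝ] Z} {R : Z → ℝ} {T : ℝ} {D : Set U} {E : ℝ → U → ℝ≥0∞}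
    {K : ℝ} {u um up : ℝ → U} {v : ℝ → ℝ}

theorem energy_add_le_of_tendsto (hE : IsConvexEnergy i T D E) (h : LimitTrajectory k R T D E K u v)
    {t a : ℝ} (ht : t ∈ Icc 0 T) {l : Filter ℝ} [l.NeBot] (hlt : l ≤ 𝓝 t)
    (hlI : ∀ᶠ r in l, r ∈ Icc 0 T) {z : U}
    (hz : ∀ φ : StrongDual ℝ U, Tendsto (fun r => φ (u r)) l (𝓝 (φ z))) (ha : Tendsto v l (𝓝 a)) :
    (E t z).toReal + a ≤ (E 0 (u 0)).toReal + ∫ r in (0 : ℝ)..t, power E r (u r) := by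
  have h0 : (0 : ℝ) ∈ Icc 0 T := ⟨le_rfl, ht.1.trans ht.2⟩
  have h1 := (h.power_integrable.tendsto_integral_of_tendsto (l := l)
    (s := fun _ => (0 : ℝ)) tendsto_const_nhds (Eventually.of_forall fun _ => h0) h0
    (t := fun r => r) (tendsto_id.mono_left hlt) hlI ht).const_add (E 0 (u 0)).toReal
  have h2 := hE.energy_le_of_tendsto' (s := fun r => r) hz (Eventually.of_forall h.mem)
    (tendsto_id.mono_left hlt) hlI ht (h1.sub ha) (by
      filter_upwards [hlI] with r hr
      linarith [h.energy_le r hr])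
  linarith

theorem energy_right_le (hk : Function.Injective k) (hE : IsConvexEnergy i T D E)
    (h : LimitTrajectory k R T D E K u v) (hl : WeakOneSidedLimits k D E K u um up) {t : ℝ}
    (ht : t ∈ Icc 0 T) : (E t (up t)).toReal + Function.rightLim v t ≤
      (E 0 (u 0)).toReal + ∫ r in (0 : ℝ)..t, power E r (u r) := by
  rcases ht.2.eq_or_lt with rfl | hlt
  · rw [(h.right_eq hk hl le_rfl).1, (h.right_eq hk hl le_rfl).2]
    exact h.energy_le t ht
  · refine h.energy_add_le_of_tendsto hE ht (l := 𝓝[>] t) nhdsWithin_le_nhds ?_ (hl.weak_right t)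
      (h.mono.tendsto_rightLim t)
    filter_upwards [Ioo_mem_nhdsGT hlt] with r hr using ⟨ht.1.trans hr.1.le, hr.2.le⟩

theorem energy_left_le (hk : Function.Injective k) (hE : IsConvexEnergy i T D E)
    (h : LimitTrajectory k R T D E K u v) (hl : WeakOneSidedLimits k D E K u um up) {t : ℝ}
    (ht : t ∈ Icc 0 T) : (E t (um t)).toReal + Function.leftLim v t ≤
      (E 0 (u 0)).toReal + ∫ r in (0 : ℝ)..t, power E r (u r) := by
  rcases ht.1.eq_or_lt with rfl | hlt
  · rw [(h.left_eq hk hl le_rfl).1, (h.left_eq hk hl le_rfl).2]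
    simp
  · refine h.energy_add_le_of_tendsto hE ht (l := 𝓝[<] t) nhdsWithin_le_nhds ?_ (hl.weak_left t)
      (h.mono.tendsto_leftLim t)
    filter_upwards [Ioo_mem_nhdsLT hlt] with r hr using ⟨hr.1.le, hr.2.le.trans ht.2⟩

theorem right_eq_of_continuousAt (hk : Function.Injective k) (hR : IsDissipationPotential R)
    (h : LimitTrajectory k R T D E K u v) (hl : WeakOneSidedLimits k D E K u um up) {t : ℝ}
    (hc : ContinuousAt v t) : up t = u t := by
  have h1 := h.right_sub_le hR hl t
  rw [(h.mono.continuousWithinAt_Ioi_iff_rightLim_eq.1 hc.continuousWithinAt), sub_self] at h1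
  exact hk (hR.eq_of_nonpos h1)

theorem ae_right_eq (hk : Function.Injective k) (hR : IsDissipationPotential R)
    (h : LimitTrajectory k R T D E K u v) (hl : WeakOneSidedLimits k D E K u um up) :
    ∀ᵐ t, up t = u t := by
  filter_upwards [h.mono.countable_not_continuousAt.ae_notMem volume] with t ht
  exact h.right_eq_of_continuousAt hk hR hl (not_not.1 ht)

/-- At continuity points of the right limit of v the right-limit curve is continuous in Z, hence
weakly in U, hence strongly in W by compactness. The W-norm is the one in power continuity. -/
theorem ae_tendsto_right (hU : IsReflexiveSpace U) (hi : IsCompactOperator i)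
    (hk : Function.Injective k) (hR : IsDissipationPotential R) (hT : 0 ≤ T)
    (hE : IsConvexEnergy i T D E) (h : LimitTrajectory k R T D E K u v)
    (hl : WeakOneSidedLimits k D E K u um up) :
    ∀ᵐ t, Tendsto (fun r => i (up r)) (𝓝 t) (𝓝 (i (up t))) := by
  obtain ⟨ρ, hρ⟩ := hE.exists_bound K hT
  obtain ⟨ρ₁, ρ₂, hρ1, -, hb⟩ := hR.bounds
  filter_upwards [h.mono.rightLim.countable_not_continuousAt.ae_notMem volume] with t ht
  have hc : ContinuousAt (Function.rightLim v) t := not_not.1 ht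
  have hk' : Tendsto (fun r => k (up r)) (𝓝 t) (𝓝 (k (up t))) := by
    rw [tendsto_iff_dist_tendsto_zero]
    have h0 := (tendsto_iff_dist_tendsto_zero.1 hc.tendsto).const_mul ρ₁⁻¹
    rw [mul_zero] at h0
    refine squeeze_zero (fun _ => dist_nonneg) (fun r => ?_) h0
    have hdist : ∀ a b, a ≤ b → dist (k (up b)) (k (up a)) ≤
        ρ₁⁻¹ * dist (Function.rightLim v b) (Function.rightLim v a) := fun a b hab => by
      rw [dist_eq_norm, Real.dist_eq, abs_of_nonneg (sub_nonneg.2 (h.mono.rightLim hab)),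
        inv_mul_eq_div, le_div_iff₀ hρ1, mul_comm]
      exact (hb _).1.trans (h.right_sub_right_le hR hl hab)
    rcases le_total t r with hr | hr
    · exact hdist t r hr
    · rw [dist_comm, dist_comm (Function.rightLim v r)]
      exact hdist r t hr
  have hbd : ∀ᶠ r in 𝓝 t, ‖up r‖ ≤ ρ := Eventually.of_forall fun r => hρ _ (hl.mem_right r)
  obtain ⟨z, hz, hzw⟩ := hU.exists_weak_limit hk hbd hk'
  rw [← hk hz]
  exact hi.tendsto_of_weak hbd hzw

/-- Lower energy estimate for a curve that coincides with the right limits inside `(s,t)`. -/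
theorem exists_partition_energy_le (hU : IsReflexiveSpace U) (hi : IsCompactOperator i)
    (hk : Function.Injective k) (hR : IsDissipationPotential R)
    (hE : IsConvexEnergy i T D E) (h : LimitTrajectory k R T D E K u v)
    (hl : WeakOneSidedLimits k D E K u um up) {w : ℝ → U} {s t : ℝ} (hs : 0 ≤ s) (ht : t ≤ T)
    (hst : s < t) (hw : ∀ r ∈ Ioo s t, w r = up r) (hws : w s ∈ energySublevel D E K)
    (hwt : w t ∈ energySublevel D E K) (hstab : IsGloballyStable k R E s (w s)) {δ : ℝ}
    (hδ : 0 < δ) :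
    ∃ N : ℕ, (E s (w s)).toReal + ∫ r in s..t, power E r (u r) ≤ (E t (w t)).toReal +
      (∑ n ∈ Finset.range (N + 1),
        R (k (w (unifPt s t N (n + 1))) - k (w (unifPt s t N n)))) + δ := by
  have hT : 0 ≤ T := hs.trans (hst.le.trans ht)
  have hsT : s ∈ Icc 0 T := ⟨hs, hst.le.trans ht⟩
  have htT : t ∈ Icc 0 T := ⟨hs.trans hst.le, ht⟩
  have hne : ∀ᵐ r : ℝ, r ≠ t := (countable_singleton t).ae_notMem volume
  have hint : ∫ r in s..t, power E r (u r) = ∫ r in s..t, power E r (w r) := by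
    refine intervalIntegral.integral_congr_ae ?_
    filter_upwards [h.ae_right_eq hk hR hl, hne] with r hr hrt hrm
    rw [uIoc_of_le hst.le] at hrm
    rw [hw r ⟨hrm.1, lt_of_le_of_ne hrm.2 hrt⟩, hr]
  rw [hint]
  refine hE.exists_partition_energy_le hR hsT htT hst (K := K) (fun r hr => ?_) (fun r hr => ?_) ?_
    hδ
  · rcases hr.1.eq_or_lt with rfl | h1
    · exact hws
    rcases hr.2.eq_or_lt with rfl | h2
    · exact hwt
    · rw [hw r ⟨h1, h2⟩]
      exact hl.mem_right r
  · rcases hr.1.eq_or_lt with rfl | h1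
    · exact hstab
    · rw [hw r ⟨h1, hr.2⟩]
      exact h.isGloballyStable_right hR hE hl ⟨hs.trans hr.1, hr.2.trans_le ht⟩
  · filter_upwards [h.ae_tendsto_right hU hi hk hR hT hE hl, hne] with r hr hrt hrm
    have hrI : r ∈ Ioo s t := ⟨hrm.1, lt_of_le_of_ne hrm.2 hrt⟩
    rw [hw r hrI]
    refine (hr.congr' ?_).mono_left nhdsWithin_le_nhds
    filter_upwards [isOpen_Ioo.mem_nhds hrI] with τ hτ
    rw [hw τ hτ]

/-- The partition estimate on [0,t] for the curve with value u₀ at 0, the right limits inside, and z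
at t. Leaving z and a free covers both u⁺(t) and u⁻(t). -/
theorem energy_ge (hU : IsReflexiveSpace U) (hi : IsCompactOperator i)
    (hk : Function.Injective k) (hR : IsDissipationPotential R)
    (hE : IsConvexEnergy i T D E) (h : LimitTrajectory k R T D E K u v)
    (hl : WeakOneSidedLimits k D E K u um up) {t : ℝ} (ht : t ∈ Ioc 0 T) {z : U} {a : ℝ}
    (hz : z ∈ energySublevel D E K)
    (ha : ∀ r < t, R (k z - k (up r)) ≤ a - Function.rightLim v r) :
    (E 0 (u 0)).toReal + (∫ r in (0 : ℝ)..t, power E r (u r)) ≤ (E t z).toReal + a := by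
  refine le_of_forall_pos_le_add fun δ hδ => ?_
  let w : ℝ → U := fun r => if r = 0 then u 0 else if r = t then z else up r
  -- The dissipation values matching `w`, chosen so that increments of `w` are dominated by
  -- telescoping increments of `ν`.
  let ν : ℝ → ℝ := fun r => if r = 0 then 0 else if r = t then a else Function.rightLim v r
  have hw0 : w 0 = u 0 := if_pos rfl
  have hwt : w t = z := by simp only [w, if_neg ht.1.ne', if_true]
  have hν0 : ν 0 = 0 := if_pos rfl
  have hνt : ν t = a := by simp only [ν, if_neg ht.1.ne', if_true]
  have hwr : ∀ r ∈ Ioo 0 t, w r = up r := fun r hr => by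
    simp only [w, if_neg hr.1.ne', if_neg hr.2.ne]
  have hνr : ∀ r ∈ Ioo 0 t, ν r = Function.rightLim v r := fun r hr => by
    simp only [ν, if_neg hr.1.ne', if_neg hr.2.ne]
  have h1 : ∀ r ∈ Ico 0 t, R (k (up r) - k (w r)) ≤ Function.rightLim v r - ν r := by
    intro r hr
    rcases hr.1.eq_or_lt with rfl | hr0
    · rw [hw0, hν0]
      simpa only [h.zero] using h.right_sub_le hR hl 0
    · rw [hwr r ⟨hr0, hr.2⟩, hνr r ⟨hr0, hr.2⟩]
      simp [hR.map_zero]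
  have h2 : ∀ r r', r < r' → r' ∈ Ioc 0 t → R (k (w r') - k (up r)) ≤
      ν r' - Function.rightLim v r := by
    intro r r' hrr hr'
    rcases hr'.2.eq_or_lt with rfl | hlt
    · rw [hwt, hνt]
      exact ha r hrr
    · rw [hwr r' ⟨hr'.1, hlt⟩, hνr r' ⟨hr'.1, hlt⟩]
      exact h.right_sub_right_le hR hl hrr.le
  obtain ⟨N, hN⟩ := h.exists_partition_energy_le hU hi hk hR hE hl (w := w) le_rfl ht.2 ht.1 hwr
    (by rw [hw0]; exact h.mem 0) (by rwa [hwt]) (by rw [hw0]; exact h.stable_zero) hδ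
  rw [hw0, hwt] at hN
  have hsum : ∑ n ∈ Finset.range (N + 1),
      R (k (w (unifPt 0 t N (n + 1))) - k (w (unifPt 0 t N n))) ≤ a := by
    refine (Finset.sum_le_sum (g := fun n => ν (unifPt 0 t N (n + 1)) - ν (unifPt 0 t N n))
      fun n hn => ?_).trans_eq ?_
    · have hn' := Finset.mem_range.1 hn
      have hm1 : unifPt 0 t N n ∈ Icc 0 t := unifPt_mem ht.1.le (by omega)
      have hm2 : unifPt 0 t N (n + 1) ∈ Icc 0 t := unifPt_mem ht.1.le (by omega)
      have hlt : unifPt 0 t N n < unifPt 0 t N (n + 1) := unifPt_strictMono ht.1 N (by omega)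
      have h3 := h1 _ ⟨hm1.1, hlt.trans_le hm2.2⟩
      have h4 := h2 _ _ hlt ⟨hm1.1.trans_lt hlt, hm2.2⟩
      -- The right limit at the left node is inserted; this matters only at time 0, where the curve
      -- takes the value u₀ instead.
      have h5 := hR.sub_le (k (w (unifPt 0 t N (n + 1)))) (k (up (unifPt 0 t N n)))
        (k (w (unifPt 0 t N n)))
      linarith
    · rw [Finset.sum_range_sub (fun n => ν (unifPt 0 t N n)), unifPt_last, unifPt_zero, hνt, hν0,
        sub_zero]
  linarith

theorem energy_right_eq (hU : IsReflexiveSpace U) (hi : IsCompactOperator i)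
    (hk : Function.Injective k) (hR : IsDissipationPotential R)
    (hE : IsConvexEnergy i T D E) (h : LimitTrajectory k R T D E K u v)
    (hl : WeakOneSidedLimits k D E K u um up) {t : ℝ} (ht : t ∈ Icc 0 T) :
    (E t (up t)).toReal + Function.rightLim v t =
      (E 0 (u 0)).toReal + ∫ r in (0 : ℝ)..t, power E r (u r) := by
  refine (h.energy_right_le hk hE hl ht).antisymm ?_
  rcases ht.1.eq_or_lt with rfl | h0
  -- At time 0 there is no interval to partition; stability of u₀ against u⁺(0) gives the estimate
  -- directly.
  · have h1 := h.stable_zero.toReal_le hE hR ht (hl.mem_right 0).1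
    have h2 := h.right_sub_le hR hl 0
    rw [h.zero] at h2
    rw [map_sub] at h1
    rw [intervalIntegral.integral_same]
    linarith
  · exact h.energy_ge hU hi hk hR hE hl ⟨h0, ht.2⟩ (hl.mem_right t)
      fun r hr => h.right_sub_right_le hR hl hr.le

theorem energy_left_eq (hU : IsReflexiveSpace U) (hi : IsCompactOperator i)
    (hk : Function.Injective k) (hR : IsDissipationPotential R)
    (hE : IsConvexEnergy i T D E) (h : LimitTrajectory k R T D E K u v)
    (hl : WeakOneSidedLimits k D E K u um up) {t : ℝ} (ht : t ∈ Icc 0 T) :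
    (E t (um t)).toReal + Function.leftLim v t =
      (E 0 (u 0)).toReal + ∫ r in (0 : ℝ)..t, power E r (u r) := by
  refine (h.energy_left_le hk hE hl ht).antisymm ?_
  rcases ht.1.eq_or_lt with rfl | h0
  · rw [(h.left_eq hk hl le_rfl).1, (h.left_eq hk hl le_rfl).2]
    simp
  · exact h.energy_ge hU hi hk hR hE hl ⟨h0, ht.2⟩ (hl.mem_left t)
      fun r hr => h.left_sub_right_le hR hl hr

/-- The left and right energy equalities give v⁺ - v⁻ = E(t,u⁻) - E(t,u⁺), and stability of u⁻
against u⁺ bounds this by R(u⁺ - u⁻). No dissipation beyond R is created at jumps. -/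
theorem jump_eq (hU : IsReflexiveSpace U) (hi : IsCompactOperator i)
    (hk : Function.Injective k) (hR : IsDissipationPotential R)
    (hE : IsConvexEnergy i T D E) (h : LimitTrajectory k R T D E K u v)
    (hl : WeakOneSidedLimits k D E K u um up) (t : ℝ) :
    R (k (up t) - k (um t)) = Function.rightLim v t - Function.leftLim v t := by
  refine (h.right_sub_left_le hR hl t).antisymm ?_
  by_cases ht : t ∈ Icc 0 T
  · have h1 := h.energy_right_eq hU hi hk hR hE hl ht
    have h2 := h.energy_left_eq hU hi hk hR hE hl ht
    have hst : IsGloballyStable k R E t (um t) := by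
      rcases ht.1.eq_or_lt with rfl | h0
      · rw [(h.left_eq hk hl le_rfl).1]
        exact h.stable_zero
      · exact h.isGloballyStable_left hR hE hl ⟨h0, ht.2⟩
    have h3 := hst.toReal_le hE hR ht (hl.mem_right t).1
    rw [map_sub] at h3
    linarith
  -- Outside [0,T] the function v is locally constant, so both sides of the identity vanish.
  · have hc : ContinuousAt v t := by
      rcases lt_or_ge t 0 with h0 | h0
      · refine tendsto_const_nhds.congr' ?_
        filter_upwards [Iio_mem_nhds h0] with r hr
        rw [(h.const_left t h0.le).2, (h.const_left r hr.le).2]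
      · have hT : T < t := by
          by_contra hT
          exact ht ⟨h0, not_lt.1 hT⟩
        refine tendsto_const_nhds.congr' ?_
        filter_upwards [Ioi_mem_nhds hT] with r hr
        rw [(h.const_right t hT.le).2, (h.const_right r hr.le).2]
    rw [h.mono.continuousWithinAt_Ioi_iff_rightLim_eq.1 hc.continuousWithinAt,
      h.mono.continuousWithinAt_Iio_iff_leftLim_eq.1 hc.continuousWithinAt, sub_self]
    exact hR.nonneg _

theorem hasDissipationFunction (hU : IsReflexiveSpace U) (hi : IsCompactOperator i)
    (hk : Function.Injective k) (hR : IsDissipationPotential R)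
    (hE : IsConvexEnergy i T D E) (h : LimitTrajectory k R T D E K u v)
    (hl : WeakOneSidedLimits k D E K u um up) :
    HasDissipationFunction R (fun t => k (u t)) (fun t => k (um t)) (fun t => k (up t)) v
      (Function.leftLim v) (Function.rightLim v) where
  left_le := h.sub_left_le hR hl
  right_le := h.right_sub_le hR hl
  between_le _ _ hst := h.left_sub_right_le hR hl hst
  jump_eq := h.jump_eq hU hi hk hR hE hl
  bounded := by
    refine ⟨v T - v 0, fun s t => sub_le_sub ?_ ?_⟩
    · rw [← (h.right_eq hk hl (le_max_right t T)).2]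
      exact h.mono.rightLim (le_max_left _ _)
    · have h1 := h.mono.le_rightLim (le_refl s)
      rcases le_total 0 s with h0 | h0
      · exact (h.mono h0).trans h1
      · rwa [(h.const_left s h0).2] at h1

theorem isEssentialEnergeticSolution [CompleteSpace Z] (hU : IsReflexiveSpace U)
    (hi : IsCompactOperator i) (hk : Function.Injective k) (hR : IsDissipationPotential R)
    (hT : 0 < T) (hE : IsConvexEnergy i T D E) (h : LimitTrajectory k R T D E K u v) :
    IsEssentialEnergeticSolution k R T D E (u 0) u := by
  obtain ⟨um, up, hl⟩ := h.exists_weakOneSidedLimits hU hk hR hT hE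
  have hd := h.hasDissipationFunction hU hi hk hR hE hl
  have hlim : HasOneSidedLimits T (fun t => k (u t)) (fun t => k (um t)) (fun t => k (up t)) :=
    ⟨congrArg k (h.left_eq hk hl le_rfl).1, congrArg k (h.right_eq hk hl le_rfl).1,
      fun t _ => hl.left t, fun t _ => hl.right t⟩
  refine ⟨fun t _ => (h.mem t).1, h.memB, ?_, rfl, fun t ht => ?_, h.power_integrable, um, up,
    fun t _ => ⟨(hl.mem_left t).1, (hl.mem_right t).1⟩, hlim, fun s t hs hst htT => ?_⟩
  · obtain ⟨c, hc⟩ := h.exists_dist_le hR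
    refine ne_top_of_le_ne_top (ENNReal.ofReal_ne_top (r := |c| * (v T - v 0))) ?_
    refine iSup_le fun p => ?_
    simp_rw [edist_dist]
    rw [← ENNReal.ofReal_sum_of_nonneg fun _ _ => dist_nonneg]
    refine ENNReal.ofReal_le_ofReal ?_
    refine (Finset.sum_le_sum
      (g := fun j => |c| * (v (p.2.1 (j + 1)) - v (p.2.1 j))) fun j _ => ?_).trans ?_
    · refine (hc _ _).trans ?_
      rw [Real.dist_eq, abs_of_nonneg (sub_nonneg.2 (h.mono (p.2.2.1 j.le_succ)))]
      exact mul_le_mul_of_nonneg_right (le_abs_self c)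
        (sub_nonneg.2 (h.mono (p.2.2.1 j.le_succ)))
    · rw [← Finset.mul_sum, Finset.sum_range_sub fun j => v (p.2.1 j)]
      exact mul_le_mul_of_nonneg_left
        (sub_le_sub (h.mono (p.2.2.2 _).2) (h.mono (p.2.2.2 _).1)) (abs_nonneg c)
  -- Off the jump set u(t) is its own left limit, which is stable; time 0 relies on the assumption
  -- on u₀.
  · have hc : ContinuousWithinAt (fun t => k (u t)) (Icc 0 T) t := by
      by_contra hc
      exact ht.2 ⟨ht.1, hc⟩
    rcases ht.1.1.eq_or_lt with rfl | h0
    · exact h.stable_zero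
    · rw [← hk (hlim.eq_of_continuousWithinAt ht.1 hc).1]
      exact h.isGloballyStable_left hR hE hl ⟨h0, ht.1.2⟩
  · have hsT : s ∈ Icc 0 T := ⟨hs, hst.trans htT⟩
    have htT' : t ∈ Icc 0 T := ⟨hs.trans hst, htT⟩
    have h0T : (0 : ℝ) ∈ Icc 0 T := ⟨le_rfl, hT.le⟩
    have hes := h.energy_right_eq hU hi hk hR hE hl hsT
    have hel := h.energy_left_eq hU hi hk hR hE hl hsT
    have het := h.energy_right_eq hU hi hk hR hE hl htT'
    have hP := intervalIntegral.integral_add_adjacent_intervals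
      (h.power_integrable.intervalIntegrable_of_mem_Icc h0T hsT)
      (h.power_integrable.intervalIntegrable_of_mem_Icc hsT htT')
    refine ⟨ne_top_of_le_ne_top ENNReal.ofReal_ne_top (hd.rVariation_contPart_le hR hs hst),
      (hd.summable_jump hR).subtype _, ?_⟩
    rw [hd.essVariation_eq hR hlim hs hst htT fun hlt δ hδ => ?_]
    · linarith
    -- By the energy equalities at s and t, the lower estimate for the right limits says that
    -- partition sums exhaust v⁺(t) - v⁺(s).
    · obtain ⟨N, hN⟩ := h.exists_partition_energy_le hU hi hk hR hE hl (w := up) hs htT hlt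
        (fun _ _ => rfl) (hl.mem_right s) (hl.mem_right t)
        (h.isGloballyStable_right hR hE hl ⟨hs, hlt.trans_le htT⟩) hδ
      exact ⟨N, by linarith⟩

end LimitTrajectory

/-! ### Initial data and conclusion. -/

theorem tendsto_initial_energy {W : Type*} [NormedAddCommGroup W] [InnerProductSpace ℝ W]
    {MW : W →L[ℝ] W} {ε e : ℕ → ℝ} {w : ℕ → W} {e₀ : ℝ}
    (hw : Tendsto (fun n => ε n • w n) atTop (𝓝 0)) (he : Tendsto e atTop (𝓝 e₀)) :
    Tendsto (fun n => ε n ^ 2 / 2 * inner ℝ (MW (w n)) (w n) + e n) atTop (𝓝 e₀) := by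
  -- The factor ε² is shared between the two slots of the quadratic form, so the initial kinetic
  -- energy vanishes.
  have h1 : Tendsto (fun n => 1 / 2 * inner ℝ (MW (ε n • w n)) (ε n • w n)) atTop (𝓝 0) := by
    have := (((MW.continuous.tendsto _).comp hw).inner (𝕜 := ℝ) hw).const_mul (1 / 2)
    simpa [Function.comp_def] using this
  have h2 := h1.add he
  rw [zero_add] at h2
  refine h2.congr fun n => ?_
  rw [map_smul, inner_smul_left, inner_smul_right, RCLike.conj_to_real]
  ring

theorem mainTheorem2 {U V W Z : Type*}
    [NormedAddCommGroup U] [NormedSpace ℝ U] [CompleteSpace U] [TopologicalSpace.SeparableSpace U]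
    [NormedAddCommGroup V] [InnerProductSpace ℝ V] [CompleteSpace V]
    [NormedAddCommGroup W] [InnerProductSpace ℝ W] [CompleteSpace W]
    [NormedAddCommGroup Z] [NormedSpace ℝ Z] [CompleteSpace Z]
    -- the functional framework
    (hU : IsReflexiveSpace U)
    (iUV : U →L[ℝ] V) (iVW : V →L[ℝ] W) (iWZ : W →L[ℝ] Z)
    (hUV : IsContDenseEmbedding iUV) (hVW : IsContDenseEmbedding iVW) (hWZ : IsContDenseEmbedding iWZ)
    (hUW : IsCompactOperator (iVW.comp iUV))
    -- mass, viscosity, dissipation, energy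
    (M : StrongDual ℝ U ≃L[ℝ] StrongDual ℝ U) (MW : W →L[ℝ] W)
    (hM : IsMassOperator (iVW.comp iUV) M MW)
    (VV : V →L[ℝ] StrongDual ℝ V) (hVV : IsViscosityOperator VV)
    (R : Z → ℝ) (hR : IsDissipationPotential R)
    (T : ℝ) (hT : 0 < T) (D : Set U) (E : ℝ → U → ℝ≥0∞)
    (hE : IsConvexEnergy (iVW.comp iUV) T D E)
    -- dynamic solutions for parameters tending to zero
    (ε : ℕ → ℝ) (hεpos : ∀ n, 0 < ε n) (hε : Tendsto ε atTop (𝓝 0))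
    (u₀ε : ℕ → U) (u₁ε : ℕ → V) (hu₀D : ∀ n, u₀ε n ∈ D)
    (uε : ℕ → ℝ → U)
    (huε : ∀ n, IsDissipativeDynamicSolution iUV iVW iWZ M MW VV R T D E
      (ε n) (u₀ε n) (u₁ε n) (uε n))
    -- convergence of the initial data
    (u₀ : U)
    (hu₁ : Tendsto (fun n => ε n • iVW (u₁ε n)) atTop (𝓝 0))
    (hu₀ : ∀ φ : StrongDual ℝ U, Tendsto (fun n => φ (u₀ε n)) atTop (𝓝 (φ u₀)))
    (hEu₀ : Tendsto (fun n => E 0 (u₀ε n)) atTop (𝓝 (E 0 u₀)))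
    (hstab : IsGloballyStable (iWZ.comp (iVW.comp iUV)) R E 0 u₀) :
    ∃ (u : ℝ → U) (κ : ℕ → ℕ), StrictMono κ ∧
      -- weak convergence in `U` at every time
      (∀ t ∈ Icc 0 T, ∀ φ : StrongDual ℝ U,
        Tendsto (fun j => φ (uε (κ j) t)) atTop (𝓝 (φ (u t)))) ∧
      -- strong convergence in `V` of the rescaled velocities at almost every time
      (∀ duV : ℕ → ℝ → V,
        (∀ j, HasSobolevDeriv T (fun t => iUV (uε (κ j) t)) (duV j)) →
        ∀ᵐ t ∂(volume.restrict (Icc 0 T)),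
          Tendsto (fun j => ε (κ j) • duV j t) atTop (𝓝 0)) ∧
      -- the limit `u ∈ B([0,T];U) ∩ BV([0,T];Z)` is an essential energetic solution
      IsEssentialEnergeticSolution (iWZ.comp (iVW.comp iUV)) R T D E u₀ u := by
  have hi : Function.Injective (iVW.comp iUV) := hVW.injective.comp hUV.injective
  have hk : Function.Injective (iWZ.comp (iVW.comp iUV)) := hWZ.injective.comp hi
  have h0 : (0 : ℝ) ∈ Icc 0 T := ⟨le_rfl, hT.le⟩
  choose hinit du duV ddu htraj using fun n => (huε n).exists_viscousTrajectory hR hT hE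
  -- Stability of u₀ against any point of D makes its energy finite, as needed to read the
  -- convergence of energies in ℝ.
  have hfin : E 0 u₀ ≠ ⊤ := by
    obtain ⟨y, hy⟩ := hE.nonempty
    exact ne_top_of_le_ne_top (ENNReal.add_ne_top.2 ⟨hE.ne_top h0 hy, ENNReal.ofReal_ne_top⟩)
      (hstab y)
  obtain ⟨K, w, v, κ, hκ, hconv, hvel, hw0, hlim⟩ := exists_limitTrajectory hU hi hWZ.injective hUW
    hVV hR hM hT hE hεpos hε htraj
    (tendsto_initial_energy hu₁ ((ENNReal.tendsto_toReal hfin).comp hEu₀))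
    (by simpa only [hinit] using hu₀) hstab
  refine ⟨w, κ, hκ, hconv, fun duV' hd => ?_, ?_⟩
  · filter_upwards [hvel, ae_all_iff.2 fun j => (hd j).ae_eq (htraj (κ j)).sobolev] with t ht heq
    exact ht.congr fun j => by rw [heq j]
  · rw [← hw0]
    exact hlim.isEssentialEnergeticSolution hU hUW hk hR hT hE
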